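/- Let $p,q\in\mathbb{N}_0$, $\alpha_1,\dots,\alpha_p,\beta_1,\dots,\beta_q\in\mathbb{R}$. For $z\in\mathbb{R}$ let $\langle z\rangle$ denote the mean-preserving stochastic rounding of $z$: the random integer that equals $\lfloor z\rfloor$ with probability $1-(z-\lfloor z\rfloor)$ and $\lfloor z\rfloor+1$ with probability $z-\lfloor z\rfloor$. Let $(\epsilon_t)$ be i.i.d. $\mathbb{Z}$-valued random variables and consider the MRARMA$(p,q)$ recursion $$X_t=\epsilon_t+\langle Z_{t-1}\rangle,\qquad Z_{t-1}=\alpha_1X_{t-1}+\dots+\alpha_pX_{t-p}+\beta_1\epsilon_{t-1}+\dots+\beta_q\epsilon_{t-q},$$ where at each time $t$ the rounding is executed independently of the innovation $\epsilon_t$ and of the past. The vector $Y_t=(X_t,\dots,X_{t-p+1},\epsilon_t,\dots,\epsilon_{t-q+1})$ is then a homogeneous Markov chain on $\mathbb{Z}^{p+q}$. Let $A$ be the real $(p+q)\times(p+q)$ matrix for which $Y_t=\langle AY_{t-1}\rangle+\eta_t$ (rounding component-wise), where $\eta_t$ has the entry $\epsilon_t$ in the coordinates of $X_t$ and $\epsilon_t$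 and is $0$ elsewhere: the row of $A$ belonging to $X_t$ (if $p\ge1$) is $(\alpha_1,\dots,\alpha_p,\beta_1,\dots,\beta_q)$, the row belonging to $\epsilon_t$ (if $q\ge1$) is zero, and each remaining row has a single entry $1$, in the column immediately to the left of the diagonal, and zeros elsewhere. For $x\in\mathbb{Z}^{p+q}$ write $\|x\|_1=\sum_i|x_i|$. Assume: (i) $P(\epsilon_t=a)>0$ for every $a\in\mathbb{Z}$; (ii) $E|\epsilon_t|^k<\infty$ for some real $k\ge1$; (iii) $\alpha_p\ne0$ (if $p\ge1$), $\beta_q\ne0$ (if $q\ge1$), and the spectral radius of $A$ satisfies $\rho(A)<1$. Then: (1) the Markov chain $(Y_t)$ has a unique invariant probability measure $\lambda$ on $\mathbb{Z}^{p+q}$, and $\int\|x\|_1^k\,d\lambda(x)<\infty$; (2) for every $y\in\mathbb{Z}^{p+q}$ and every real-valued $f\in L^1(\lambda)$, $$\frac1n\sum_{m=1}^n f(Y_m)\longrightarrow\int f\,d\lambda\qquad P_y\text{-almost surely},$$ where $P_y$ is the law of the chain $(Y_t)_{t\ge0}$ started at $Y_0=y$. -/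

import Mathlib

open MeasureTheory ProbabilityTheory Filter
open scoped Topology

noncomputable section

namespace MRARMA

/-- The law on `ℤ` of the mean-preserving (stochastic) rounding `⟨z⟩` of a real number `z`:
`⌊z⌋` with probability `1 - (z - ⌊z⌋)` and `⌊z⌋ + 1` with probability `z - ⌊z⌋`. -/
def roundLaw (z : ℝ) : Measure ℤ :=
  ENNReal.ofReal (1 - Int.fract z) • Measure.dirac ⌊z⌋ +
    ENNReal.ofReal (Int.fract z) • Measure.dirac (⌊z⌋ + 1)

instance isProbabilityMeasure_roundLaw (z : ℝ) : IsProbabilityMeasure (roundLaw z) := by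
  constructor
  have h0 := Int.fract_nonneg z
  have h1 := (Int.fract_lt_one z).le
  simp only [roundLaw, Measure.add_apply, Measure.smul_apply, measure_univ, smul_eq_mul, mul_one]
  rw [← ENNReal.ofReal_add (by linarith) h0]
  simp

/-- The state space `ℤ^{p+q}` of the vectorised process
`Y_t = (X_t, …, X_{t-p+1}, ε_t, …, ε_{t-q+1})`: coordinate `inl i` is `X_{t-i}`,
coordinate `inr j` is `ε_{t-j}` (indices counted from `0`). -/
abbrev State (p q : ℕ) : Type := Fin p ⊕ Fin q → ℤ

variable {p q : ℕ}

/-- The linear predictor `∑ i, α_i X_{t-i} + ∑ j, β_j ε_{t-j}` evaluated at a state. -/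
def predictor (α : Fin p → ℝ) (β : Fin q → ℝ) (y : State p q) : ℝ :=
  ∑ i, α i * (y (Sum.inl i) : ℝ) + ∑ j, β j * (y (Sum.inr j) : ℝ)

/-- The state following `y` when the new innovation is `e` and the rounded predictor is `r`:
the new observation is `e + r`, all other entries are shifted by one lag. -/
def step (y : State p q) (e r : ℤ) : State p q
  | Sum.inl i => if i.val = 0 then e + r
      else y (Sum.inl ⟨i.val - 1, lt_of_le_of_lt (Nat.sub_le _ _) i.isLt⟩)
  | Sum.inr j => if j.val = 0 then e
      else y (Sum.inr ⟨j.val - 1, lt_of_le_of_lt (Nat.sub_le _ _) j.isLt⟩)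

/-- The transition kernel of `(Y_t)` when the innovations have law `ν`: given `Y_{t-1} = y`, the
innovation and the rounding of the predictor are drawn independently. -/
def transition (α : Fin p → ℝ) (β : Fin q → ℝ) (ν : Measure ℤ) :
    Kernel (State p q) (State p q) :=
  Kernel.ofFunOfCountable fun y =>
    (ν.prod (roundLaw (predictor α β y))).map fun er => step y er.1 er.2

instance isMarkovKernel_transition (α : Fin p → ℝ) (β : Fin q → ℝ) (ν : Measure ℤ)
    [IsProbabilityMeasure ν] : IsMarkovKernel (transition α β ν) :=
  ⟨fun _ => Measure.isProbabilityMeasure_map (measurable_of_countable _).aemeasurable⟩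

/-- The law `P_y` on path space `(Y_0, Y_1, Y_2, …)` of the Markov chain with kernel
`transition α β ν` started at `Y_0 = y`. -/
def pathLaw (α : Fin p → ℝ) (β : Fin q → ℝ) (ν : Measure ℤ) [IsProbabilityMeasure ν]
    (y : State p q) : Measure (ℕ → State p q) :=
  Kernel.traj (X := fun _ => State p q)
    (fun n => (transition α β ν).comap
      (fun h : (i : Finset.Iic n) → State p q => h ⟨n, Finset.mem_Iic.2 le_rfl⟩)
      (measurable_pi_apply _)) 0 (fun _ => y)

/-- The matrix `A` with `Y_t = ⟨A Y_{t-1}⟩ + (ε_t, 0, …, 0, ε_t, 0, …, 0)`: the row of `X_t` is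
`(α, β)`, the row of `ε_t` is zero, and every other row has a single `1` that shifts a lag. -/
def companion (α : Fin p → ℝ) (β : Fin q → ℝ) : Matrix (Fin p ⊕ Fin q) (Fin p ⊕ Fin q) ℝ
  | Sum.inl i, Sum.inl k => if i.val = 0 then α k else if i.val = k.val + 1 then 1 else 0
  | Sum.inl i, Sum.inr j => if i.val = 0 then β j else 0
  | Sum.inr _, Sum.inl _ => 0
  | Sum.inr j, Sum.inr l => if j.val = l.val + 1 then 1 else 0

/-- The `ℓ¹` norm of a state. -/
def norm1 (y : State p q) : ℝ := ∑ c, |(y c : ℝ)|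

end MRARMA

end

/-! ### Accessibility of zero for the noise-free rounded autoregression -/

namespace RoundingAR

/-! ### Adapted norms -/

/-! Since ρ(A) < 1, some norm N is contracted by A, and N^k is a Lyapunov function for the chain
(`exists_lyapunov`). Hence time averages of the laws are tight, and their limits are invariant
probabilities with finite k-th moment (`exists_invariant`). Everything else rests on the origin
being accessible from every state (`reach_zero`). It makes the invariant probability unique
(`invariant_unique`) and the stationary shift ergodic (`ergodic_shift`), so Birkhoff's theorem gives
the law of large numbers under the stationary law. It passes to every starting point y because the
probability h(x) that the averages converge is harmonic, and Fatou's lemma along the time averages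
from y gives 1 = ∫ h dλ ≤ h(y).

Accessibility is the hard point. Innovations equal to 0 have positive probability; using only these,
a deterministic problem remains: bring an integer vector to 0 by choosing the roundings
(`exists_flow_to_zero`). A rounding is written ⌊α·x + u⌋ with 0 ≤ u < 1, and a flow applies the same
thresholds u to all points at once. Suppose that x never reaches 0. Then {0, x} is rigid: no flow
merges its points. Contraction bounds the size of rigid sets; let m ≥ 2 be the maximum. A flow that
makes the image of a finite set Y rigid maps every maximal rigid K ⊆ Y onto that image, so every
translate of K inside Y meets each fibre exactly once, as in a tiling. In the group ring of the
lattice this has two consequences: by Frobenius, dilates rK with r coprime to m are again maximal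
rigid (`rigidSets_smul`), and over ℚ the indicators of the maximal rigid sets lie in a proper ideal,
so that some character t has sum zero over all of them (`exists_character`).

Comparing the thresholds u transports this vanishing backwards along the companion map A, within the
larger class of partial characters, which are characters of a subgroup extended by zero
(`exists_successor`). Take one whose support has a real span V of least dimension. Noetherianity
leaves finitely many such spans, so the preimages of V under powers of A are periodic; the dilates
give an N such that t(N a) = 1 for all integer vectors a of the span (`exists_uniform_exponent`).
The common kernels for these spans are lattices that A links in a periodic sequence. As powers of A
tend to 0 while integer vectors are discrete, such lattices contain every unit vector on which one
of their elements has a nonzero entry (`single_mem_of_apply_ne_zero`). So t takes only the values 0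
and 1, and its sum over a translate of K containing 0 is a positive integer: a contradiction
(`not_good`). -/

theorem exists_adapted_norm {ι : Type*} [Fintype ι] (A : (ι → ℝ) →ₗ[ℝ] (ι → ℝ))
    (hA : ∀ x, Tendsto (fun n : ℕ => (A ^ n) x) atTop (𝓝 0)) :
    ∃ (N : (ι → ℝ) → ℝ) (ρ : ℝ), 0 < ρ ∧ ρ < 1 ∧ (∀ x, ‖x‖ ≤ N x) ∧
      (∀ x y, N (x + y) ≤ N x + N y) ∧ (∀ (c : ℝ) x, N (c • x) = |c| * N x) ∧
      ∀ x, N (A x) ≤ ρ * N x := by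
  classical
  have h1 : Tendsto (fun n : ℕ => ∑ i, ‖(A ^ n) (Pi.single i 1)‖) atTop (𝓝 0) := by
    have := tendsto_finsetSum (Finset.univ : Finset ι)
      (fun i _ => (hA (Pi.single i (1 : ℝ))).norm)
    simpa using this
  obtain ⟨n₀, hn₀, hpos⟩ :=
    ((h1.eventually (ge_mem_nhds (show (0 : ℝ) < 1 / 2 by norm_num))).and
      (eventually_ge_atTop 1)).exists
  have h2 : ∀ x, ‖(A ^ n₀) x‖ ≤ 1 / 2 * ‖x‖ := by
    intro x
    have hx : x = ∑ i, x i • (Pi.single i (1 : ℝ) : ι → ℝ) := by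
      ext j
      simp [Finset.sum_apply, Pi.single_apply]
    calc ‖(A ^ n₀) x‖ = ‖∑ i, x i • (A ^ n₀) (Pi.single i 1)‖ := by
          conv_lhs => rw [hx]
          simp
      _ ≤ ∑ i, ‖x i • (A ^ n₀) (Pi.single i 1)‖ := norm_sum_le _ _
      _ ≤ ∑ i, ‖x‖ * ‖(A ^ n₀) (Pi.single i 1)‖ := by
          refine Finset.sum_le_sum fun i _ => ?_
          rw [norm_smul]
          exact mul_le_mul_of_nonneg_right (norm_le_pi_norm x i) (norm_nonneg _)
      _ = ‖x‖ * ∑ i, ‖(A ^ n₀) (Pi.single i 1)‖ := by rw [Finset.mul_sum]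
      _ ≤ ‖x‖ * (1 / 2) := mul_le_mul_of_nonneg_left hn₀ (norm_nonneg _)
      _ = 1 / 2 * ‖x‖ := mul_comm _ _
  -- The weight has s^n₀ = 2, which offsets the factor 1/2 of A^n₀. For N x = ∑_{j<n₀} s^j ‖A^j x‖
  -- the sum telescopes: s N(Ax) = N x - ‖x‖ + 2‖A^n₀ x‖ ≤ N x.
  set s : ℝ := (2 : ℝ) ^ ((1 : ℝ) / n₀) with hs
  have hn₀' : (0 : ℝ) < n₀ := by exact_mod_cast hpos
  have hs1 : 1 < s := Real.one_lt_rpow (by norm_num) (by positivity)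
  have hs0 : 0 < s := by linarith
  have hsn : s ^ n₀ = 2 := by
    rw [hs, ← Real.rpow_natCast, ← Real.rpow_mul (by norm_num)]
    field_simp
    norm_num
  refine ⟨fun x => ∑ j ∈ Finset.range n₀, s ^ j * ‖(A ^ j) x‖, s⁻¹, by positivity,
    inv_lt_one_of_one_lt₀ hs1, ?_, ?_, ?_, ?_⟩
  · intro x
    have := Finset.single_le_sum (f := fun j => s ^ j * ‖(A ^ j) x‖) (s := Finset.range n₀)
      (fun i _ => by positivity) (Finset.mem_range.2 hpos)
    simpa using this
  · intro x y
    rw [← Finset.sum_add_distrib]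
    refine Finset.sum_le_sum fun j _ => ?_
    rw [map_add, ← mul_add]
    exact mul_le_mul_of_nonneg_left (norm_add_le _ _) (by positivity)
  · intro c x
    rw [Finset.mul_sum]
    refine Finset.sum_congr rfl fun j _ => ?_
    rw [map_smul, norm_smul, Real.norm_eq_abs]
    ring
  · intro x
    have e1 : s * ∑ j ∈ Finset.range n₀, s ^ j * ‖(A ^ j) (A x)‖
        = ∑ j ∈ Finset.range n₀, s ^ (j + 1) * ‖(A ^ (j + 1)) x‖ := by
      rw [Finset.mul_sum]
      refine Finset.sum_congr rfl fun j _ => ?_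
      rw [pow_succ A, Module.End.mul_apply]
      ring
    have e2 := Finset.sum_range_succ' (fun j => s ^ j * ‖(A ^ j) x‖) n₀
    rw [Finset.sum_range_succ] at e2
    have e3 := h2 x
    rw [hsn] at e2
    simp only [pow_zero, Module.End.one_apply, one_mul] at e2
    rw [le_inv_mul_iff₀ hs0, e1]
    linarith

/-! ### Shift maps -/

variable {d : ℕ}

/-- Insert `c` in front and drop the last entry. -/
def shiftIn {R : Type*} (c : R) (x : Fin (d + 1) → R) : Fin (d + 1) → R :=
  Fin.cons c (fun i => x i.castSucc)

@[simp] lemma shiftIn_zero {R : Type*} (c : R) (x : Fin (d + 1) → R) : shiftIn c x 0 = c := rfl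

@[simp] lemma shiftIn_succ {R : Type*} (c : R) (x : Fin (d + 1) → R) (i : Fin d) :
    shiftIn c x i.succ = x i.castSucc := rfl

lemma shiftIn_add {R : Type*} [Add R] (c c' : R) (x y : Fin (d + 1) → R) :
    shiftIn (c + c') (x + y) = shiftIn c x + shiftIn c' y := by
  ext i
  refine Fin.cases ?_ (fun i => ?_) i <;> simp

@[simp] lemma shiftIn_zero_zero {R : Type*} [Zero R] :
    shiftIn (0 : R) (0 : Fin (d + 1) → R) = 0 := by
  ext i
  refine Fin.cases ?_ (fun i => ?_) i <;> simp

/-- The real vector with the given integer coordinates. -/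
def toReal (x : Fin (d + 1) → ℤ) : Fin (d + 1) → ℝ := fun i => (x i : ℝ)

@[simp] lemma toReal_apply (x : Fin (d + 1) → ℤ) (i) : toReal x i = (x i : ℝ) := rfl

lemma toReal_add (x y : Fin (d + 1) → ℤ) : toReal (x + y) = toReal x + toReal y := by
  ext i; simp

lemma toReal_sub (x y : Fin (d + 1) → ℤ) : toReal (x - y) = toReal x - toReal y := by
  ext i; simp

@[simp] lemma toReal_zero : toReal (0 : Fin (d + 1) → ℤ) = 0 := by
  ext i; simp

lemma toReal_shiftIn (c : ℤ) (x : Fin (d + 1) → ℤ) :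
    toReal (shiftIn c x) = shiftIn (c : ℝ) (toReal x) := by
  ext i
  refine Fin.cases ?_ (fun i => ?_) i <;> simp

/-- The linear form `∑ i, α i * x i`. -/
def dot (α x : Fin (d + 1) → ℝ) : ℝ := ∑ i, α i * x i

lemma dot_add (α x y : Fin (d + 1) → ℝ) : dot α (x + y) = dot α x + dot α y := by
  simp [dot, mul_add, Finset.sum_add_distrib]

lemma dot_smul (α : Fin (d + 1) → ℝ) (c : ℝ) (x : Fin (d + 1) → ℝ) :
    dot α (c • x) = c * dot α x := by
  simp only [dot, Finset.mul_sum, Pi.smul_apply, smul_eq_mul]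
  exact Finset.sum_congr rfl fun i _ => by ring

@[simp] lemma dot_zero (α : Fin (d + 1) → ℝ) : dot α 0 = 0 := by simp [dot]

/-- The autoregressive companion map `x ↦ (α ⬝ x, x₀, …, x_{d-1})`. -/
def arMap (α : Fin (d + 1) → ℝ) : (Fin (d + 1) → ℝ) →ₗ[ℝ] (Fin (d + 1) → ℝ) where
  toFun x := shiftIn (dot α x) x
  map_add' x y := by rw [dot_add, shiftIn_add]
  map_smul' c x := by
    rw [dot_smul]
    ext i
    refine Fin.cases ?_ (fun i => ?_) i <;> simp

lemma arMap_apply (α x : Fin (d + 1) → ℝ) : arMap α x = shiftIn (dot α x) x := rfl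

lemma arMap_injective {α : Fin (d + 1) → ℝ} (hlast : α (Fin.last d) ≠ 0) :
    Function.Injective (arMap α) := by
  rw [injective_iff_map_eq_zero]
  intro x hx
  have h0 : ∀ i : Fin d, x i.castSucc = 0 := fun i => by
    have := congrFun hx i.succ
    simpa [arMap_apply] using this
  have h1 : dot α x = 0 := by
    have := congrFun hx 0
    simpa [arMap_apply] using this
  rw [dot, Fin.sum_univ_castSucc] at h1
  simp only [h0, mul_zero, Finset.sum_const_zero, zero_add] at h1
  ext i
  refine Fin.lastCases ?_ (fun i => ?_) i
  · simpa [hlast] using h1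
  · simpa using h0 i

/-- An integer vector whose forward orbit under `arMap α` consists infinitely often of integer
vectors vanishes. -/
lemma eq_zero_of_frequently_integral {α : Fin (d + 1) → ℝ} (hlast : α (Fin.last d) ≠ 0)
    (hA : ∀ x, Tendsto (fun n : ℕ => (arMap α ^ n) x) atTop (𝓝 0)) {x : Fin (d + 1) → ℝ}
    (hx : ∃ᶠ n in atTop, ∃ b : Fin (d + 1) → ℤ, toReal b = (arMap α ^ n) x) : x = 0 := by
  have h1 : ∀ᶠ n in atTop, ‖(arMap α ^ n) x‖ < 1 := by
    have := (hA x).norm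
    rw [norm_zero] at this
    exact this.eventually (gt_mem_nhds zero_lt_one)
  -- An integer vector of sup norm below 1 is zero, and powers of the companion map are injective.
  obtain ⟨n, ⟨b, hb⟩, hn⟩ := (hx.and_eventually h1).exists
  have hb0 : b = 0 := by
    ext i
    have := (norm_le_pi_norm ((arMap α ^ n) x) i).trans_lt hn
    rw [← hb, toReal_apply, Real.norm_eq_abs] at this
    have h2 : |b i| < 1 := by exact_mod_cast this
    simpa using Int.abs_lt_one_iff.1 h2
  rw [hb0, toReal_zero] at hb
  have hinj : Function.Injective (arMap α ^ n : (Fin (d + 1) → ℝ) →ₗ[ℝ] _) := by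
    rw [Module.End.coe_pow]
    exact (arMap_injective hlast).iterate n
  exact hinj (by rw [← hb, map_zero])

/-- Extension of a coefficient vector by zero. -/
def ext0 (α : Fin (d + 1) → ℝ) (n : ℕ) : ℝ := if h : n < d + 1 then α ⟨n, h⟩ else 0

/-- Links the linear form to power series: on a window of a sequence that is zero at negative times
it is a convolution. Both sums have the same nonzero terms. -/
lemma dot_window (α : Fin (d + 1) → ℝ) (s : ℕ → ℝ) (j : ℕ) (w : Fin (d + 1) → ℝ)
    (hw : ∀ i, w i = if i.val ≤ j then s (j - i.val) else 0) :
    dot α w = ∑ x ∈ Finset.range (j + 1), ext0 α x * s (j - x) := by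
  have e1 : dot α w = ∑ x ∈ Finset.range (d + 1),
      if x ≤ j then ext0 α x * s (j - x) else 0 := by
    rw [Finset.sum_range]
    refine Finset.sum_congr rfl fun i _ => ?_
    rw [hw]
    simp [ext0, Fin.is_le]
  rw [e1, ← Finset.sum_filter, ← Finset.sum_filter_ne_zero,
    ← Finset.sum_filter_ne_zero (s := Finset.range (j + 1))]
  refine Finset.sum_congr ?_ fun _ _ => rfl
  ext x
  simp only [Finset.mem_filter, Finset.mem_range]
  constructor
  · rintro ⟨⟨h1, h2⟩, h3⟩
    exact ⟨by omega, h3⟩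
  · rintro ⟨h1, h2⟩
    refine ⟨⟨?_, by omega⟩, h2⟩
    by_contra hcon
    simp [ext0, hcon] at h2

end RoundingAR

namespace RoundingAR
variable {d : ℕ}

/-! ### Periodic sequences of lattices compatible with the companion map -/

section Lattice

variable {α : Fin (d + 1) → ℝ} {L : ℕ → AddSubgroup (Fin (d + 1) → ℤ)} {e : ℕ}

/-- The first basis vector. -/
abbrev e0 (d : ℕ) : Fin (d + 1) → ℤ := Pi.single 0 1

/-- Coefficients of the characteristic power series `1 - ∑ α_i X^{i+1}`. -/
def charCoeff (α : Fin (d + 1) → ℝ) (n : ℕ) : ℝ := if n = 0 then 1 else -ext0 α (n - 1)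

@[simp] lemma charCoeff_zero (α : Fin (d + 1) → ℝ) : charCoeff α 0 = 1 := rfl

@[simp] lemma charCoeff_succ (α : Fin (d + 1) → ℝ) (n : ℕ) :
    charCoeff α (n + 1) = -ext0 α n := by simp [charCoeff]

open Classical in
lemma coeff_charCoeff_mul (α : Fin (d + 1) → ℝ) (s : ℕ → ℝ) (j : ℕ) :
    PowerSeries.coeff (j + 1) (PowerSeries.mk (charCoeff α) * PowerSeries.mk s)
      = s (j + 1) - ∑ x ∈ Finset.range (j + 1), ext0 α x * s (j - x) := by
  rw [PowerSeries.coeff_mul, Finset.Nat.sum_antidiagonal_eq_sum_range_succ_mk,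
    Finset.sum_range_succ']
  simp only [PowerSeries.coeff_mk, charCoeff_succ, charCoeff_zero, one_mul, Nat.sub_zero]
  rw [add_comm, sub_eq_add_neg, ← Finset.sum_neg_distrib]
  congr 1
  refine Finset.sum_congr rfl fun x hx => ?_
  rw [Nat.add_sub_add_right, neg_mul]

/-- Integer sequences obtained by pulling back the first basis vector. -/
lemma exists_backward_sequence
    (hN : ∀ n, e0 d ∈ L n → ∀ a ∈ L (n + 1), shiftIn 0 a ∈ L n)
    (hF : ∀ n, e0 d ∉ L n → ∀ a ∈ L (n + 1),
      ∃ c : ℤ, (c : ℝ) = dot α (toReal a) ∧ shiftIn c a ∈ L n)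
    (ν : ℕ) (hν : e0 d ∈ L ν) :
    ∃ κ : ℕ → ℤ, κ 0 = 1 ∧ ∀ j, 1 ≤ j → j ≤ ν → e0 d ∉ L (ν - j) →
      PowerSeries.coeff j (PowerSeries.mk (charCoeff α) * PowerSeries.mk fun n => (κ n : ℝ)) = 0 := by
  classical
  -- Step j leads from `L (ν - j)` to `L (ν - (j + 1))`. When the latter does not contain `e0 d`,
  -- the linear form is an integer by `hF`, so the floor changes nothing and the recursion holds
  -- exactly.
  let x : ℕ → (Fin (d + 1) → ℤ) := fun n => Nat.rec (e0 d)
    (fun j y => if e0 d ∈ L (ν - (j + 1)) then shiftIn 0 y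
      else shiftIn ⌊dot α (toReal y)⌋ y) n
  have x0 : x 0 = e0 d := rfl
  have xs : ∀ j, x (j + 1) = if e0 d ∈ L (ν - (j + 1)) then shiftIn 0 (x j)
      else shiftIn ⌊dot α (toReal (x j))⌋ (x j) := fun j => rfl
  have hmem : ∀ j, j ≤ ν → x j ∈ L (ν - j) := by
    intro j
    induction j with
    | zero => intro _; simpa [x0] using hν
    | succ j ih =>
      intro hj
      have h1 := ih (by omega)
      have h2 : ν - j = (ν - (j + 1)) + 1 := by omega
      rw [h2] at h1
      rw [xs]
      split_ifs with h
      · exact hN _ h _ h1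
      · obtain ⟨c, hc, hm⟩ := hF _ h _ h1
        rwa [← hc, Int.floor_intCast]
  have hwin : ∀ j (i : Fin (d + 1)), x j i = if i.val ≤ j then x (j - i.val) 0 else 0 := by
    intro j
    induction j with
    | zero =>
      intro i
      rw [x0]
      by_cases h : i = 0
      · subst h; simp [x0]
      · have : ¬ i.val ≤ 0 := by
          intro h'
          exact h (Fin.ext (by simpa using h'))
        simp [h]
    | succ j ih =>
      intro i
      refine Fin.cases (by simp) (fun i => ?_) i
      have : x (j + 1) i.succ = x j i.castSucc := by
        rw [xs]; split_ifs <;> simp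
      rw [this, ih]
      simp
  refine ⟨fun j => x j 0, by simp [x0], ?_⟩
  intro j h1 hj hnot
  obtain ⟨j, rfl⟩ : ∃ i, j = i + 1 := ⟨j - 1, by omega⟩
  rw [coeff_charCoeff_mul]
  change Int.cast (x (j + 1) 0) -
    ∑ y ∈ Finset.range (j + 1), ext0 α y * (Int.cast (x (j - y) 0) : ℝ) = 0
  have hw := dot_window α (fun n => Int.cast (x n 0)) j (toReal (x j)) ?_
  · rw [← hw]
    have h1 := hmem j (by omega)
    have h2 : ν - j = (ν - (j + 1)) + 1 := by omega
    rw [h2] at h1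
    obtain ⟨c, hc, -⟩ := hF _ hnot _ h1
    rw [xs, if_neg hnot, ← hc]
    simp
  · intro i
    rw [toReal_apply, hwin]
    split_ifs <;> simp

lemma periodic_iterate (hper : ∀ n, L (n + e) = L n) (n k : ℕ) : L (n + k * e) = L n := by
  induction k with
  | zero => simp
  | succ k ih => rw [Nat.succ_mul, ← add_assoc, hper, ih]

/-- If `α i ≠ 0`, then translation by `i + 1` preserves the set of times at which the lattice
contains the first basis vector. -/
theorem translation_invariant_of_ne_zero (hlast : α (Fin.last d) ≠ 0)
    (hA : ∀ x, Tendsto (fun n : ℕ => (arMap α ^ n) x) atTop (𝓝 0))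
    (he : 0 < e) (hper : ∀ n, L (n + e) = L n)
    (hN : ∀ n, e0 d ∈ L n → ∀ a ∈ L (n + 1), shiftIn 0 a ∈ L n)
    (hF : ∀ n, e0 d ∉ L n → ∀ a ∈ L (n + 1),
      ∃ c : ℤ, (c : ℝ) = dot α (toReal a) ∧ shiftIn c a ∈ L n)
    (i : Fin (d + 1)) (hi : α i ≠ 0) (n : ℕ) :
    e0 d ∈ L (n + (i.val + 1)) ↔ e0 d ∈ L n := by
  classical
  -- Let Z be the set of n with `e0 d ∈ L n`; `St` consists of the translations preserving Z. The
  -- claim is that the characteristic series a = 1 - ∑ α_i X^(i+1) is supported on `St`. Let a0 be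
  -- its part with exponents in `St`, and b = a / a0. Once b is known to be integral, so is C = 1 /
  -- b, and a C = a0 says that C obeys the autoregression beyond degree d + 1. Stability and
  -- integrality then kill the coefficients of C in degrees 1 to d + 1, and a and a0 agree.
  set St : ℕ → Prop := fun i => ∀ n, e0 d ∈ L (n + i) ↔ e0 d ∈ L n with hSt
  have St0 : St 0 := fun n => by simp
  have Stsub : ∀ x y, St x → St (x + y) → St y := by
    intro x y hx hxy m
    have h1 := hxy m
    have h2 := hx (m + y)
    rw [add_assoc, add_comm y x] at h2
    rw [← h2, h1]
  set a : PowerSeries ℝ := PowerSeries.mk (charCoeff α) with ha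
  set a0 : PowerSeries ℝ := PowerSeries.mk (fun n => if St n then charCoeff α n else 0) with ha0
  have ha0c : PowerSeries.constantCoeff a0 ≠ 0 := by
    rw [← PowerSeries.coeff_zero_eq_constantCoeff_apply]
    simp [ha0, St0]
  set b : PowerSeries ℝ := a0⁻¹ * a with hb
  have hab : a0 * b = a := by
    rw [hb, ← mul_assoc, PowerSeries.mul_inv_cancel _ ha0c, one_mul]
  have hb0 : PowerSeries.coeff 0 b = 1 := by
    have := congrArg (PowerSeries.coeff 0) hab
    rw [PowerSeries.coeff_mul] at this
    simpa [ha0, ha, St0] using this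
  -- expansion of a coefficient of a product with `a0`
  have hexp : ∀ (φ : PowerSeries ℝ) n, PowerSeries.coeff n (a0 * φ) = PowerSeries.coeff n φ +
      ∑ x ∈ Finset.range n, (if St (x + 1) then charCoeff α (x + 1) else 0) *
        PowerSeries.coeff (n - (x + 1)) φ := by
    intro φ n
    rw [PowerSeries.coeff_mul, Finset.Nat.sum_antidiagonal_eq_sum_range_succ_mk,
      Finset.sum_range_succ', add_comm]
    simp [ha0, St0]
  -- coefficients of `b` on `St` vanish
  have hbSt : ∀ n, 0 < n → St n → PowerSeries.coeff n b = 0 := by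
    intro n
    induction n using Nat.strong_induction_on with
    | _ n ih =>
      intro hn hS
      obtain ⟨n, rfl⟩ : ∃ m, n = m + 1 := ⟨n - 1, by omega⟩
      have h1 := hexp b (n + 1)
      rw [hab, Finset.sum_range_succ, Finset.sum_eq_zero] at h1
      · rw [if_pos hS, Nat.sub_self, hb0, ha, PowerSeries.coeff_mk] at h1
        linarith
      · intro x hx
        rw [Finset.mem_range] at hx
        split_ifs with hSx
        · rw [ih (n + 1 - (x + 1)) (by omega) (by omega), mul_zero]
          refine Stsub (x + 1) _ hSx ?_
          rwa [show x + 1 + (n + 1 - (x + 1)) = n + 1 by omega]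
        · simp
  -- integrality of `b`
  have hbint : ∀ n, ∃ c : ℤ, (c : ℝ) = PowerSeries.coeff n b := by
    intro n
    induction n using Nat.strong_induction_on with
    | _ n ih =>
      by_cases hn : n = 0
      · exact ⟨1, by rw [hn, hb0]; simp⟩
      by_cases hS : St n
      · exact ⟨0, by rw [hbSt n (by omega) hS]; simp⟩
      -- Were Z stable under subtracting n, then going down e - 1 times from x + n e, which lies in
      -- Z with x by periodicity, would give x + n ∈ Z, and `St n` would hold.
      obtain ⟨x, hx1, hx2⟩ : ∃ x, e0 d ∈ L (x + n) ∧ e0 d ∉ L x := by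
        by_contra hcon
        push Not at hcon
        apply hS
        intro x
        refine ⟨hcon x, fun hx => ?_⟩
        have key : ∀ k, e0 d ∈ L (x + n + k * n) → e0 d ∈ L (x + n) := by
          intro k
          induction k with
          | zero => simp
          | succ k ihk =>
            intro h
            refine ihk (hcon _ ?_)
            rwa [Nat.succ_mul, ← add_assoc] at h
        refine key (e - 1) ?_
        have : x + n + (e - 1) * n = x + n * e := by
          obtain ⟨m, rfl⟩ : ∃ m, e = m + 1 := ⟨e - 1, by omega⟩
          simp only [Nat.add_sub_cancel]
          ring
        rw [this, periodic_iterate hper]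
        exact hx
      obtain ⟨κ, hκ0, hκ⟩ := exists_backward_sequence hN hF (x + n) hx1
      set K : PowerSeries ℝ := PowerSeries.mk fun n => (κ n : ℝ) with hK
      -- Division by a0 involves only shifts in `St`, which preserve the complement of Z. So the
      -- vanishing of the coefficients of a K at times outside Z passes to b K = a K / a0.
      have hφ : ∀ m, 1 ≤ m → m ≤ x + n → e0 d ∉ L (x + n - m) →
          PowerSeries.coeff m (b * K) = 0 := by
        intro m
        induction m using Nat.strong_induction_on with
        | _ m ihm =>
          intro hm1 hm2 hm3
          have h1 := hexp (b * K) m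
          rw [← mul_assoc, hab, hκ m hm1 hm2 hm3, Finset.sum_eq_zero, add_zero] at h1
          · exact h1.symm
          · intro y hy
            rw [Finset.mem_range] at hy
            split_ifs with hSy
            · have h2 := hSy (x + n - m)
              by_cases hym : m = y + 1
              · rw [← hym, show x + n - m + m = x + n by omega] at h2
                exact absurd (h2.1 hx1) hm3
              · rw [ihm (m - (y + 1)) (by omega) (by omega) (by omega), mul_zero]
                rw [show x + n - (m - (y + 1)) = x + n - m + (y + 1) by omega, h2]
                exact hm3
            · simp
      -- As κ 0 = 1, this vanishing coefficient expresses the n-th coefficient of b as an integer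
      -- combination of earlier ones.
      have h1 := hφ n (by omega) (by omega) (by simpa using hx2)
      rw [PowerSeries.coeff_mul, Finset.Nat.sum_antidiagonal_eq_sum_range_succ_mk,
        Finset.sum_range_succ] at h1
      simp only [hK, PowerSeries.coeff_mk, Nat.sub_self, hκ0] at h1
      choose! cc hcc using ih
      refine ⟨-∑ y ∈ Finset.range n, cc y * κ (n - y), ?_⟩
      push_cast
      rw [Finset.sum_congr rfl fun y hy => by rw [hcc y (Finset.mem_range.1 hy)]]
      push_cast at h1
      linarith
  -- the integral inverse
  choose bz hbz using hbint
  have hbmap : PowerSeries.map (Int.castRingHom ℝ) (PowerSeries.mk bz) = b := by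
    ext n
    simp [hbz]
  have hbz0 : bz 0 = 1 := by
    have := hbz 0
    rw [hb0] at this
    exact_mod_cast this
  have hunit : IsUnit (PowerSeries.mk bz) := by
    rw [PowerSeries.isUnit_iff_constantCoeff, ← PowerSeries.coeff_zero_eq_constantCoeff_apply,
      PowerSeries.coeff_mk, hbz0]
    exact isUnit_one
  obtain ⟨C, hC⟩ := hunit.exists_right_inv
  set s : ℕ → ℝ := fun n => ((PowerSeries.coeff n C : ℤ) : ℝ) with hs
  have hCmap : PowerSeries.map (Int.castRingHom ℝ) C = PowerSeries.mk s := by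
    ext n
    simp [hs]
  have haC : a * PowerSeries.mk s = a0 := by
    rw [← hCmap, ← hab, mul_assoc, ← hbmap, ← map_mul, hC, map_one, mul_one]
  have hs0 : s 0 = 1 := by
    have := congrArg (PowerSeries.coeff 0) haC
    rw [PowerSeries.coeff_mul] at this
    simpa [ha, ha0, St0] using this
  have hrec : ∀ j, s (j + 1) - ∑ x ∈ Finset.range (j + 1), ext0 α x * s (j - x)
      = if St (j + 1) then charCoeff α (j + 1) else 0 := by
    intro j
    rw [← coeff_charCoeff_mul, ← ha, haC, ha0, PowerSeries.coeff_mk]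
  -- windows of `s` are eventually transported by the companion map
  let W : ℕ → (Fin (d + 1) → ℤ) := fun n i => PowerSeries.coeff (n - i.val) C
  have hW : ∀ k, toReal (W (d + 1 + k)) = (arMap α ^ k) (toReal (W (d + 1))) := by
    intro k
    induction k with
    | zero => simp
    | succ k ih =>
      rw [pow_succ', Module.End.mul_apply, ← ih, arMap_apply]
      ext i
      refine Fin.cases ?_ (fun i => ?_) i
      · rw [shiftIn_zero, dot_window α s (d + 1 + k)]
        · have h1 := hrec (d + 1 + k)
          have h2 : charCoeff α (d + 1 + k + 1) = 0 := by
            rw [charCoeff_succ, ext0, dif_neg (by omega), neg_zero]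
          rw [h2, ite_self] at h1
          have h3 : toReal (W (d + 1 + (k + 1))) 0 = s (d + 1 + k + 1) := by
            simp [W, hs, add_assoc]
          rw [h3]
          linarith
        · intro i
          have : i.val ≤ d + 1 + k := by have := i.isLt; omega
          simp [W, hs, this]
      · simp only [shiftIn_succ, toReal_apply, W, Fin.val_succ, Fin.val_castSucc]
        rw [show d + 1 + (k + 1) - (i.val + 1) = d + 1 + k - i.val by omega]
  -- The whole forward orbit of this window consists of integer windows of C.
  have hW0 : toReal (W (d + 1)) = 0 :=
    eq_zero_of_frequently_integral hlast hA (Frequently.of_forall fun k => ⟨_, hW k⟩)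
  have hsz : ∀ n, 1 ≤ n → n ≤ d + 1 → s n = 0 := by
    intro n h1 h2
    have := congrFun hW0 ⟨d + 1 - n, by omega⟩
    simp only [toReal_apply, W, Pi.zero_apply] at this
    rw [show d + 1 - (d + 1 - n) = n by omega] at this
    exact this
  -- conclusion
  have hfin := hrec i.val
  rw [hsz _ (by omega) (by have := i.isLt; omega), Finset.sum_eq_single i.val] at hfin
  · rw [Nat.sub_self, hs0] at hfin
    have hai : ext0 α i.val = α i := by simp [ext0, Fin.is_le]
    rw [hai] at hfin
    by_cases hS : St (i.val + 1)
    · exact hS n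
    · rw [if_neg hS] at hfin
      exact absurd (by linarith) hi
  · intro y hy hyi
    rw [Finset.mem_range] at hy
    rw [hsz _ (by omega) (by have := i.isLt; omega), mul_zero]
  · intro h
    exact absurd (Finset.mem_range.2 (by omega)) h

/-- In a periodic sequence of lattices compatible with the companion map, every lattice is a
coordinate lattice. -/
theorem single_mem_of_apply_ne_zero (hlast : α (Fin.last d) ≠ 0)
    (hA : ∀ x, Tendsto (fun n : ℕ => (arMap α ^ n) x) atTop (𝓝 0))
    (he : 0 < e) (hper : ∀ n, L (n + e) = L n)
    (hN : ∀ n, e0 d ∈ L n → ∀ a ∈ L (n + 1), shiftIn 0 a ∈ L n)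
    (hF : ∀ n, e0 d ∉ L n → ∀ a ∈ L (n + 1),
      ∃ c : ℤ, (c : ℝ) = dot α (toReal a) ∧ shiftIn c a ∈ L n)
    {a : Fin (d + 1) → ℤ} (ha : a ∈ L 0) (i : Fin (d + 1)) (hi : a i ≠ 0) :
    Pi.single i 1 ∈ L 0 := by
  classical
  have hSt := translation_invariant_of_ne_zero hlast hA he hper hN hF
  -- Call coordinate k dead at time n if `e0 d ∈ L (n + k)`. Pulling the first unit vector back k
  -- times yields the k-th one: a step through a time outside Z inserts some coefficient of α, which
  -- is zero because a nonzero one would make Z invariant under the corresponding translation.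
  have hdead : ∀ (k : ℕ) (hk : k < d + 1) n, e0 d ∈ L (n + k) → Pi.single ⟨k, hk⟩ 1 ∈ L n := by
    intro k
    induction k with
    | zero => intro _ n h; simpa using h
    | succ k ih =>
      intro hk n h
      have h1 := ih (by omega) (n + 1) (by rwa [add_assoc, add_comm 1 k])
      have hshift : shiftIn 0 (Pi.single (⟨k, by omega⟩ : Fin (d + 1)) (1 : ℤ))
          = Pi.single (⟨k + 1, hk⟩ : Fin (d + 1)) 1 := by
        ext j
        refine Fin.cases ?_ (fun j => ?_) j
        · simp [Fin.ext_iff]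
        · simp [Pi.single_apply, Fin.ext_iff]
      rw [← hshift]
      by_cases hn : e0 d ∈ L n
      · exact hN n hn _ h1
      · obtain ⟨c, hc, hm⟩ := hF n hn _ h1
        have hdot : dot α (toReal (Pi.single (⟨k, by omega⟩ : Fin (d + 1)) (1 : ℤ)))
            = α ⟨k, by omega⟩ := by
          rw [dot, Finset.sum_eq_single ⟨k, by omega⟩]
          · simp
          · intro b _ hb
            simp [hb]
          · simp
        have hzero : α ⟨k, by omega⟩ = 0 := by
          by_contra hne
          exact hn ((hSt _ hne n).1 h)
        rw [hdot, hzero] at hc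
        have : c = 0 := by exact_mod_cast hc
        rwa [this] at hm
  have hlive : ∀ n, ∀ x ∈ L n, (fun j : Fin (d + 1) => if e0 d ∈ L (n + j.val) then 0 else x j)
      ∈ L n := by
    intro n x hx
    have : (fun j : Fin (d + 1) => if e0 d ∈ L (n + j.val) then 0 else x j)
        = x - ∑ j : Fin (d + 1), if e0 d ∈ L (n + j.val) then x j • Pi.single j 1 else 0 := by
      ext k
      rw [Pi.sub_apply, Finset.sum_apply, Finset.sum_eq_single k]
      · split_ifs <;> simp
      · intro b _ hb
        split_ifs <;> simp [hb.symm]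
      · simp
    rw [this]
    refine sub_mem hx (sum_mem fun j _ => ?_)
    split_ifs with h
    · exact zsmul_mem (hdead j.val j.isLt n h) _
    · exact zero_mem _
  set Live : ℕ → (Fin (d + 1) → ℤ) → Prop :=
    fun n x => x ∈ L n ∧ ∀ j : Fin (d + 1), e0 d ∈ L (n + j.val) → x j = 0 with hLive
  -- On vectors without dead entries both kinds of backward step are the companion map: if n ∈ Z,
  -- every j with α_j ≠ 0 is dead at time n + 1, so the linear form vanishes.
  have hback : ∀ n x, Live (n + 1) x → ∃ y, Live n y ∧ toReal y = arMap α (toReal x) := by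
    rintro n x ⟨hx, hz⟩
    by_cases hn : e0 d ∈ L n
    · have hdot : dot α (toReal x) = 0 := by
        refine Finset.sum_eq_zero fun j _ => ?_
        by_cases hj : α j = 0
        · simp [hj]
        · have := (hSt j hj n).2 hn
          rw [show n + (j.val + 1) = n + 1 + j.val by ring] at this
          simp [hz j this]
      refine ⟨shiftIn 0 x, ⟨hN n hn x hx, fun j => ?_⟩, ?_⟩
      · refine Fin.cases (fun _ => rfl) (fun j h => ?_) j
        refine hz _ ?_
        simpa [add_assoc, add_comm, add_left_comm] using h
      · rw [toReal_shiftIn, arMap_apply, hdot]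
        simp
    · obtain ⟨c, hc, hm⟩ := hF n hn x hx
      refine ⟨shiftIn c x, ⟨hm, fun j => ?_⟩, ?_⟩
      · refine Fin.cases (fun h => absurd (by simpa using h) hn) (fun j h => ?_) j
        refine hz _ ?_
        simpa [add_assoc, add_comm, add_left_comm] using h
      · rw [toReal_shiftIn, arMap_apply, hc]
  have hiter : ∀ k n x, Live (n + k) x → ∃ y, Live n y ∧ toReal y = (arMap α ^ k) (toReal x) := by
    intro k
    induction k with
    | zero => intro n x hx; exact ⟨x, hx, by simp⟩
    | succ k ih =>
      intro n x hx
      obtain ⟨y, hy, hyx⟩ := hback (n + k) x (by rwa [← add_assoc] at hx)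
      obtain ⟨w, hw, hwy⟩ := ih n y hy
      exact ⟨w, hw, by rw [hwy, hyx, pow_succ, Module.End.mul_apply]⟩
  by_contra hcon
  have hni : e0 d ∉ L (0 + i.val) := fun h => hcon (hdead i.val i.isLt 0 h)
  set x : Fin (d + 1) → ℤ := fun j => if e0 d ∈ L (0 + j.val) then 0 else a j with hx
  -- By periodicity the live part x of a belongs to the lattice at every time k e. Pulled back to
  -- time 0, it shows that A^(k e) x is integral for all k, which forces x = 0.
  have hxl : ∀ k, Live (0 + k * e) x := by
    intro k
    refine ⟨?_, ?_⟩
    · rw [periodic_iterate hper]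
      exact hlive 0 a ha
    · intro j hj
      have : L (0 + k * e + j.val) = L (0 + j.val) := by
        rw [add_right_comm, periodic_iterate hper]
      rw [this] at hj
      simp only [hx, if_pos hj]
  have hx0 : toReal x = 0 := by
    refine eq_zero_of_frequently_integral hlast hA ?_
    rw [frequently_atTop]
    intro k
    obtain ⟨y, -, hy⟩ := hiter (k * e) 0 x (hxl k)
    exact ⟨k * e, Nat.le_mul_of_pos_right k he, y, hy⟩
  have := congrFun hx0 i
  simp only [hx, toReal_apply, if_neg hni, Pi.zero_apply] at this
  exact hi (by exact_mod_cast this)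

end Lattice

end RoundingAR

namespace RoundingAR
variable {d : ℕ}

/-! ### Flows of the rounded autoregression -/

/-- The lattice `ℤ^{d+1}`. -/
abbrev Lat (d : ℕ) : Type := Fin (d + 1) → ℤ

/-- One step of the noise-free recursion, with rounding threshold determined by `u`. -/
noncomputable def stepU (α : Fin (d + 1) → ℝ) (u : ℝ) (x : Lat d) : Lat d := shiftIn ⌊dot α (toReal x) + u⌋ x

/-- Compositions of rounding steps with thresholds in `[0, 1)`. -/
inductive IsFlow (α : Fin (d + 1) → ℝ) : (Lat d → Lat d) → Prop
  | id : IsFlow α id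
  | step {φ : Lat d → Lat d} {u : ℝ} (hφ : IsFlow α φ) (h0 : 0 ≤ u) (h1 : u < 1) :
      IsFlow α (stepU α u ∘ φ)

variable {α : Fin (d + 1) → ℝ}

lemma IsFlow.comp {φ ψ : Lat d → Lat d} (hψ : IsFlow α ψ) (hφ : IsFlow α φ) :
    IsFlow α (ψ ∘ φ) := by
  induction hψ with
  | id => exact hφ
  | step _ h0 h1 ih => exact ih.step h0 h1

lemma isFlow_stepU {u : ℝ} (h0 : 0 ≤ u) (h1 : u < 1) : IsFlow α (stepU α u) :=
  IsFlow.id.step h0 h1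

/-- Moving the origin to z only replaces the threshold by a fractional part, again in [0, 1). This
cocycle property makes rigidity invariant under translation. -/
lemma stepU_add (u : ℝ) (x z : Lat d) :
    stepU α u (x + z) = stepU α u z + stepU α (Int.fract (dot α (toReal z) + u)) x := by
  rw [stepU, stepU, stepU, ← shiftIn_add, add_comm z x]
  congr 1
  rw [toReal_add, dot_add, ← Int.floor_intCast_add]
  congr 1
  have := Int.floor_add_fract (dot α (toReal z) + u)
  linarith

lemma IsFlow.cocycle {φ : Lat d → Lat d} (hφ : IsFlow α φ) (z : Lat d) :
    ∃ φ', IsFlow α φ' ∧ ∀ x, φ (x + z) = φ z + φ' x := by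
  induction hφ with
  | id => exact ⟨_, IsFlow.id, fun x => add_comm _ _⟩
  | @step φ u _ h0 h1 ih =>
    obtain ⟨φ', hφ', h⟩ := ih
    refine ⟨_, hφ'.step (Int.fract_nonneg (dot α (toReal (φ z)) + u)) (Int.fract_lt_one _),
      fun x => ?_⟩
    simp only [Function.comp_apply]
    rw [h, add_comm, stepU_add]

lemma IsFlow.map_zero {φ : Lat d → Lat d} (hφ : IsFlow α φ) : φ 0 = 0 := by
  induction hφ with
  | id => rfl
  | @step φ u _ h0 h1 ih =>
    have : ⌊u⌋ = 0 := Int.floor_eq_zero_iff.2 ⟨h0, h1⟩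
    simp [ih, stepU, this]

/-- Some finite set absorbs all finite sets under suitable flows. -/
lemma exists_absorbing (hA : ∀ x, Tendsto (fun n : ℕ => (arMap α ^ n) x) atTop (𝓝 0)) :
    ∃ B : Finset (Lat d), ∀ X : Finset (Lat d), ∃ φ, IsFlow α φ ∧ ∀ x ∈ X, φ x ∈ B := by
  classical
  obtain ⟨N, ρ, hρ0, hρ1, hnorm, hadd, hsmul, hcontr⟩ := exists_adapted_norm (arMap α) hA
  set b : ℝ := N (toReal (e0 d)) with hb
  have hb0 : 0 ≤ b := (norm_nonneg _).trans (hnorm _)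
  have hstep : ∀ x : Lat d, N (toReal (stepU α 0 x)) ≤ ρ * N (toReal x) + b := by
    intro x
    have h1 : toReal (stepU α 0 x) = arMap α (toReal x) +
        (-Int.fract (dot α (toReal x))) • toReal (e0 d) := by
      ext i
      refine Fin.cases ?_ (fun i => ?_) i
      · simp only [stepU, arMap_apply, toReal_apply, shiftIn_zero, Pi.add_apply, Pi.smul_apply, smul_eq_mul]
        have := Int.floor_add_fract (dot α (toReal x))
        simp
        linarith
      · simp [stepU, arMap_apply]
    rw [h1]
    refine (hadd _ _).trans (add_le_add (hcontr _) ?_)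
    rw [hsmul, abs_neg, abs_of_nonneg (Int.fract_nonneg _)]
    exact mul_le_of_le_one_left hb0 (Int.fract_lt_one _).le
  have hfl : ∀ n : ℕ, ∃ φ, IsFlow α φ ∧
      ∀ x, N (toReal (φ x)) ≤ ρ ^ n * N (toReal x) + b / (1 - ρ) := by
    intro n
    have h1 : 0 < 1 - ρ := by linarith
    induction n with
    | zero =>
      refine ⟨id, IsFlow.id, fun x => ?_⟩
      have : 0 ≤ b / (1 - ρ) := by positivity
      simpa using this
    | succ n ih =>
      obtain ⟨φ, hφ, h⟩ := ih
      refine ⟨_, hφ.step le_rfl zero_lt_one, fun x => (hstep _).trans ?_⟩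
      have h2 := mul_le_mul_of_nonneg_left (h x) hρ0.le
      have h3 : ρ * (b / (1 - ρ)) + b = b / (1 - ρ) := by field_simp; ring
      rw [pow_succ]
      nlinarith
  set C : ℝ := b / (1 - ρ) + 1 with hC
  have hfin : {x : Lat d | N (toReal x) ≤ C}.Finite := by
    have h1 : (Set.Icc (fun _ => -⌈C⌉ : Lat d) (fun _ => ⌈C⌉)).Finite := Set.finite_Icc _ _
    refine h1.subset fun x hx => ?_
    have h2 : ∀ i, |x i| ≤ ⌈C⌉ := by
      intro i
      have h3 := (norm_le_pi_norm (toReal x) i).trans ((hnorm _).trans hx)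
      rw [toReal_apply, Real.norm_eq_abs] at h3
      have h4 := h3.trans (Int.le_ceil C)
      exact_mod_cast h4
    exact ⟨fun i => (abs_le.1 (h2 i)).1, fun i => (abs_le.1 (h2 i)).2⟩
  refine ⟨hfin.toFinset, fun X => ?_⟩
  have hlim : ∀ x ∈ X, ∀ᶠ n : ℕ in atTop, ρ ^ n * N (toReal x) ≤ 1 := by
    intro x _
    have h1 := (tendsto_pow_atTop_nhds_zero_of_lt_one hρ0.le hρ1).mul_const (N (toReal x))
    rw [zero_mul] at h1
    exact h1.eventually (ge_mem_nhds zero_lt_one)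
  obtain ⟨n, hn⟩ := ((Finset.eventually_all X).2 hlim).exists
  obtain ⟨φ, hφ, h⟩ := hfl n
  refine ⟨φ, hφ, fun x hx => ?_⟩
  rw [Set.Finite.mem_toFinset, Set.mem_ofPred_eq]
  have := h x
  have := hn x hx
  linarith

/-! ### Rigid sets -/

/-- A finite set is rigid if no flow identifies two of its points. -/
def Rigid (α : Fin (d + 1) → ℝ) (X : Finset (Lat d)) : Prop :=
  ∀ φ, IsFlow α φ → Set.InjOn φ X

open Classical in
lemma Rigid.image {X : Finset (Lat d)} (hX : Rigid α X) {φ : Lat d → Lat d} (hφ : IsFlow α φ) :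
    Rigid α (X.image φ) := by
  intro ψ hψ
  have := hX _ (hψ.comp hφ)
  rw [Finset.coe_image]
  exact Set.InjOn.image_of_comp this

open Classical in
lemma Rigid.translate {X : Finset (Lat d)} (hX : Rigid α X) (z : Lat d) :
    Rigid α (X.image (· + z)) := by
  intro ψ hψ
  obtain ⟨ψ', hψ', h⟩ := hψ.cocycle z
  rw [Finset.coe_image]
  rintro _ ⟨x, hx, rfl⟩ _ ⟨y, hy, rfl⟩ hxy
  simp only [h, add_right_inj] at hxy
  rw [hX _ hψ' hx hy hxy]

-- Take a flow whose image of Y has the fewest points; no further flow can merge two of them.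
open Classical in
lemma exists_rigid_image (Y : Finset (Lat d)) : ∃ φ, IsFlow α φ ∧ Rigid α (Y.image φ) := by
  have hne : ∃ n, ∃ φ, IsFlow α φ ∧ (Y.image φ).card = n := ⟨_, id, IsFlow.id, rfl⟩
  obtain ⟨φ, hφ, hc⟩ := Nat.find_spec hne
  refine ⟨φ, hφ, fun ψ hψ => ?_⟩
  rw [← Finset.card_image_iff]
  refine le_antisymm Finset.card_image_le ?_
  rw [hc]
  refine Nat.find_min' hne ⟨ψ ∘ φ, hψ.comp hφ, ?_⟩
  rw [Finset.image_image]

/-- The rigid sets with `m` elements. -/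
def rigidSets (α : Fin (d + 1) → ℝ) (m : ℕ) : Set (Finset (Lat d)) :=
  {K | Rigid α K ∧ K.card = m}

variable {m : ℕ}

open Classical in
lemma rigidSets_translate {K : Finset (Lat d)} (hK : K ∈ rigidSets α m) (z : Lat d) :
    K.image (· + z) ∈ rigidSets α m :=
  ⟨hK.1.translate z, by rw [Finset.card_image_of_injective _ (add_left_injective z), hK.2]⟩

open Classical in
lemma rigidSets_stepU {K : Finset (Lat d)} (hK : K ∈ rigidSets α m) {u : ℝ} (h0 : 0 ≤ u)
    (h1 : u < 1) : K.image (stepU α u) ∈ rigidSets α m :=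
  ⟨hK.1.image (isFlow_stepU h0 h1),
    by rw [Finset.card_image_of_injOn (hK.1 _ (isFlow_stepU h0 h1)), hK.2]⟩

open Classical in
/-- If a rigid image contains the image of a maximal rigid set, then the two images agree. -/
lemma image_eq_of_maximal (hmax : ∀ X : Finset (Lat d), Rigid α X → X.card ≤ m)
    {K Y : Finset (Lat d)} (hK : K ∈ rigidSets α m) {φ : Lat d → Lat d} (hφ : IsFlow α φ)
    (hY : Rigid α (Y.image φ)) (hKY : K ⊆ Y) : K.image φ = Y.image φ := by
  refine Finset.eq_of_subset_of_card_le (Finset.image_subset_image hKY) ?_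
  rw [Finset.card_image_of_injOn (hK.1 φ hφ), hK.2]
  exact hmax _ hY

-- K is mapped bijectively onto the image of Y, so it is a transversal of the fibres of φ on Y.
open Classical in
lemma card_filter_eq_one (hmax : ∀ X : Finset (Lat d), Rigid α X → X.card ≤ m)
    {K Y : Finset (Lat d)} (hK : K ∈ rigidSets α m) {φ : Lat d → Lat d} (hφ : IsFlow α φ)
    (hY : Rigid α (Y.image φ)) (hKY : K ⊆ Y) {w : Lat d} (hw : w ∈ Y.image φ) :
    (K.filter fun k => φ k = w).card = 1 := by
  rw [← image_eq_of_maximal hmax hK hφ hY hKY] at hw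
  obtain ⟨k, hk, rfl⟩ := Finset.mem_image.1 hw
  rw [Finset.card_eq_one]
  refine ⟨k, ?_⟩
  ext x
  simp only [Finset.mem_filter, Finset.mem_singleton]
  exact ⟨fun h => hK.1 φ hφ h.1 hk h.2, fun h => by rw [h]; exact ⟨hk, rfl⟩⟩

/-- Either every point can be sent to `0`, or there are maximal rigid sets with at least two
points. -/
lemma exists_maximal_rigid (hA : ∀ x, Tendsto (fun n : ℕ => (arMap α ^ n) x) atTop (𝓝 0))
    {x : Lat d} (hx : ∀ φ, IsFlow α φ → φ x ≠ 0) :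
    ∃ m, 2 ≤ m ∧ (rigidSets α m).Nonempty ∧ ∀ X, Rigid α X → X.card ≤ m := by
  classical
  obtain ⟨B, hB⟩ := exists_absorbing hA
  -- Some flow maps X into the absorbing set, injectively by rigidity.
  have hbd : ∀ X, Rigid α X → X.card ≤ B.card := by
    intro X hX
    obtain ⟨φ, hφ, h⟩ := hB X
    exact Finset.card_le_card_of_injOn φ h (hX φ hφ)
  have hx0 : x ≠ 0 := hx _ IsFlow.id
  have h2 : Rigid α {0, x} := by
    intro φ hφ
    have h0 := hφ.map_zero
    have h1 := hx φ hφ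
    intro a ha b hb hab
    simp only [Finset.coe_insert, Finset.coe_singleton, Set.mem_insert_iff,
      Set.mem_singleton_iff] at ha hb
    rcases ha with rfl | rfl <;> rcases hb with rfl | rfl
    · rfl
    · exact absurd (hab.symm.trans h0) h1
    · exact absurd (hab.trans h0) h1
    · rfl
  set P : ℕ → Prop := fun n => ∃ X, Rigid α X ∧ X.card = n with hP
  have hP2 : P 2 := ⟨_, h2, Finset.card_pair hx0.symm⟩
  have hle : 2 ≤ B.card := by
    have := hbd _ h2
    rwa [Finset.card_pair hx0.symm] at this
  refine ⟨Nat.findGreatest P B.card, Nat.le_findGreatest hle hP2, Nat.findGreatest_spec hle hP2,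
    fun X hX => Nat.le_findGreatest (hbd X hX) ⟨X, hX, rfl⟩⟩

end RoundingAR

namespace RoundingAR
variable {d : ℕ}

/-! ### Group rings -/

section GroupRing

variable (R : Type*) [CommRing R]

/-- The indicator of a finite set as an element of the group ring. -/
noncomputable def indic (K : Finset (Lat d)) : AddMonoidAlgebra R (Lat d) :=
  ∑ k ∈ K, AddMonoidAlgebra.single k 1

/-- The augmentation of the group ring. -/
noncomputable def aug : AddMonoidAlgebra R (Lat d) →ₐ[R] R := AddMonoidAlgebra.lift R R (Lat d) 1

variable {R}

@[simp] lemma aug_single (g : Lat d) (r : R) : aug R (AddMonoidAlgebra.single g r) = r := by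
  simp [aug]

lemma aug_indic (K : Finset (Lat d)) : aug R (indic R K) = K.card := by
  simp [indic]

/-- The linear pairing of the group ring with a function. -/
noncomputable def pairing {S : Type*} [AddCommGroup S] [Module R S] (t : Lat d → S) :
    AddMonoidAlgebra R (Lat d) →ₗ[R] S :=
  (Finsupp.linearCombination R t) ∘ₗ (AddMonoidAlgebra.coeffLinearEquiv R).toLinearMap

@[simp] lemma pairing_single {S : Type*} [AddCommGroup S] [Module R S] (t : Lat d → S) (g : Lat d)
    (r : R) : pairing t (AddMonoidAlgebra.single g r) = r • t g := by
  simp [pairing]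

lemma pairing_indic {S : Type*} [AddCommGroup S] [Module R S] (t : Lat d → S)
    (K : Finset (Lat d)) : pairing t (indic R K) = ∑ k ∈ K, t k := by
  simp [indic]

lemma pairing_single_mul_indic {S : Type*} [AddCommGroup S] [Module R S] (t : Lat d → S)
    (g : Lat d) (r : R) (K : Finset (Lat d)) :
    pairing t (AddMonoidAlgebra.single g r * indic R K) = r • ∑ k ∈ K, t (k + g) := by
  simp [indic, Finset.mul_sum, AddMonoidAlgebra.single_mul_single, Finset.smul_sum, add_comm]

end GroupRing

variable {α : Fin (d + 1) → ℝ} {m : ℕ}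

-- For G = g the pairing counts the points of the translate K + g in the fibre over w, of which
-- there is exactly one as soon as Y contains that translate. The general case is linear in G.
open Classical in
lemma exists_pairing_mul_indic {R : Type*} [CommRing R]
    (hmax : ∀ X : Finset (Lat d), Rigid α X → X.card ≤ m)
    {K : Finset (Lat d)} (hK : K ∈ rigidSets α m) (G : AddMonoidAlgebra R (Lat d)) :
    ∃ Y₀ : Finset (Lat d), ∀ Y, Y₀ ⊆ Y → ∀ φ, IsFlow α φ → Rigid α (Y.image φ) →
      ∀ w ∈ Y.image φ,
        pairing (fun g => if φ g = w then (1 : R) else 0) (G * indic R K) = aug R G := by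
  induction G using AddMonoidAlgebra.induction_linear with
  | zero => exact ⟨∅, by simp⟩
  | add F G hF hG =>
    obtain ⟨Y₁, h1⟩ := hF
    obtain ⟨Y₂, h2⟩ := hG
    refine ⟨Y₁ ∪ Y₂, fun Y hY φ hφ hr w hw => ?_⟩
    rw [add_mul, map_add, map_add, h1 Y (Finset.union_subset_left hY) φ hφ hr w hw,
      h2 Y (Finset.union_subset_right hY) φ hφ hr w hw]
  | single g r =>
    refine ⟨K.image (· + g), fun Y hY φ hφ hr w hw => ?_⟩
    have h1 := card_filter_eq_one hmax (rigidSets_translate hK g) hφ hr hY hw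
    rw [pairing_single_mul_indic, aug_single]
    have h2 : ∑ k ∈ K, (if φ (k + g) = w then (1 : R) else 0) = 1 := by
      rw [← Finset.sum_image (s := K) (g := (· + g)) (f := fun x => if φ x = w then (1 : R) else 0)
        (fun a _ b _ h => add_left_injective g h), Finset.sum_boole, h1, Nat.cast_one]
    rw [h2, smul_eq_mul, mul_one]

/-! ### Dilations of maximal rigid sets -/

-- In characteristic l, Frobenius turns the l-th power of the indicator of K into that of the dilate
-- lK, while by Fermat the (l-1)-th power has augmentation m^(l-1) = 1. Hence every fibre of a
-- suitable flow pairs to 1 with lK and so meets it; the dilate therefore still has m points, and no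
-- flow merges any of them.
open Classical in
lemma rigidSets_prime_smul (hmax : ∀ X : Finset (Lat d), Rigid α X → X.card ≤ m)
    {K : Finset (Lat d)} (hK : K ∈ rigidSets α m) {l : ℕ} (hl : l.Prime) (hlm : ¬ l ∣ m) :
    K.image (l • ·) ∈ rigidSets α m := by
  have : Fact l.Prime := ⟨hl⟩
  have : CharP (AddMonoidAlgebra (ZMod l) (Lat d)) l :=
    charP_of_injective_algebraMap (FaithfulSMul.algebraMap_injective (ZMod l) _) l
  have hpow : indic (ZMod l) K ^ (l - 1) * indic (ZMod l) K
      = ∑ k ∈ K, AddMonoidAlgebra.single (l • k) 1 := by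
    rw [← pow_succ, Nat.sub_add_cancel hl.one_le, indic, sum_pow_char]
    exact Finset.sum_congr rfl fun k _ => by rw [AddMonoidAlgebra.single_pow, one_pow]
  have haug : aug (ZMod l) (indic (ZMod l) K ^ (l - 1)) = 1 := by
    rw [map_pow, aug_indic, hK.2]
    apply ZMod.pow_card_sub_one_eq_one
    rwa [Ne, ZMod.natCast_eq_zero_iff]
  obtain ⟨Y₀, hY₀⟩ := exists_pairing_mul_indic hmax hK (indic (ZMod l) K ^ (l - 1))
  have key : ∀ ψ, IsFlow α ψ → (K.image (l • ·)).card = m ∧ Set.InjOn ψ (K.image (l • ·)) := by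
    intro ψ hψ
    obtain ⟨χ, hχ, hr⟩ := exists_rigid_image (α := α) ((Y₀ ∪ K).image ψ)
    rw [Finset.image_image] at hr
    have hφ := hχ.comp hψ
    set φ := χ ∘ ψ with hφdef
    have hsub : (Y₀ ∪ K).image φ ⊆ (K.image (l • ·)).image φ := by
      intro w hw
      have h1 := hY₀ _ Finset.subset_union_left φ hφ hr w hw
      rw [hpow, haug, map_sum] at h1
      by_contra hcon
      have h2 : ∀ k ∈ K, φ (l • k) ≠ w := fun k hk h =>
        hcon (Finset.mem_image.2 ⟨_, Finset.mem_image_of_mem _ hk, h⟩)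
      rw [Finset.sum_eq_zero] at h1
      · exact zero_ne_one h1
      · intro k hk
        rw [pairing_single, if_neg (h2 k hk), smul_zero]
    have h3 := Finset.card_le_card hsub
    rw [← image_eq_of_maximal hmax hK hφ hr Finset.subset_union_right,
      Finset.card_image_of_injOn (hK.1 φ hφ), hK.2] at h3
    have h4 : ((K.image (l • ·)).image φ).card ≤ (K.image (l • ·)).card := Finset.card_image_le
    have h5 : (K.image (l • ·)).card ≤ m := by
      rw [← hK.2]; exact Finset.card_image_le
    refine ⟨by omega, ?_⟩
    have h6 : Set.InjOn φ (K.image (l • ·)) := Finset.card_image_iff.1 (by omega)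
    exact Set.InjOn.of_comp h6
  exact ⟨fun ψ hψ => (key ψ hψ).2, (key id IsFlow.id).1⟩

open Classical in
lemma rigidSets_smul (hmax : ∀ X : Finset (Lat d), Rigid α X → X.card ≤ m) (r : ℕ) (hr : 0 < r)
    (hrm : r.Coprime m) :
    ∀ {K : Finset (Lat d)}, K ∈ rigidSets α m → K.image (r • ·) ∈ rigidSets α m := by
  induction r using Nat.recOnMul with
  | zero => exact absurd hr (lt_irrefl 0)
  | one => intro K hK; simpa using hK
  | prime l hl =>
    exact fun hK => rigidSets_prime_smul hmax hK hl ((Nat.Prime.coprime_iff_not_dvd hl).1 hrm)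
  | mul a b iha ihb =>
    intro K hK
    have h1 := ihb (Nat.pos_of_mul_pos_left hr) (Nat.Coprime.coprime_mul_left hrm) hK
    have h2 := iha (Nat.pos_of_mul_pos_right hr) (Nat.Coprime.coprime_mul_right hrm) h1
    rw [Finset.image_image] at h2
    convert h2 using 2
    ext x : 1
    simp [mul_smul]

/-! ### The ideal of maximal rigid sets -/

open Classical in
/-- There is a maximal ideal of the rational group ring containing all maximal rigid sets. -/
lemma exists_maximal_ideal (hmax : ∀ X : Finset (Lat d), Rigid α X → X.card ≤ m) (hm : 2 ≤ m)
    (hne : (rigidSets α m).Nonempty) :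
    ∃ M : Ideal (AddMonoidAlgebra ℚ (Lat d)), M.IsMaximal ∧
      ∀ K ∈ rigidSets α m, indic ℚ K ∈ M := by
  -- `P φ w F` adds the coefficients of F over the fibre of φ above w. The ideal `I` consists of the
  -- F all of whose multiples have, for every large Y, equal sums over all fibres meeting Y.
  -- Indicators of maximal rigid sets qualify, the common sum being an augmentation. The unit does
  -- not: there are at least m ≥ 2 such fibres and only one contains 0.
  let P : (Lat d → Lat d) → Lat d → AddMonoidAlgebra ℚ (Lat d) → ℚ :=
    fun φ w => pairing (fun g => if φ g = w then (1 : ℚ) else 0)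
  let Q : AddMonoidAlgebra ℚ (Lat d) → Prop := fun F => ∃ Y₀ : Finset (Lat d), ∀ Y, Y₀ ⊆ Y →
    ∀ φ, IsFlow α φ → Rigid α (Y.image φ) → ∀ w ∈ Y.image φ, ∀ w' ∈ Y.image φ, P φ w F = P φ w' F
  let I : Ideal (AddMonoidAlgebra ℚ (Lat d)) :=
    { carrier := {F | ∀ G, Q (G * F)}
      zero_mem' := fun G => ⟨∅, fun Y _ φ _ _ w _ w' _ => by simp [P]⟩
      add_mem' := by
        intro F F' hF hF' G
        obtain ⟨Y₁, h1⟩ := hF G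
        obtain ⟨Y₂, h2⟩ := hF' G
        refine ⟨Y₁ ∪ Y₂, fun Y hY φ hφ hr w hw w' hw' => ?_⟩
        have e1 := h1 Y (Finset.union_subset_left hY) φ hφ hr w hw w' hw'
        have e2 := h2 Y (Finset.union_subset_right hY) φ hφ hr w hw w' hw'
        simp only [P, mul_add, map_add] at *
        rw [e1, e2]
      smul_mem' := by
        intro H F hF G
        have := hF (G * H)
        rwa [mul_assoc] at this }
  have hI : I ≠ ⊤ := by
    intro htop
    have h1 : (1 : AddMonoidAlgebra ℚ (Lat d)) ∈ I := by rw [htop]; trivial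
    obtain ⟨Y₀, h⟩ := h1 1
    obtain ⟨K, hK⟩ := hne
    obtain ⟨φ, hφ, hr⟩ := exists_rigid_image (α := α) (Y₀ ∪ K ∪ {0})
    have hcard : 1 < ((Y₀ ∪ K ∪ {0}).image φ).card := by
      rw [← image_eq_of_maximal hmax hK hφ hr
        (Finset.subset_union_right.trans Finset.subset_union_left),
        Finset.card_image_of_injOn (hK.1 φ hφ), hK.2]
      omega
    have hw : φ 0 ∈ (Y₀ ∪ K ∪ {0}).image φ := Finset.mem_image_of_mem _ (by simp)
    obtain ⟨w, hw', hne⟩ := Finset.exists_mem_ne hcard (φ 0)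
    have := h _ (Finset.subset_union_left.trans Finset.subset_union_left) φ hφ hr _ hw w hw'
    rw [one_mul, AddMonoidAlgebra.one_def] at this
    simp only [P, pairing_single, if_true, if_neg hne.symm] at this
    norm_num at this
  obtain ⟨M, hM, hle⟩ := Ideal.exists_le_maximal I hI
  refine ⟨M, hM, fun K hK => hle fun G => ?_⟩
  obtain ⟨Y₀, h⟩ := exists_pairing_mul_indic hmax hK G
  exact ⟨Y₀, fun Y hY φ hφ hr w hw w' hw' => by
    simp only [P]
    rw [h Y hY φ hφ hr w hw, h Y hY φ hφ hr w' hw']⟩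

/-! ### Partial characters -/

section PartialChar

variable {Ω : Type*} [Field Ω]

/-- A function which is a character on a subgroup and vanishes elsewhere. -/
structure IsPartialChar (t : Lat d → Ω) : Prop where
  map_zero : t 0 = 1
  map_add : ∀ g h, t g ≠ 0 → t (g + h) = t g * t h

/-- The sums over all maximal rigid sets vanish. -/
def Annihilates (α : Fin (d + 1) → ℝ) (m : ℕ) (t : Lat d → Ω) : Prop :=
  ∀ K ∈ rigidSets α m, ∑ k ∈ K, t k = 0

lemma Annihilates.translate {t : Lat d → Ω} (ht : Annihilates α m t) {K : Finset (Lat d)}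
    (hK : K ∈ rigidSets α m) (z : Lat d) : ∑ k ∈ K, t (k + z) = 0 := by
  classical
  have := ht _ (rigidSets_translate hK z)
  rwa [Finset.sum_image (fun a _ b _ h => add_left_injective z h)] at this

open Classical in
/-- Finitely many maximal rigid sets suffice to test the vanishing of all sums. -/
lemma exists_finite_test [CharZero Ω] : ∃ T : Finset (Finset (Lat d)),
    (∀ K ∈ T, K ∈ rigidSets α m) ∧ ∀ t : Lat d → Ω,
      (∀ K ∈ T, ∀ z, ∑ k ∈ K, t (k + z) = 0) → Annihilates α m t := by
  have : AddMonoid.FG (Lat d) :=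
    AddGroup.fg_iff_addMonoid_fg.1 (Module.Finite.iff_addGroup_fg.1 inferInstance)
  have : IsNoetherianRing (AddMonoidAlgebra ℚ (Lat d)) :=
    Algebra.FiniteType.isNoetherianRing ℚ _
  -- Hilbert's basis theorem: finitely many indicators generate the ideal of all of them, and
  -- vanishing on all translates of the sets in T amounts to vanishing on that ideal.
  have hfg := (isNoetherianRing_iff_ideal_fg _).1 this (Ideal.span (indic ℚ '' rigidSets α m))
  obtain ⟨S, hS, hspan⟩ := (Submodule.fg_span_iff_fg_span_finset_subset _).1 hfg
  obtain ⟨T, hT, rfl⟩ := Finset.subset_set_image_iff.1 hS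
  refine ⟨T, hT, fun t ht K hK => ?_⟩
  let A : Ideal (AddMonoidAlgebra ℚ (Lat d)) :=
    { carrier := {F | ∀ G, pairing t (G * F) = 0}
      zero_mem' := fun G => by simp
      add_mem' := fun {F F'} hF hF' G => by rw [mul_add, _root_.map_add, hF, hF', add_zero]
      smul_mem' := fun H F hF G => by
        have := hF (G * H)
        rwa [mul_assoc] at this }
  have hle : Ideal.span (indic ℚ '' rigidSets α m) ≤ A := by
    change Submodule.span _ _ ≤ A
    rw [hspan, Submodule.span_le]
    intro F hF G
    obtain ⟨K, hK, rfl⟩ := Finset.mem_image.1 (Finset.mem_coe.1 hF)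
    induction G using AddMonoidAlgebra.induction_linear with
    | zero => simp
    | add F G hF hG => rw [add_mul, _root_.map_add, hF, hG, add_zero]
    | single g r => rw [pairing_single_mul_indic, ht K hK, smul_zero]
  have := hle (Ideal.subset_span (Set.mem_image_of_mem _ hK)) 1
  rwa [one_mul, pairing_indic] at this

end PartialChar

/-- Existence of an annihilating character. -/
lemma exists_character (hmax : ∀ X : Finset (Lat d), Rigid α X → X.card ≤ m) (hm : 2 ≤ m)
    (hne : (rigidSets α m).Nonempty) :
    ∃ (Ω : Type) (_ : Field Ω) (_ : CharZero Ω) (_ : IsAlgClosed Ω) (t : Lat d → Ω),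
      IsPartialChar t ∧ Annihilates α m t := by
  obtain ⟨M, hM, h⟩ := exists_maximal_ideal hmax hm hne
  let : Field (AddMonoidAlgebra ℚ (Lat d) ⧸ M) := Ideal.Quotient.field M
  let ι : AddMonoidAlgebra ℚ (Lat d) →+* AlgebraicClosure (AddMonoidAlgebra ℚ (Lat d) ⧸ M) :=
    (algebraMap _ _).comp (Ideal.Quotient.mk M)
  have : CharZero (AddMonoidAlgebra ℚ (Lat d) ⧸ M) := algebraRat.charZero _
  have : CharZero (AlgebraicClosure (AddMonoidAlgebra ℚ (Lat d) ⧸ M)) :=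
    charZero_of_injective_algebraMap (algebraMap (AddMonoidAlgebra ℚ (Lat d) ⧸ M) _).injective
  refine ⟨AlgebraicClosure (AddMonoidAlgebra ℚ (Lat d) ⧸ M), inferInstance, inferInstance,
    inferInstance, fun g => ι (AddMonoidAlgebra.single g 1), ⟨?_, ?_⟩, ?_⟩
  · rw [← AddMonoidAlgebra.one_def, map_one]
  · intro g h _
    rw [← map_mul, AddMonoidAlgebra.single_mul_single, one_mul]
  · intro K hK
    rw [← map_sum]
    change algebraMap _ _ (Ideal.Quotient.mk M (indic ℚ K)) = 0
    rw [Ideal.Quotient.eq_zero_iff_mem.2 (h K hK), map_zero]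

end RoundingAR

namespace RoundingAR
variable {d : ℕ} {α : Fin (d + 1) → ℝ} {m : ℕ} {Ω : Type*} [Field Ω]

namespace IsPartialChar

variable {t : Lat d → Ω} (ht : IsPartialChar t)
include ht

lemma ne_zero_neg {g : Lat d} (hg : t g ≠ 0) : t g * t (-g) = 1 := by
  rw [← ht.map_add _ _ hg, add_neg_cancel, ht.map_zero]

/-- The support of a partial character. -/
def supp : AddSubgroup (Lat d) where
  carrier := {g | t g ≠ 0}
  zero_mem' := by simp [ht.map_zero]
  add_mem' := fun {a b} ha hb => by
    change t (a + b) ≠ 0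
    rw [ht.map_add _ _ ha]
    exact mul_ne_zero ha hb
  neg_mem' := fun {a} ha => right_ne_zero_of_mul_eq_one (ht.ne_zero_neg ha)

/-- The kernel of a partial character. -/
def ker : AddSubgroup (Lat d) where
  carrier := {g | t g = 1}
  zero_mem' := ht.map_zero
  add_mem' := fun {a b} ha hb => by
    change t a = 1 at ha
    change t b = 1 at hb
    change t (a + b) = 1
    rw [ht.map_add a b (by rw [ha]; exact one_ne_zero), ha, hb, one_mul]
  neg_mem' := fun {a} ha => by
    change t a = 1 at ha
    have := ht.ne_zero_neg (g := a) (by rw [ha]; exact one_ne_zero)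
    rwa [ha, one_mul] at this

@[simp] lemma mem_supp {g : Lat d} : g ∈ ht.supp ↔ t g ≠ 0 := Iff.rfl

@[simp] lemma mem_ker {g : Lat d} : g ∈ ht.ker ↔ t g = 1 := Iff.rfl

lemma map_add_right (g : Lat d) {h : Lat d} (hh : t h ≠ 0) : t (g + h) = t g * t h := by
  rw [add_comm, ht.map_add _ _ hh, mul_comm]

lemma map_add_ker (g : Lat d) {h : Lat d} (hh : t h = 1) : t (g + h) = t g := by
  rw [ht.map_add_right g (by rw [hh]; exact one_ne_zero), hh, mul_one]

lemma map_nsmul {g : Lat d} (hg : t g ≠ 0) (n : ℕ) : t (n • g) = t g ^ n := by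
  induction n with
  | zero => simp [ht.map_zero]
  | succ n ih => rw [succ_nsmul, ht.map_add_right _ hg, ih, pow_succ]

omit ht in
open Classical in
/-- Restriction of a function to a subgroup, extended by zero. -/
noncomputable def restrict (t : Lat d → Ω) (Q : AddSubgroup (Lat d)) (g : Lat d) : Ω :=
  if g ∈ Q then t g else 0

lemma isPartialChar_restrict (Q : AddSubgroup (Lat d)) : IsPartialChar (restrict t Q) := by
  constructor
  · simp [restrict, ht.map_zero]
  · intro g h hg
    have hgQ : g ∈ Q := by
      by_contra hcon
      simp [restrict, hcon] at hg
    simp only [restrict, if_pos hgQ] at hg ⊢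
    rw [add_mem_cancel_left hgQ]
    split_ifs
    · rw [ht.map_add _ _ hg]
    · simp

/-- Restricting an annihilating partial character to a subgroup that contains the relevant short
vectors of its support keeps it annihilating. -/
lemma annihilates_restrict {T : Finset (Finset (Lat d))} (hT : ∀ K ∈ T, K ∈ rigidSets α m)
    (htest : ∀ t : Lat d → Ω, (∀ K ∈ T, ∀ z, ∑ k ∈ K, t (k + z) = 0) → Annihilates α m t)
    (ha : Annihilates α m t) (Q : AddSubgroup (Lat d))
    (hQ : ∀ K ∈ T, ∀ k ∈ K, ∀ k' ∈ K, t (k - k') ≠ 0 → k - k' ∈ Q) :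
    Annihilates α m (restrict t Q) := by
  refine htest _ fun K hK z => ?_
  -- Once one point of the translate lies in Q and in the support, all its support points do, since
  -- their differences lie in Q. So the restricted sum is either the full sum or empty.
  by_cases h : ∃ k₀ ∈ K, restrict t Q (k₀ + z) ≠ 0
  · obtain ⟨k₀, hk₀, h0⟩ := h
    have h0Q : k₀ + z ∈ Q := by
      by_contra hcon
      simp [restrict, hcon] at h0
    rw [restrict, if_pos h0Q] at h0
    rw [← ha.translate (hT K hK) z]
    refine Finset.sum_congr rfl fun k hk => ?_
    by_cases hkz : t (k + z) = 0
    · simp [restrict, hkz]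
    · have h1 : k - k₀ ∈ ht.supp := by
        have := sub_mem (H := ht.supp) (show k + z ∈ ht.supp from hkz) (show k₀ + z ∈ ht.supp from h0)
        simpa using this
      have h2 := add_mem (hQ K hK k hk k₀ hk₀ h1) h0Q
      rw [← add_assoc, sub_add_cancel] at h2
      rw [restrict, if_pos h2]
  · push Not at h
    exact Finset.sum_eq_zero h

end IsPartialChar

/-! ### Successors of annihilating partial characters -/

/-- K is finite, so subtracting the sum over φ ≥ r from the sum over φ ≥ s, with r slightly above s,
isolates the level φ = s. -/
lemma sum_level_eq_zero {ι : Type*} (K : Finset ι) (φ : ι → ℝ) (δ : ι → Ω) (hφ : ∀ k ∈ K, φ k < 1)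
    (h : ∀ s, 0 < s → s < 1 → ∑ k ∈ K, (if s ≤ φ k then δ k else 0) = 0) {s : ℝ} (hs : 0 < s) :
    ∑ k ∈ K, (if φ k = s then δ k else 0) = 0 := by
  by_cases hs1 : s < 1
  · have h1 : ∀ k ∈ K, ∀ᶠ r in 𝓝[>] s, s < φ k → r ≤ φ k := by
      intro k _
      by_cases hk : s < φ k
      · filter_upwards [Ioc_mem_nhdsGT hk] with r hr _
        exact hr.2
      · exact Eventually.of_forall fun r hr => absurd hr hk
    obtain ⟨r, hr, hr1, hr2⟩ := (((Finset.eventually_all K).2 h1).and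
      (Ioo_mem_nhdsGT hs1)).exists
    have e1 := h s hs hs1
    have e2 := h r (hs.trans hr1) hr2
    have e3 : ∑ k ∈ K, (if s ≤ φ k then δ k else 0) = ∑ k ∈ K, (if φ k = s then δ k else 0) +
        ∑ k ∈ K, (if r ≤ φ k then δ k else 0) := by
      rw [← Finset.sum_add_distrib]
      refine Finset.sum_congr rfl fun k hk => ?_
      rcases lt_trichotomy s (φ k) with h2 | h2 | h2
      · rw [if_pos h2.le, if_neg h2.ne', if_pos (hr k hk h2), zero_add]
      · rw [if_pos h2.le, if_pos h2.symm, if_neg (by rw [← h2]; exact not_le.2 hr1), add_zero]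
      · rw [if_neg (not_le.2 h2), if_neg h2.ne, if_neg (not_le.2 (h2.trans hr1)), add_zero]
    rw [e1, e2, add_zero] at e3
    exact e3.symm
  · refine Finset.sum_eq_zero fun k hk => if_neg ?_
    have := hφ k hk
    intro h'
    exact hs1 (h' ▸ this)

lemma shiftIn_eq_add (c : ℤ) (x : Lat d) : shiftIn c x = shiftIn 0 x + c • e0 d := by
  ext i
  refine Fin.cases ?_ (fun i => ?_) i <;> simp

lemma stepU_eq_add {u : ℝ} (h0 : 0 ≤ u) (h1 : u < 1) (x : Lat d) :
    stepU α u x = stepU α 0 x + (if 1 - u ≤ Int.fract (dot α (toReal x)) then e0 d else 0) := by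
  have h2 := Int.floor_add_fract (dot α (toReal x))
  have h3 := Int.fract_lt_one (dot α (toReal x))
  have h4 := Int.fract_nonneg (dot α (toReal x))
  rw [stepU, stepU, shiftIn_eq_add, shiftIn_eq_add (⌊dot α (toReal x) + 0⌋), add_assoc, add_zero]
  congr 1
  split_ifs with h
  · have : ⌊dot α (toReal x) + u⌋ = ⌊dot α (toReal x)⌋ + 1 := by
      rw [Int.floor_eq_iff]
      push_cast
      constructor <;> linarith
    rw [this, add_smul, one_smul]
  · have : ⌊dot α (toReal x) + u⌋ = ⌊dot α (toReal x)⌋ := by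
      rw [Int.floor_eq_iff]
      constructor <;> linarith
    rw [this, add_zero]

/-- A finite sum of translates of a partial character that is invariant under translation by `e₀`
vanishes unless `e₀` has finite order modulo the kernel. -/
lemma sum_eq_zero_of_periodic {t : Lat d → Ω} (ht : IsPartialChar t)
    (hcase : (∀ q : ℕ, 0 < q → t (q • e0 d) = 0) ∨
      ∃ q : ℕ, 0 < q ∧ t (q • e0 d) ≠ 0 ∧ t (q • e0 d) ≠ 1)
    {ι : Type*} (K : Finset ι) (y : ι → Lat d)
    (h : ∀ z, ∑ k ∈ K, t (y k + (z + e0 d)) = ∑ k ∈ K, t (y k + z)) (z : Lat d) :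
    ∑ k ∈ K, t (y k + z) = 0 := by
  have hn : ∀ n : ℕ, ∑ k ∈ K, t (y k + (z + n • e0 d)) = ∑ k ∈ K, t (y k + z) := by
    intro n
    induction n with
    | zero => simp
    | succ n ih => rw [succ_nsmul, ← add_assoc, h, ih]
  -- If no positive multiple of e₀ lies in the support, each term is nonzero for at most one n, and
  -- a large translation empties the sum. Otherwise translation by q e₀ multiplies the sum by t(q
  -- e₀) ≠ 1 and yet preserves it.
  rcases hcase with hq | ⟨q, -, hq0, hq1⟩
  · have h1 : ∀ k ∈ K, ∀ᶠ n : ℕ in atTop, t (y k + (z + n • e0 d)) = 0 := by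
      intro k _
      by_cases hex : ∃ n₀ : ℕ, t (y k + (z + n₀ • e0 d)) ≠ 0
      · obtain ⟨n₀, hn₀⟩ := hex
        filter_upwards [eventually_gt_atTop n₀] with n hn
        by_contra hcon
        have h2 := sub_mem (H := ht.supp) (show y k + (z + n • e0 d) ∈ ht.supp from hcon)
          (show y k + (z + n₀ • e0 d) ∈ ht.supp from hn₀)
        have h3 : y k + (z + n • e0 d) - (y k + (z + n₀ • e0 d)) = (n - n₀) • e0 d := by
          rw [sub_nsmul _ hn.le]
          abel
        rw [h3] at h2
        exact h2 (hq _ (by omega))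
      · push Not at hex
        exact Eventually.of_forall hex
    obtain ⟨n, hn'⟩ := ((Finset.eventually_all K).2 h1).exists
    rw [← hn n]
    exact Finset.sum_eq_zero hn'
  · have h1 := hn q
    have h2 : ∑ k ∈ K, t (y k + (z + q • e0 d)) = (∑ k ∈ K, t (y k + z)) * t (q • e0 d) := by
      rw [Finset.sum_mul]
      exact Finset.sum_congr rfl fun k _ => by rw [← add_assoc, ht.map_add_right _ hq0]
    rw [h2] at h1
    by_contra hne
    exact hq1 (mul_left_cancel₀ hne (h1.trans (mul_one _).symm))

open Classical in
/-- Pull-back of a function along the companion map, on the vectors with integral image. -/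
noncomputable def integralPull (α : Fin (d + 1) → ℝ) (t : Lat d → Ω) (a : Lat d) : Ω :=
  if Int.fract (dot α (toReal a)) = 0 then t (stepU α 0 a) else 0

lemma isPartialChar_integralPull {t : Lat d → Ω} (ht : IsPartialChar t) :
    IsPartialChar (integralPull α t) := by
  constructor
  · have : stepU α 0 0 = 0 := (isFlow_stepU (α := α) le_rfl zero_lt_one).map_zero
    simp [integralPull, this, ht.map_zero]
  · intro g h hg
    have hg0 : Int.fract (dot α (toReal g)) = 0 := by
      by_contra hcon
      simp [integralPull, hcon] at hg
    simp only [integralPull, if_pos hg0] at hg ⊢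
    have h1 : Int.fract (dot α (toReal (g + h))) = Int.fract (dot α (toReal h)) := by
      have := Int.floor_add_fract (dot α (toReal g))
      rw [hg0, add_zero] at this
      rw [toReal_add, dot_add, ← this, Int.fract_intCast_add]
    rw [h1, add_comm g h, stepU_add, add_zero, hg0, ht.map_add _ _ hg]
    split_ifs <;> simp

/-- All images of K under the thresholds u have sum zero. Comparing them shows that over each level
set of positive fractional part the sum is invariant under translation by e₀, hence zero. What is
left of the total is the sum over the points with integral linear form, on which rounding is the
companion map itself. -/
lemma annihilates_integralPull {t : Lat d → Ω} (ht : IsPartialChar t) (ha : Annihilates α m t)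
    (hcase : (∀ q : ℕ, 0 < q → t (q • e0 d) = 0) ∨
      ∃ q : ℕ, 0 < q ∧ t (q • e0 d) ≠ 0 ∧ t (q • e0 d) ≠ 1) :
    Annihilates α m (integralPull α t) := by
  classical
  intro K hK
  set φ : Lat d → ℝ := fun k => Int.fract (dot α (toReal k)) with hφ
  have hu : ∀ u, 0 ≤ u → u < 1 → ∀ z, ∑ k ∈ K, t (stepU α u k + z) = 0 := by
    intro u h0 h1 z
    have := ha.translate (rigidSets_stepU hK h0 h1) z
    rwa [Finset.sum_image (hK.1 _ (isFlow_stepU h0 h1))] at this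
  have hδ : ∀ z s, 0 < s → s < 1 → ∑ k ∈ K, (if s ≤ φ k then
      t (stepU α 0 k + (z + e0 d)) - t (stepU α 0 k + z) else 0) = 0 := by
    intro z s h0 h1
    have e1 := hu (1 - s) (by linarith) (by linarith) z
    have e2 := hu 0 le_rfl zero_lt_one z
    refine Eq.trans ?_ (sub_eq_zero.2 (e1.trans e2.symm))
    rw [← Finset.sum_sub_distrib]
    refine Finset.sum_congr rfl fun k _ => ?_
    rw [stepU_eq_add (u := 1 - s) (by linarith) (by linarith), sub_sub_cancel]
    change _ = t (stepU α 0 k + (if s ≤ φ k then e0 d else 0) + z) - _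
    split_ifs
    · rw [add_assoc, add_comm z]
    · simp
  have hlev : ∀ s, 0 < s → ∑ k ∈ K.filter (φ · = s), t (stepU α 0 k) = 0 := by
    intro s hs
    have := sum_eq_zero_of_periodic ht hcase (K.filter (φ · = s)) (stepU α 0) (fun z => ?_) 0
    · simpa using this
    · rw [← sub_eq_zero, ← Finset.sum_sub_distrib, Finset.sum_filter]
      exact sum_level_eq_zero K φ _ (fun k _ => Int.fract_lt_one _) (hδ z) hs
  have htot := hu 0 le_rfl zero_lt_one 0
  rw [← Finset.sum_fiberwise_of_maps_to (t := insert 0 (K.image φ)) (g := φ)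
    (fun k hk => Finset.mem_insert_of_mem (Finset.mem_image_of_mem _ hk)),
    Finset.sum_eq_single 0] at htot
  · simp only [add_zero] at htot
    rw [Finset.sum_filter] at htot
    exact htot
  · intro s hs hs0
    rw [Finset.mem_insert, Finset.mem_image] at hs
    rcases hs with h | ⟨k, -, rfl⟩
    · exact absurd h hs0
    · have : 0 < φ k := lt_of_le_of_ne (Int.fract_nonneg _) (Ne.symm hs0)
      simpa using hlev _ this
  · intro h
    exact absurd (Finset.mem_insert_self _ _) h

lemma isPartialChar_shift {t : Lat d → Ω} (ht : IsPartialChar t) :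
    IsPartialChar fun a => t (shiftIn 0 a) := by
  constructor
  · simp [ht.map_zero]
  · intro g h hg
    have : shiftIn (0 : ℤ) (g + h) = shiftIn 0 g + shiftIn 0 h := by
      rw [← shiftIn_add, add_zero]
    rw [this, ht.map_add _ _ hg]

lemma apply_shiftIn {t : Lat d → Ω} (ht : IsPartialChar t) (h1 : t (e0 d) = 1) (c : ℤ)
    (x : Lat d) : t (shiftIn c x) = t (shiftIn 0 x) := by
  rw [shiftIn_eq_add c x]
  exact ht.map_add_ker _ (zsmul_mem (show e0 d ∈ ht.ker from h1) c)

/-- When t(e₀) = 1, the value inserted by the rounding is invisible to t. -/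
lemma annihilates_shift {t : Lat d → Ω} (ht : IsPartialChar t) (ha : Annihilates α m t)
    (h1 : t (e0 d) = 1) : Annihilates α m fun a => t (shiftIn 0 a) := by
  classical
  intro K hK
  have := ha _ (rigidSets_stepU hK le_rfl zero_lt_one)
  rw [Finset.sum_image (hK.1 _ (isFlow_stepU le_rfl zero_lt_one))] at this
  rw [← this]
  exact Finset.sum_congr rfl fun k _ => (apply_shiftIn ht h1 _ k).symm

/-! ### Twisted averages -/

/-- The twisted average of a function along the first coordinate direction. -/
noncomputable def twist (t : Lat d → Ω) (q : ℕ) (ω : Ω) (g : Lat d) : Ω :=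
  ∑ j ∈ Finset.range q, ω ^ j * t (g - j • e0 d)

lemma annihilates_twist {t : Lat d → Ω} (ha : Annihilates α m t) (q : ℕ) (ω : Ω) :
    Annihilates α m (twist t q ω) := by
  intro K hK
  simp only [twist]
  rw [Finset.sum_comm]
  refine Finset.sum_eq_zero fun j _ => ?_
  rw [← Finset.mul_sum]
  simp only [sub_eq_add_neg]
  rw [ha.translate hK, mul_zero]

lemma sum_range_shift {q : ℕ} (F : ℤ → Ω) (hF : ∀ i, F (i + q) = F i) (j : ℕ) :
    ∑ i ∈ Finset.range q, F (i - j) = ∑ i ∈ Finset.range q, F i := by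
  induction j with
  | zero => simp
  | succ j ih =>
    rw [← ih]
    rcases q with _ | q
    · simp
    · rw [Finset.sum_range_succ', Finset.sum_range_succ]
      congr 1
      · exact Finset.sum_congr rfl fun i _ => by push_cast; congr 1; ring
      · rw [← hF]
        push_cast
        congr 1
        ring

section Twist

variable {t : Lat d → Ω} (ht : IsPartialChar t) {q : ℕ} (hq : 1 < q)
  (hmin : ∀ j : ℕ, 0 < j → j < q → t (j • e0 d) = 0) (hq1 : t (q • e0 d) = 1)
include ht hmin

/-- Two nonzero terms of the twisted sum would put a multiple of e₀ with factor strictly between 0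
and q into the support. -/
lemma twist_eq {ω : Ω} {g : Lat d} {j : ℕ} (hj : j < q) (hg : t (g - j • e0 d) ≠ 0) :
    twist t q ω g = ω ^ j * t (g - j • e0 d) := by
  rw [twist, Finset.sum_eq_single j]
  · intro i hi hij
    rw [Finset.mem_range] at hi
    rw [mul_eq_zero]
    right
    by_contra hcon
    rcases lt_or_gt_of_ne hij with h | h
    · have h2 := sub_mem (H := ht.supp) (show g - i • e0 d ∈ ht.supp from hcon)
        (show g - j • e0 d ∈ ht.supp from hg)
      have h3 : g - i • e0 d - (g - j • e0 d) = (j - i) • e0 d := by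
        rw [sub_nsmul _ h.le]; abel
      rw [h3] at h2
      exact h2 (hmin _ (by omega) (by omega))
    · have h2 := sub_mem (H := ht.supp) (show g - j • e0 d ∈ ht.supp from hg)
        (show g - i • e0 d ∈ ht.supp from hcon)
      have h3 : g - j • e0 d - (g - i • e0 d) = (i - j) • e0 d := by
        rw [sub_nsmul _ h.le]; abel
      rw [h3] at h2
      exact h2 (hmin _ (by omega) (by omega))
  · intro h
    exact absurd (Finset.mem_range.2 hj) h

omit ht hmin in
lemma exists_of_twist_ne_zero {ω : Ω} {g : Lat d} (hg : twist t q ω g ≠ 0) :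
    ∃ j < q, t (g - j • e0 d) ≠ 0 := by
  obtain ⟨j, hj, h⟩ := Finset.exists_ne_zero_of_sum_ne_zero hg
  exact ⟨j, Finset.mem_range.1 hj, right_ne_zero_of_mul h⟩

-- Modulo the support, e₀ has order exactly q. Twisting extends t to the subgroup generated by the
-- support and e₀, with value ω at e₀; this is consistent because ω^q = 1 = t(q e₀).
include hq1 in
lemma isPartialChar_twist (hq : 1 < q) {ω : Ω} (hω : ω ^ q = 1) :
    IsPartialChar (twist t q ω) := by
  have hω0 : ω ≠ 0 := by
    rintro rfl
    rw [zero_pow (by omega)] at hω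
    exact zero_ne_one hω
  constructor
  · rw [twist_eq ht hmin (j := 0) (by omega) (by simp [ht.map_zero])]
    simp [ht.map_zero]
  · intro g h hg
    obtain ⟨j, hj, hgj⟩ := exists_of_twist_ne_zero hg
    rw [twist_eq ht hmin hj hgj]
    let F : ℤ → Ω := fun i => ω ^ i * t (h - i • e0 d)
    have hF : ∀ i, F (i + q) = F i := by
      intro i
      simp only [F]
      rw [zpow_add₀ hω0, zpow_natCast, hω, mul_one, add_smul, natCast_zsmul, ← sub_sub]
      congr 1
      have := ht.map_add_ker (h - i • e0 d - q • e0 d) hq1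
      rw [sub_add_cancel] at this
      exact this.symm
    have h1 : twist t q ω (g + h) = ω ^ j * t (g - j • e0 d) * ∑ i ∈ Finset.range q, F (i - j) := by
      rw [twist, Finset.mul_sum]
      refine Finset.sum_congr rfl fun i _ => ?_
      have h2 : g + h - i • e0 d = (g - j • e0 d) + (h - ((i : ℤ) - j) • e0 d) := by
        rw [sub_smul, natCast_zsmul, natCast_zsmul]
        abel
      rw [h2, ht.map_add _ _ hgj]
      simp only [F]
      rw [zpow_sub₀ hω0, zpow_natCast, zpow_natCast]
      field_simp
    rw [h1, sum_range_shift F hF]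
    congr 1
    rw [twist]
    exact Finset.sum_congr rfl fun i _ => by simp [F]

include hq in
lemma twist_e0 (ω : Ω) : twist t q ω (e0 d) = ω := by
  have h0 : e0 d - 1 • e0 d = 0 := by simp
  rw [twist_eq ht hmin (j := 1) hq (by rw [h0, ht.map_zero]; exact one_ne_zero), h0, ht.map_zero,
    pow_one, mul_one]

end Twist

/-! ### Spans -/

/-- The real span of the support of a function. -/
noncomputable def spn (t : Lat d → Ω) : Submodule ℝ (Fin (d + 1) → ℝ) :=
  Submodule.span ℝ (toReal '' {g | t g ≠ 0})

lemma toReal_mem_spn {t : Lat d → Ω} {g : Lat d} (hg : t g ≠ 0) : toReal g ∈ spn t :=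
  Submodule.subset_span ⟨g, hg, rfl⟩

lemma spn_le {t : Lat d → Ω} {V : Submodule ℝ (Fin (d + 1) → ℝ)}
    (h : ∀ g, t g ≠ 0 → toReal g ∈ V) : spn t ≤ V := by
  rw [spn, Submodule.span_le]
  rintro _ ⟨g, hg, rfl⟩
  exact h g hg

lemma toReal_nsmul (n : ℕ) (g : Lat d) : toReal (n • g) = (n : ℝ) • toReal g := by
  ext i; simp

lemma spn_integralPull_le (t : Lat d → Ω) :
    spn (integralPull α t) ≤ (spn t).comap (arMap α) := by
  refine spn_le fun g hg => ?_
  have hg0 : Int.fract (dot α (toReal g)) = 0 := by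
    by_contra hcon
    simp [integralPull, hcon] at hg
  rw [integralPull, if_pos hg0] at hg
  have h1 := toReal_mem_spn hg
  have h2 := Int.floor_add_fract (dot α (toReal g))
  rw [hg0, add_zero] at h2
  rw [stepU, add_zero, toReal_shiftIn, h2] at h1
  exact h1

lemma spn_shift_le {t : Lat d → Ω} (h1 : t (e0 d) ≠ 0) :
    spn (fun a => t (shiftIn 0 a)) ≤ (spn t).comap (arMap α) := by
  refine spn_le fun g hg => ?_
  have h2 := toReal_mem_spn hg
  have h3 := Submodule.smul_mem _ (dot α (toReal g)) (toReal_mem_spn h1)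
  have h4 : arMap α (toReal g) = toReal (shiftIn 0 g) + dot α (toReal g) • toReal (e0 d) := by
    ext i
    refine Fin.cases ?_ (fun i => ?_) i <;> simp [arMap_apply]
  rw [Submodule.mem_comap, h4]
  exact add_mem h2 h3

lemma spn_twist_le {t : Lat d → Ω} {q : ℕ} (hq : 0 < q) (hq1 : t (q • e0 d) ≠ 0) (ω : Ω) :
    spn (twist t q ω) ≤ spn t := by
  refine spn_le fun g hg => ?_
  obtain ⟨j, -, hj⟩ := exists_of_twist_ne_zero hg
  have h1 := toReal_mem_spn hq1
  rw [toReal_nsmul] at h1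
  have h2 : toReal (e0 d) ∈ spn t := by
    rwa [Submodule.smul_mem_iff _ (by positivity)] at h1
  have h3 := toReal_mem_spn hj
  rw [toReal_sub, toReal_nsmul] at h3
  have := add_mem h3 (Submodule.smul_mem _ (j : ℝ) h2)
  rwa [sub_add_cancel] at this

/-- Annihilating partial characters. -/
def Good (α : Fin (d + 1) → ℝ) (m : ℕ) (t : Lat d → Ω) : Prop :=
  IsPartialChar t ∧ Annihilates α m t

/-- Every annihilating partial character has a successor, and the values of its successors at a
vector control its own values. -/
lemma exists_successor [CharZero Ω] [IsAlgClosed Ω] {t : Lat d → Ω} (ht : Good α m t) :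
    (∃ t' : Lat d → Ω, Good α m t' ∧ spn t' ≤ (spn t).comap (arMap α)) ∧
    ∀ a : Lat d, (∀ t' : Lat d → Ω, Good α m t' → spn t' ≤ (spn t).comap (arMap α) → t' a = 1) →
      (t (e0 d) = 1 ∧ t (shiftIn 0 a) = 1) ∨
        ∃ c : ℤ, (c : ℝ) = dot α (toReal a) ∧ t (shiftIn c a) = 1 := by
  classical
  have hA : ∀ {t : Lat d → Ω} {a : Lat d}, integralPull α t a = 1 →
      ∃ c : ℤ, (c : ℝ) = dot α (toReal a) ∧ t (shiftIn c a) = 1 := by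
    intro t a h
    have hg0 : Int.fract (dot α (toReal a)) = 0 := by
      by_contra hcon
      simp [integralPull, hcon] at h
    rw [integralPull, if_pos hg0, stepU, add_zero] at h
    have h2 := Int.floor_add_fract (dot α (toReal a))
    rw [hg0, add_zero] at h2
    exact ⟨_, h2, h⟩
  -- If this fails, the least positive multiple q e₀ in the support has t(q e₀) = 1. For q = 1 the
  -- shift gives the successor; for q > 1 the twists reduce to the other two cases.
  by_cases hcase : (∀ q : ℕ, 0 < q → t (q • e0 d) = 0) ∨
      ∃ q : ℕ, 0 < q ∧ t (q • e0 d) ≠ 0 ∧ t (q • e0 d) ≠ 1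
  · have h1 : Good α m (integralPull α t) :=
      ⟨isPartialChar_integralPull ht.1, annihilates_integralPull ht.1 ht.2 hcase⟩
    exact ⟨⟨_, h1, spn_integralPull_le t⟩, fun a h => Or.inr (hA (h _ h1 (spn_integralPull_le t)))⟩
  · push Not at hcase
    obtain ⟨hex, hone⟩ := hcase
    have hq0 := Nat.find_spec hex
    set q := Nat.find hex with hqdef
    have hq1 : t (q • e0 d) = 1 := hone q hq0.1 hq0.2
    have hmin : ∀ j : ℕ, 0 < j → j < q → t (j • e0 d) = 0 := by
      intro j hj hjq
      by_contra hcon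
      exact Nat.find_min hex hjq ⟨hj, hcon⟩
    rcases (Nat.succ_le_of_lt hq0.1).eq_or_lt with h1 | h1
    · have h1' : q = 1 := h1.symm
      rw [h1', one_nsmul] at hq1
      have h2 : Good α m fun a => t (shiftIn 0 a) :=
        ⟨isPartialChar_shift ht.1, annihilates_shift ht.1 ht.2 hq1⟩
      have h3 : spn (fun a => t (shiftIn 0 a)) ≤ (spn t).comap (arMap α) :=
        spn_shift_le (by rw [hq1]; exact one_ne_zero)
      exact ⟨⟨_, h2, h3⟩, fun a h => Or.inl ⟨hq1, h _ h2 h3⟩⟩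
    · have hq : 1 < q := h1
      have : NeZero (q : Ω) := ⟨by exact_mod_cast hq0.1.ne'⟩
      obtain ⟨ω, hω⟩ := HasEnoughRootsOfUnity.exists_primitiveRoot Ω q
      have hspn : ∀ ω, (spn (twist t q ω)).comap (arMap α) ≤ (spn t).comap (arMap α) :=
        fun ω => Submodule.comap_mono (spn_twist_le hq0.1 hq0.2 ω)
      have ht1 := isPartialChar_twist ht.1 hmin hq1 hq (one_pow (M := Ω) q)
      have htω := isPartialChar_twist ht.1 hmin hq1 hq hω.pow_eq_one
      have e1 := twist_e0 ht.1 hq hmin (1 : Ω)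
      have eω := twist_e0 ht.1 hq hmin ω
      have g1 : Good α m fun a => twist t q (1 : Ω) (shiftIn 0 a) :=
        ⟨isPartialChar_shift ht1, annihilates_shift ht1 (annihilates_twist ht.2 _ _) e1⟩
      have s1 : spn (fun a => twist t q (1 : Ω) (shiftIn 0 a)) ≤ (spn t).comap (arMap α) :=
        (spn_shift_le (by rw [e1]; exact one_ne_zero)).trans (hspn _)
      have gω : Good α m (integralPull α (twist t q ω)) := by
        refine ⟨isPartialChar_integralPull htω,
          annihilates_integralPull htω (annihilates_twist ht.2 _ _) (Or.inr ⟨1, one_pos, ?_, ?_⟩)⟩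
        · rw [one_nsmul, eω]
          exact hω.ne_zero (by omega)
        · rw [one_nsmul, eω]
          exact hω.ne_one hq
      have sω : spn (integralPull α (twist t q ω)) ≤ (spn t).comap (arMap α) :=
        (spn_integralPull_le _).trans (hspn _)
      -- Two successors are tested at a: the shift of the twist by 1 and the integral pull-back of
      -- the twist by a primitive root ω. With g = `shiftIn c a` they give t(g - j e₀) = 1 and ω^j
      -- t(g - j e₀) = 1 for one j < q, so that j = 0.
      refine ⟨⟨_, g1, s1⟩, fun a h => Or.inr ?_⟩
      have v1 := h _ g1 s1
      obtain ⟨c, hc, vω⟩ := hA (h _ gω sω)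
      refine ⟨c, hc, ?_⟩
      rw [← apply_shiftIn ht1 e1 c] at v1
      obtain ⟨j, hj, hne⟩ := exists_of_twist_ne_zero (by rw [vω]; exact one_ne_zero)
      rw [twist_eq ht.1 hmin hj hne] at v1 vω
      rw [one_pow, one_mul] at v1
      rw [v1, mul_one] at vω
      have hj0 : j = 0 := by
        by_contra hj0
        exact hω.pow_ne_one_of_pos_of_lt hj0 hj vω
      simpa [hj0] using v1

end RoundingAR

namespace RoundingAR
variable {d : ℕ} {α : Fin (d + 1) → ℝ} {m : ℕ} {Ω : Type*} [Field Ω]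

/-! ### Saturation of lattices -/

/-- The saturation of Q is finitely generated; the product of exponents for its generators serves
all of it. -/
lemma exists_saturation_exponent (Q : AddSubgroup (Lat d)) :
    ∃ E : ℕ, 0 < E ∧ ∀ g : Lat d, ∀ n : ℕ, 0 < n → n • g ∈ Q → E • g ∈ Q := by
  classical
  let S : AddSubgroup (Lat d) :=
    { carrier := {g | ∃ n : ℕ, 0 < n ∧ n • g ∈ Q}
      zero_mem' := ⟨1, one_pos, by simp⟩
      add_mem' := by
        rintro a b ⟨n, hn, ha⟩ ⟨k, hk, hb⟩
        refine ⟨n * k, Nat.mul_pos hn hk, ?_⟩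
        rw [nsmul_add]
        refine add_mem ?_ ?_
        · rw [mul_comm, mul_nsmul']; exact nsmul_mem ha k
        · rw [mul_nsmul']; exact nsmul_mem hb n
      neg_mem' := by
        rintro a ⟨n, hn, ha⟩
        exact ⟨n, hn, by rw [smul_neg]; exact neg_mem ha⟩ }
  obtain ⟨s, hs⟩ := (IsNoetherian.noetherian (AddSubgroup.toIntSubmodule S) :
    (AddSubgroup.toIntSubmodule S).FG)
  have hsS : ∀ g ∈ s, ∃ n : ℕ, 0 < n ∧ n • g ∈ Q := by
    intro g hg
    have : g ∈ AddSubgroup.toIntSubmodule S := by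
      rw [← hs]; exact Submodule.subset_span hg
    exact this
  choose! n hn hnQ using hsS
  refine ⟨∏ g ∈ s, n g, Finset.prod_pos hn, fun g k hk hg => ?_⟩
  have hgS : g ∈ Submodule.span ℤ (s : Set (Lat d)) := by
    rw [hs]; exact ⟨k, hk, hg⟩
  clear hg hk
  induction hgS using Submodule.span_induction with
  | mem x hx =>
    rw [← Finset.prod_erase_mul s n hx, mul_nsmul']
    exact nsmul_mem (hnQ x hx) _
  | zero => simp
  | add x y _ _ hx hy => rw [nsmul_add]; exact add_mem hx hy
  | smul a x _ hx => rw [smul_comm]; exact zsmul_mem hx a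

/-- Otherwise a is not torsion modulo Q, and some integral linear functional vanishes on Q but not
at a. Its real extension separates a from the real span of Q. -/
lemma exists_nsmul_mem_of_mem_span (Q : AddSubgroup (Lat d)) {a : Lat d}
    (ha : toReal a ∈ Submodule.span ℝ (toReal '' (Q : Set (Lat d)))) :
    ∃ n : ℕ, 0 < n ∧ n • a ∈ Q := by
  classical
  by_contra hcon
  push Not at hcon
  let S := AddSubgroup.toIntSubmodule Q
  let M := Lat d ⧸ S
  let f : Lat d →ₗ[ℤ] (M ⧸ Submodule.torsion ℤ M) := (Submodule.mkQ _).comp S.mkQ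
  have hfa : f a ≠ 0 := by
    intro h
    have h1 : S.mkQ a ∈ Submodule.torsion ℤ M := (Submodule.Quotient.mk_eq_zero _).1 h
    obtain ⟨⟨c, hc⟩, hca⟩ := (Submodule.mem_torsion_iff _).1 h1
    have h2 : S.mkQ (c • a) = 0 := by rw [map_smul]; exact hca
    have h3 : c • a ∈ Q := (Submodule.Quotient.mk_eq_zero S).1 h2
    have hc0 : c ≠ 0 := nonZeroDivisors.ne_zero hc
    refine hcon c.natAbs (Int.natAbs_pos.2 hc0) ?_
    rw [← natCast_zsmul]
    rcases Int.natAbs_eq c with h | h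
    · rwa [← h]
    · rw [h, neg_smul] at h3
      exact neg_mem_iff.1 h3
  obtain ⟨ℓ, hℓ⟩ : ∃ ℓ : Module.Dual ℤ (M ⧸ Submodule.torsion ℤ M), ℓ (f a) ≠ 0 := by
    by_contra hall
    push Not at hall
    exact hfa ((Module.forall_dual_apply_eq_zero_iff ℤ (f a)).1 hall)
  let g : Lat d →ₗ[ℤ] ℤ := ℓ.comp f
  have hgQ : ∀ x ∈ Q, g x = 0 := by
    intro x hx
    have : S.mkQ x = 0 := (Submodule.Quotient.mk_eq_zero S).2 hx
    simp [g, f, this]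
  let c : Fin (d + 1) → ℝ := fun i => ((g (Pi.single i 1) : ℤ) : ℝ)
  have hc : ∀ x : Lat d, dot c (toReal x) = ((g x : ℤ) : ℝ) := by
    intro x
    have h1 : g x = ∑ i, x i * g (Pi.single i 1) := by
      conv_lhs => rw [← Finset.univ_sum_single x, _root_.map_sum]
      refine Finset.sum_congr rfl fun i _ => ?_
      rw [← smul_eq_mul, ← map_smul, ← Pi.single_smul, smul_eq_mul, mul_one]
    rw [h1, dot]
    push_cast
    exact Finset.sum_congr rfl fun i _ => mul_comm _ _
  have hspan : ∀ y ∈ Submodule.span ℝ (toReal '' (Q : Set (Lat d))), dot c y = 0 := by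
    intro y hy
    induction hy using Submodule.span_induction with
    | mem y hy =>
      obtain ⟨x, hx, rfl⟩ := hy
      rw [hc, hgQ x hx, Int.cast_zero]
    | zero => simp
    | add x y _ _ hx hy => rw [dot_add, hx, hy, add_zero]
    | smul r x _ hx => rw [dot_smul, hx, mul_zero]
  have := hspan _ ha
  rw [hc] at this
  exact hℓ (by exact_mod_cast this)

/-! ### Power sums -/

/-- The relation extends from powers to polynomials; one that vanishes at every x k ≠ 1 but not at 1
isolates the required terms. -/
lemma sum_filter_eq_zero_of_power_sums {ι : Type*} [DecidableEq Ω] (K : Finset ι) (c x : ι → Ω)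
    (h : ∀ j : ℕ, ∑ k ∈ K, c k * x k ^ j = 0) : ∑ k ∈ K.filter (x · = 1), c k = 0 := by
  have hP : ∀ P : Polynomial Ω, ∑ k ∈ K, c k * P.eval (x k) = 0 := by
    intro P
    induction P using Polynomial.induction_on' with
    | add P P' hP hP' =>
      simp only [Polynomial.eval_add, mul_add, Finset.sum_add_distrib, hP, hP', add_zero]
    | monomial n a =>
      simp only [Polynomial.eval_monomial]
      rw [← mul_zero a, ← h n, Finset.mul_sum]
      exact Finset.sum_congr rfl fun k _ => by ring
  set P : Polynomial Ω := ∏ y ∈ (K.image x).erase 1, (Polynomial.X - Polynomial.C y) with hPdef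
  have h1 : P.eval 1 ≠ 0 := by
    rw [hPdef, Polynomial.eval_prod, Finset.prod_ne_zero_iff]
    intro y hy
    simp only [Polynomial.eval_sub, Polynomial.eval_X, Polynomial.eval_C]
    exact sub_ne_zero.2 (Finset.ne_of_mem_erase hy).symm
  have h2 : ∀ k ∈ K, x k ≠ 1 → P.eval (x k) = 0 := by
    intro k hk hne
    rw [hPdef, Polynomial.eval_prod]
    refine Finset.prod_eq_zero (Finset.mem_erase.2 ⟨hne, Finset.mem_image_of_mem _ hk⟩) ?_
    simp
  have h3 := hP P
  have h4 : ∑ k ∈ K, c k * P.eval (x k) = (∑ k ∈ K.filter (x · = 1), c k) * P.eval 1 := by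
    rw [Finset.sum_mul, Finset.sum_filter]
    refine Finset.sum_congr rfl fun k hk => ?_
    split_ifs with hx
    · rw [hx]
    · rw [h2 k hk hx, mul_zero]
  rw [h4] at h3
  exact (mul_eq_zero.1 h3).resolve_right h1

/-! ### Partial characters with minimal span -/

/-- The subgroup generated by the vectors of `D` in the support. -/
def shortGroup (D : Finset (Lat d)) (t : Lat d → Ω) : AddSubgroup (Lat d) :=
  AddSubgroup.closure {g | g ∈ D ∧ t g ≠ 0}

open Classical in
lemma exists_shortGroup_eq (D : Finset (Lat d)) (t : Lat d → Ω) :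
    ∃ σ ∈ D.powerset, shortGroup D t = AddSubgroup.closure (σ : Set (Lat d)) :=
  ⟨D.filter (t · ≠ 0), by simp, by rw [shortGroup, Finset.coe_filter]⟩

/-- Annihilating partial characters with span of minimal dimension. -/
structure MinimalGood (α : Fin (d + 1) → ℝ) (m : ℕ) (t : Lat d → Ω) : Prop where
  good : Good α m t
  minimal : ∀ t' : Lat d → Ω, Good α m t' →
    Module.finrank ℝ (spn t) ≤ Module.finrank ℝ (spn t')

lemma MinimalGood.of_le {t t' : Lat d → Ω} (ht : MinimalGood α m t) (ht' : Good α m t')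
    (hle : spn t' ≤ spn t) : MinimalGood α m t' ∧ spn t' = spn t :=
  ⟨⟨ht', fun s hs => (Submodule.finrank_mono hle).trans (ht.minimal s hs)⟩,
    Submodule.eq_of_le_of_finrank_le hle (ht.minimal _ ht')⟩

lemma spn_restrict_le (t : Lat d → Ω) (Q : AddSubgroup (Lat d)) :
    spn (IsPartialChar.restrict t Q) ≤ spn t :=
  spn_le fun g hg => toReal_mem_spn fun h => hg (by simp [IsPartialChar.restrict, h])

/-- The finite set of short vectors that governs the restriction of annihilating partial
characters. -/
def IsShortSet (Ω : Type*) [Field Ω] (α : Fin (d + 1) → ℝ) (m : ℕ) (D : Finset (Lat d)) : Prop :=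
  ∀ (t : Lat d → Ω), Good α m t → ∀ Q : AddSubgroup (Lat d), (∀ g ∈ D, t g ≠ 0 → g ∈ Q) →
    Good α m (IsPartialChar.restrict t Q)

/-- The short vectors are the differences of points within the finitely many test sets: a sum over a
translate of a test set compares only points that differ by these. -/
lemma exists_isShortSet [CharZero Ω] : ∃ D : Finset (Lat d), IsShortSet Ω α m D := by
  classical
  obtain ⟨T, hT, htest⟩ := exists_finite_test (Ω := Ω) (α := α) (m := m)
  refine ⟨T.biUnion fun K => (K ×ˢ K).image fun p => p.1 - p.2, fun t ht Q hQ =>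
    ⟨ht.1.isPartialChar_restrict Q, ht.1.annihilates_restrict hT htest ht.2 Q ?_⟩⟩
  intro K hK k hk k' hk' hne
  refine hQ _ ?_ hne
  exact Finset.mem_biUnion.2 ⟨K, hK, Finset.mem_image.2 ⟨(k, k'), by simp [hk, hk'], rfl⟩⟩

lemma shortGroup_le_supp {t : Lat d → Ω} (ht : IsPartialChar t) (D : Finset (Lat d)) :
    shortGroup D t ≤ ht.supp := by
  rw [shortGroup, AddSubgroup.closure_le]
  intro g hg
  exact hg.2

lemma mem_shortGroup {t : Lat d → Ω} {D : Finset (Lat d)} {g : Lat d} (hg : g ∈ D)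
    (hne : t g ≠ 0) : g ∈ shortGroup D t :=
  AddSubgroup.subset_closure ⟨hg, hne⟩

/-- Restriction to the group of short support vectors keeps t annihilating, so minimality prevents
the span from shrinking. -/
lemma MinimalGood.spn_eq {t : Lat d → Ω} (ht : MinimalGood α m t) {D : Finset (Lat d)}
    (hD : IsShortSet Ω α m D) :
    spn t = Submodule.span ℝ (toReal '' (shortGroup D t : Set (Lat d))) := by
  have h1 := hD t ht.good (shortGroup D t) fun g => mem_shortGroup
  rw [← (ht.of_le h1 (spn_restrict_le _ _)).2, spn]
  congr 2
  ext g
  have h2 := shortGroup_le_supp ht.good.1 D (x := g)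
  rw [IsPartialChar.mem_supp] at h2
  by_cases hg : g ∈ shortGroup D t
  · simp [IsPartialChar.restrict, hg, h2 hg]
  · simp [IsPartialChar.restrict, hg]

lemma finite_range_spn {D : Finset (Lat d)} (hD : IsShortSet Ω α m D) :
    {V | ∃ t : Lat d → Ω, MinimalGood α m t ∧ spn t = V}.Finite := by
  classical
  refine ((D.powerset.finite_toSet).image fun σ : Finset (Lat d) =>
    Submodule.span ℝ (toReal '' (AddSubgroup.closure (σ : Set (Lat d)) : Set (Lat d)))).subset ?_
  rintro _ ⟨t, ht, rfl⟩
  obtain ⟨σ, hσ, h⟩ := exists_shortGroup_eq D t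
  exact ⟨σ, hσ, by rw [ht.spn_eq hD, h]⟩

/-- A uniform multiple of every integral vector of a minimal span lies in the kernel. -/
lemma exists_uniform_exponent [CharZero Ω]
    (hmax : ∀ X : Finset (Lat d), Rigid α X → X.card ≤ m) (hm : 0 < m) :
    ∃ N : ℕ, 0 < N ∧ ∀ t : Lat d → Ω, MinimalGood α m t →
      ∀ a : Lat d, toReal a ∈ spn t → t (N • a) = 1 := by
  classical
  obtain ⟨D, hD⟩ := exists_isShortSet (Ω := Ω) (α := α) (m := m)
  choose Ef hEf0 hEf using fun Q : AddSubgroup (Lat d) => exists_saturation_exponent Q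
  set E : ℕ := ∏ σ ∈ D.powerset, Ef (AddSubgroup.closure (σ : Set (Lat d))) with hEdef
  have hE0 : 0 < E := Finset.prod_pos fun _ _ => hEf0 _
  have hE : ∀ (t : Lat d → Ω) (g : Lat d) (n : ℕ), 0 < n → n • g ∈ shortGroup D t →
      E • g ∈ shortGroup D t := by
    intro t g n hn hg
    have h1 := hEf (shortGroup D t) g n hn hg
    have h2 : Ef (shortGroup D t) ∣ E := by
      obtain ⟨σ, hσ, h⟩ := exists_shortGroup_eq D t
      rw [h]
      exact Finset.dvd_prod_of_mem
        (fun σ : Finset (Lat d) => Ef (AddSubgroup.closure (σ : Set (Lat d)))) hσ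
    obtain ⟨c, hc⟩ := h2
    rw [hc, mul_comm, mul_nsmul']
    exact nsmul_mem h1 c
  refine ⟨m * E * E, by positivity, fun t ht a ha => ?_⟩
  -- A multiple of m, so that every 1 + N j is coprime to m and the dilates by it stay maximal
  -- rigid; a multiple of E, so that such a dilate of k lies in Q₁ only if k does.
  set N := m * E with hN
  have hN0 : 0 < N := by positivity
  set Q₁ := shortGroup D t with hQ₁
  have hQ₁s : ∀ g ∈ Q₁, t g ≠ 0 := fun g hg => shortGroup_le_supp ht.good.1 D hg
  have hg1 := hD t ht.good Q₁ fun g => mem_shortGroup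
  set Q₂ : AddSubgroup (Lat d) := Q₁ ⊓ ht.good.1.ker.comap (nsmulAddMonoidHom N) with hQ₂
  have hmem2 : ∀ g, g ∈ Q₂ ↔ g ∈ Q₁ ∧ t (N • g) = 1 := fun g => by
    rw [hQ₂, AddSubgroup.mem_inf, AddSubgroup.mem_comap]
    rfl
  have hg2 : Good α m (IsPartialChar.restrict t Q₂) := by
    refine ⟨ht.good.1.isPartialChar_restrict _, fun K hK => ?_⟩
    -- The sums over the dilates by 1 + N j are power sums in t(k)^N. They isolate the points with
    -- t(k)^N = 1, so t restricted to Q₂ is still annihilating.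
    have hpow : ∀ j : ℕ, ∑ k ∈ K.filter (· ∈ Q₁), t k * (t k ^ N) ^ j = 0 := by
      intro j
      have hcop : (1 + N * j).Coprime m := by
        rw [hN, mul_assoc]
        simp
      have h1 := hg1.2 _ (rigidSets_smul hmax (1 + N * j) (by omega) hcop hK)
      rw [Finset.sum_image (fun a _ b _ h => nsmul_right_injective (by omega) h)] at h1
      rw [← h1, Finset.sum_filter]
      refine Finset.sum_congr rfl fun k _ => ?_
      by_cases hk : k ∈ Q₁
      · rw [if_pos hk, IsPartialChar.restrict, if_pos (nsmul_mem hk _),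
          ht.good.1.map_nsmul (hQ₁s k hk)]
        ring
      · rw [if_neg hk, IsPartialChar.restrict, if_neg]
        intro hcon
        have h2 := hE t k _ (show 0 < 1 + N * j by omega) hcon
        apply hk
        beta_reduce at hcon
        rw [add_nsmul, one_nsmul] at hcon
        refine (add_mem_cancel_right ?_).1 hcon
        rw [hN, show m * E * j = (m * j) * E by ring, mul_nsmul']
        exact nsmul_mem h2 _
    have h3 := sum_filter_eq_zero_of_power_sums _ _ _ hpow
    rw [Finset.sum_filter, Finset.sum_filter] at h3
    rw [← h3]
    refine Finset.sum_congr rfl fun k _ => ?_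
    rw [IsPartialChar.restrict]
    by_cases hk : k ∈ Q₁
    · have := ht.good.1.map_nsmul (hQ₁s k hk) N
      simp only [hmem2, hk, true_and, this, if_true]
    · simp only [hmem2, hk, false_and, if_false]
  -- By minimality the restriction to Q₂ has the same span, so some multiple of a, and then E a,
  -- falls into Q₂, where t(N g) = 1 for every g.
  obtain ⟨hmin2, hspn2⟩ := ht.of_le hg2 (spn_restrict_le _ _)
  rw [← hspn2, hmin2.spn_eq hD] at ha
  obtain ⟨n, hn, hna⟩ := exists_nsmul_mem_of_mem_span _ ha
  have h4 := shortGroup_le_supp hg2.1 D (hE _ a n hn hna)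
  have h5 : E • a ∈ Q₂ := by
    by_contra hcon
    exact h4 (by rw [IsPartialChar.restrict, if_neg hcon])
  have h6 := ((hmem2 _).1 h5).2
  rwa [← mul_nsmul'] at h6

/-- The common kernel of all annihilating partial characters with a given span. -/
def commonKer (Ω : Type*) [Field Ω] (α : Fin (d + 1) → ℝ) (m : ℕ)
    (V : Submodule ℝ (Fin (d + 1) → ℝ)) : AddSubgroup (Lat d) :=
  ⨅ (t : Lat d → Ω) (h : Good α m t) (_ : spn t = V), h.1.ker

lemma mem_commonKer {V : Submodule ℝ (Fin (d + 1) → ℝ)} {a : Lat d} :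
    a ∈ commonKer Ω α m V ↔ ∀ t : Lat d → Ω, Good α m t → spn t = V → t a = 1 := by
  simp [commonKer, AddSubgroup.mem_iInf]

/-- There is no annihilating partial character. -/
theorem not_good [CharZero Ω] [IsAlgClosed Ω] (hlast : α (Fin.last d) ≠ 0)
    (hA : ∀ x, Tendsto (fun n : ℕ => (arMap α ^ n) x) atTop (𝓝 0))
    (hmax : ∀ X : Finset (Lat d), Rigid α X → X.card ≤ m) (hm : 0 < m)
    (hne : (rigidSets α m).Nonempty) (t : Lat d → Ω) : ¬ Good α m t := by
  classical
  intro htg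
  have hex : ∃ n, ∃ t : Lat d → Ω, Good α m t ∧ Module.finrank ℝ (spn t) = n := ⟨_, t, htg, rfl⟩
  obtain ⟨t₀, ht₀, hv⟩ := Nat.find_spec hex
  have hmin₀ : MinimalGood α m t₀ :=
    ⟨ht₀, fun t' ht' => by rw [hv]; exact Nat.find_min' hex ⟨t', ht', rfl⟩⟩
  let A := LinearEquiv.ofInjectiveEndo (arMap α) (arMap_injective hlast)
  have hcomap : ∀ V : Submodule ℝ (Fin (d + 1) → ℝ), Module.finrank ℝ (V.comap (arMap α)) = Module.finrank ℝ V := by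
    intro V
    have : V.comap (arMap α) = V.map (A.symm : _ →ₗ[ℝ] _) :=
      (Submodule.map_equiv_eq_comap_symm A.symm V).symm
    rw [this]
    exact LinearEquiv.finrank_map_eq A.symm V
  have hsucc : ∀ {t t' : Lat d → Ω}, MinimalGood α m t → Good α m t' →
      spn t' ≤ (spn t).comap (arMap α) →
      MinimalGood α m t' ∧ spn t' = (spn t).comap (arMap α) := by
    intro t t' ht ht' hle
    have h1 := Submodule.finrank_mono hle
    rw [hcomap] at h1
    refine ⟨⟨ht', fun s hs => h1.trans (ht.minimal s hs)⟩,
      Submodule.eq_of_le_of_finrank_le hle ?_⟩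
    rw [hcomap]
    exact ht.minimal _ ht'
  -- The iterated preimages of a span of least dimension. The companion map is bijective, so
  -- dimensions are kept and every successor fills the whole preimage.
  let V : ℕ → Submodule ℝ (Fin (d + 1) → ℝ) := fun n =>
    Nat.rec (spn t₀) (fun _ W => W.comap (arMap α)) n
  have V0 : V 0 = spn t₀ := rfl
  have Vs : ∀ n, V (n + 1) = (V n).comap (arMap α) := fun n => rfl
  have hV : ∀ n, ∃ t : Lat d → Ω, MinimalGood α m t ∧ spn t = V n := by
    intro n
    induction n with
    | zero => exact ⟨t₀, hmin₀, rfl⟩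
    | succ n ih =>
      obtain ⟨t, ht, hs⟩ := ih
      obtain ⟨⟨t', ht', hle⟩, -⟩ := exists_successor ht.good
      obtain ⟨h1, h2⟩ := hsucc ht ht' hle
      exact ⟨t', h1, by rw [h2, hs, Vs]⟩
  have hgoodV : ∀ n (t : Lat d → Ω), Good α m t → spn t = V n → MinimalGood α m t := by
    intro n t ht hs
    obtain ⟨t', ht', hs'⟩ := hV n
    exact (ht'.of_le ht (by rw [hs, hs'])).1
  -- periodicity
  have hcinj : Function.Injective (Submodule.comap (arMap α)) :=
    Submodule.comap_injective_of_surjective A.surjective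
  have hcancel : ∀ k n, V (n + k) = V k → V n = V 0 := by
    intro k
    induction k with
    | zero => intro n h; exact h
    | succ k ih =>
      intro n h
      rw [← add_assoc, Vs, Vs] at h
      exact ih n (hcinj h)
  -- Only finitely many minimal spans exist, so two of the V n coincide; taking preimages is
  -- injective, which brings the coincidence back to time 0.
  obtain ⟨e, he, hVe⟩ : ∃ e, 0 < e ∧ V e = V 0 := by
    obtain ⟨D, hD⟩ := exists_isShortSet (Ω := Ω) (α := α) (m := m)
    have hfin := finite_range_spn hD
    obtain ⟨i, j, hij, hVij⟩ : ∃ i j, i < j ∧ V i = V j := by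
      have h1 : ¬ Function.Injective fun n => (⟨V n, hV n⟩ :
          {V | ∃ t : Lat d → Ω, MinimalGood α m t ∧ spn t = V}) := by
        intro hinj
        have := hfin.to_subtype
        exact not_injective_infinite_finite _ hinj
      simp only [Function.Injective] at h1
      push Not at h1
      obtain ⟨i, j, h, hne⟩ := h1
      have h' : V i = V j := congrArg Subtype.val h
      rcases lt_or_gt_of_ne hne with h2 | h2
      · exact ⟨i, j, h2, h'⟩
      · exact ⟨j, i, h2, h'.symm⟩
    exact ⟨j - i, by omega, hcancel i _ (by rw [Nat.sub_add_cancel hij.le, hVij])⟩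
  have hper : ∀ n, V (n + e) = V n := by
    intro n
    induction n with
    | zero => rw [zero_add, hVe]
    | succ n ih => rw [Nat.add_right_comm, Vs, ih, Vs]
  set L : ℕ → AddSubgroup (Lat d) := fun n => commonKer Ω α m (V n) with hL
  have hedge : ∀ n, ∀ a ∈ L (n + 1), ∀ t : Lat d → Ω, Good α m t → spn t = V n →
      (t (e0 d) = 1 ∧ t (shiftIn 0 a) = 1) ∨
        ∃ c : ℤ, (c : ℝ) = dot α (toReal a) ∧ t (shiftIn c a) = 1 := by
    intro n a ha t ht hs
    refine (exists_successor ht).2 a fun t' ht' hle => ?_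
    refine mem_commonKer.1 ha t' ht' ?_
    rw [(hsucc (hgoodV n t ht hs) ht' hle).2, hs, Vs]
  have hN : ∀ n, e0 d ∈ L n → ∀ a ∈ L (n + 1), shiftIn 0 a ∈ L n := by
    intro n hn a ha
    refine mem_commonKer.2 fun t ht hs => ?_
    have h1 := mem_commonKer.1 hn t ht hs
    rcases hedge n a ha t ht hs with h | ⟨c, -, h⟩
    · exact h.2
    · rwa [apply_shiftIn ht.1 h1] at h
  have hF : ∀ n, e0 d ∉ L n → ∀ a ∈ L (n + 1),
      ∃ c : ℤ, (c : ℝ) = dot α (toReal a) ∧ shiftIn c a ∈ L n := by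
    intro n hn a ha
    rw [hL, mem_commonKer] at hn
    push Not at hn
    obtain ⟨t₁, ht₁, hs₁, hne₁⟩ := hn
    rcases hedge n a ha t₁ ht₁ hs₁ with h | ⟨c, hc, -⟩
    · exact absurd h.1 hne₁
    · refine ⟨c, hc, mem_commonKer.2 fun t ht hs => ?_⟩
      rcases hedge n a ha t ht hs with h | ⟨c', hc', h⟩
      · rw [apply_shiftIn ht.1 h.1]
        exact h.2
      · have : c = c' := by
          rw [← hc'] at hc
          exact_mod_cast hc
        rwa [this]
  obtain ⟨N, hN0, hNu⟩ := exists_uniform_exponent (Ω := Ω) hmax hm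
  -- N a lies in the common kernel L 0, hence so does the unit vector of each nonzero coordinate of
  -- a, and hence a itself.
  have hone : ∀ a, t₀ a ≠ 0 → t₀ a = 1 := by
    intro a ha
    have h1 : N • a ∈ L 0 := mem_commonKer.2 fun t ht hs => by
      refine hNu t (hgoodV 0 t ht hs) a ?_
      rw [hs, V0]
      exact toReal_mem_spn ha
    have h2 : ∀ i, a i ≠ 0 → (Pi.single i 1 : Lat d) ∈ L 0 := fun i hi =>
      single_mem_of_apply_ne_zero hlast hA he (fun n => by rw [hL]; simp only [hper]) hN hF h1 i
        (by simp [hi, hN0.ne'])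
    have h3 : a ∈ L 0 := by
      rw [← Finset.univ_sum_single a]
      refine sum_mem fun i _ => ?_
      by_cases hi : a i = 0
      · rw [hi, Pi.single_zero]; exact zero_mem _
      · rw [← mul_one (a i), ← smul_eq_mul, Pi.single_smul]
        exact zsmul_mem (h2 i hi) _
    exact mem_commonKer.1 h3 t₀ ht₀ rfl
  obtain ⟨K, hK⟩ := hne
  obtain ⟨k₀, hk₀⟩ := Finset.card_pos.1 (by rw [hK.2]; exact hm)
  -- This translate of K contains 0, where t₀ is 1; a sum of zeros and ones with at least one 1 does
  -- not vanish in characteristic zero.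
  have hsum := ht₀.2.translate hK (-k₀)
  have h1 : ∀ g, t₀ g = ((if t₀ g = 0 then 0 else 1 : ℕ) : Ω) := by
    intro g
    split_ifs with h
    · simp [h]
    · simp [hone g h]
  rw [Finset.sum_congr rfl fun k _ => h1 (k + -k₀), ← Nat.cast_sum, Nat.cast_eq_zero,
    Finset.sum_eq_zero_iff] at hsum
  have h2 := hsum k₀ hk₀
  rw [add_neg_cancel, ht₀.1.map_zero] at h2
  simp at h2

/-- Every lattice point is sent to `0` by some flow of a stable rounded autoregression. -/
theorem exists_flow_to_zero (hlast : α (Fin.last d) ≠ 0)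
    (hA : ∀ x, Tendsto (fun n : ℕ => (arMap α ^ n) x) atTop (𝓝 0)) (x : Lat d) :
    ∃ φ, IsFlow α φ ∧ φ x = 0 := by
  by_contra hcon
  push Not at hcon
  obtain ⟨m, hm, hne, hmax⟩ := exists_maximal_rigid hA hcon
  obtain ⟨Ω, _, _, _, t, ht⟩ := exists_character hmax hm hne
  exact not_good hlast hA hmax (by omega) hne t ht

end RoundingAR

/-! ### The pointwise ergodic theorem -/

namespace PointwiseErgodic

variable {X : Type*} {T : X → X} {f : X → ℝ}

/-- The maximum of `0` and the first `n` Birkhoff sums. -/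
def maxSum (T : X → X) (f : X → ℝ) : ℕ → X → ℝ
  | 0 => fun _ => 0
  | n + 1 => fun x => max 0 (f x + maxSum T f n (T x))

lemma maxSum_nonneg (n : ℕ) (x : X) : 0 ≤ maxSum T f n x := by
  cases n with
  | zero => exact le_rfl
  | succ n => exact le_max_left _ _

lemma maxSum_le_succ (n : ℕ) (x : X) : maxSum T f n x ≤ maxSum T f (n + 1) x := by
  induction n generalizing x with
  | zero => exact maxSum_nonneg _ _
  | succ n ih => exact max_le_max le_rfl (add_le_add le_rfl (ih _))

lemma maxSum_mono (x : X) : Monotone fun n => maxSum T f n x :=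
  monotone_nat_of_le_succ fun n => maxSum_le_succ n x

lemma birkhoffSum_le_maxSum (n : ℕ) (x : X) : birkhoffSum T f n x ≤ maxSum T f n x := by
  induction n generalizing x with
  | zero => simp [maxSum]
  | succ n ih =>
    rw [birkhoffSum_succ']
    exact (add_le_add le_rfl (ih _)).trans (le_max_right _ _)

lemma birkhoffSum_sub_const (g : X → ℝ) (c : ℝ) (n : ℕ) (x : X) :
    birkhoffSum T (fun y => g y - c) n x = birkhoffSum T g n x - n * c := by
  simp [birkhoffSum, Finset.sum_sub_distrib]

variable [MeasurableSpace X] {P : Measure X}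

lemma measurable_maxSum (hT : Measurable T) (hf : Measurable f) (n : ℕ) :
    Measurable (maxSum T f n) := by
  induction n with
  | zero => exact measurable_const
  | succ n ih => exact measurable_const.max (hf.add (ih.comp hT))

lemma integrable_maxSum (hT : MeasurePreserving T P P) (hf : Integrable f P) (n : ℕ) :
    Integrable (maxSum T f n) P := by
  induction n with
  | zero => exact integrable_zero _ _ _
  | succ n ih => exact (integrable_zero _ _ _).sup (hf.add (hT.integrable_comp_of_integrable ih))

/-- Birkhoff sums of a function with negative mean are bounded above almost surely. -/
lemma ae_bddAbove_of_integral_neg [IsProbabilityMeasure P] (hT : Ergodic T P)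
    (hfm : Measurable f) (hf : Integrable f P) (hneg : ∫ x, f x ∂P < 0) :
    ∀ᵐ x ∂P, ∃ C, ∀ n, birkhoffSum T f n x ≤ C := by
  set M := maxSum T f with hM
  -- The invariant event that the maximal sums are unbounded. On it M (n+1) - M n ∘ T is eventually
  -- f, while the integral of this difference over A is nonnegative by monotonicity and invariance.
  -- Thus f has nonnegative integral over A, which excludes P A = 1.
  set A : Set X := {x | ∀ C : ℕ, ∃ n, (C : ℝ) < M n x} with hA
  have hAm : MeasurableSet A := by
    have : A = ⋂ C : ℕ, ⋃ n, {x | (C : ℝ) < M n x} := by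
      ext x; simp [hA]
    rw [this]
    exact MeasurableSet.iInter fun C => MeasurableSet.iUnion fun n =>
      measurableSet_lt measurable_const (measurable_maxSum hT.measurable hfm n)
  have hAinv : T ⁻¹' A = A := by
    ext x
    constructor
    · intro h C
      obtain ⟨K, hK⟩ := exists_nat_ge (C - f x)
      obtain ⟨n, hn⟩ := h K
      refine ⟨n + 1, lt_of_lt_of_le ?_ (le_max_right _ _)⟩
      linarith
    · intro h C
      obtain ⟨K, hK⟩ := exists_nat_ge (max 0 (f x + C))
      obtain ⟨n, hn⟩ := h K
      cases n with
      | zero =>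
        have h1 : (K : ℝ) < 0 := hn
        have := (le_max_left 0 (f x + C)).trans hK
        linarith
      | succ n =>
        refine ⟨n, ?_⟩
        have h1 := hK.trans_lt hn
        have h2 : max 0 (f x + C) < max 0 (f x + M n (T x)) := h1
        rcases lt_max_iff.1 h2 with h3 | h3
        · exact absurd (le_max_left _ _) (not_le.2 h3)
        · have := (le_max_right _ _).trans_lt h3
          linarith
  have hMint := fun n => integrable_maxSum (f := f) hT.toMeasurePreserving hf n
  have hMTint : ∀ n, Integrable (fun x => M n (T x)) P := fun n =>
    hT.toMeasurePreserving.integrable_comp_of_integrable (hMint n)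
  have hset : ∀ n, ∫ x in A, M n (T x) ∂P = ∫ x in A, M n x ∂P := by
    intro n
    have h1 := hT.toMeasurePreserving.restrict_preimage hAm
    rw [hAinv] at h1
    have h2 := integral_map (μ := P.restrict A) (φ := T) (f := M n) hT.measurable.aemeasurable
      (measurable_maxSum hT.measurable hfm n).aestronglyMeasurable
    rw [h1.map_eq] at h2
    exact h2.symm
  have hnn : ∀ n, 0 ≤ ∫ x in A, (M (n + 1) x - M n (T x)) ∂P := by
    intro n
    rw [integral_sub (hMint _).integrableOn (hMTint _).integrableOn, hset, sub_nonneg]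
    exact integral_mono (hMint _).integrableOn (hMint _).integrableOn fun x => maxSum_le_succ n x
  have hlim : Tendsto (fun n => ∫ x in A, (M (n + 1) x - M n (T x)) ∂P) atTop
      (𝓝 (∫ x in A, f x ∂P)) := by
    refine tendsto_integral_of_dominated_convergence (fun x => |f x|) (fun n => ?_)
      hf.abs.integrableOn (fun n => Eventually.of_forall fun x => ?_) ?_
    · exact ((hMint _).sub (hMTint _)).aestronglyMeasurable.restrict
    · have h1 := maxSum_nonneg (T := T) (f := f) n (T x)
      have h2 : M (n + 1) x = max 0 (f x + M n (T x)) := rfl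
      rw [h2, Real.norm_eq_abs, abs_le]
      rcases max_cases 0 (f x + M n (T x)) with h | h <;> rw [h.1] <;>
        constructor <;> cases abs_cases (f x) <;> linarith
    · refine (ae_restrict_iff' hAm).2 (Eventually.of_forall fun x hx => ?_)
      refine tendsto_const_nhds.congr' ?_
      rw [← hAinv] at hx
      obtain ⟨K, hK⟩ := exists_nat_ge (-f x)
      obtain ⟨n₀, hn₀⟩ := hx K
      filter_upwards [eventually_ge_atTop n₀] with n hn
      have h1 := maxSum_mono (T := T) (f := f) (T x) hn
      have h2 : M (n + 1) x = max 0 (f x + M n (T x)) := rfl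
      rw [h2, max_eq_right]
      · ring
      · have h3 : M n₀ (T x) ≤ M n (T x) := h1
        linarith
  have hAf : 0 ≤ ∫ x in A, f x ∂P := ge_of_tendsto' hlim hnn
  have hA0 : P A = 0 := by
    rcases hT.toPreErgodic.prob_eq_zero_or_one hAm hAinv with h | h
    · exact h
    · have h1 : P.restrict A = P := by
        rw [Measure.restrict_eq_self_of_ae_mem]
        exact (prob_compl_eq_zero_iff hAm).2 h
      rw [h1] at hAf
      linarith
  have h2 : ∀ᵐ x ∂P, x ∉ A := measure_eq_zero_iff_ae_notMem.1 hA0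
  filter_upwards [h2] with x hx
  simp only [hA, Set.mem_ofPred_eq, not_forall, not_exists, not_lt] at hx
  obtain ⟨C, hC⟩ := hx
  exact ⟨C, fun n => (birkhoffSum_le_maxSum n x).trans (hC n)⟩

/-- After subtraction of ∫ f + ε/2 the mean is negative, so the Birkhoff sums are bounded, and
dividing the bound by n costs at most another ε/2 eventually. -/
lemma ae_eventually_le [IsProbabilityMeasure P] (hT : Ergodic T P)
    (hfm : Measurable f) (hf : Integrable f P) {ε : ℝ} (hε : 0 < ε) :
    ∀ᵐ x ∂P, ∀ᶠ n : ℕ in atTop, (1 / (n : ℝ)) * birkhoffSum T f n x ≤ ∫ x, f x ∂P + ε := by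
  have h1 := ae_bddAbove_of_integral_neg (f := fun x => f x - (∫ x, f x ∂P + ε / 2)) hT
    (hfm.sub measurable_const) (hf.sub (integrable_const _)) (by
      rw [integral_sub hf (integrable_const _)]
      simp
      linarith)
  filter_upwards [h1] with x hx
  obtain ⟨C, hC⟩ := hx
  obtain ⟨N, hN⟩ := exists_nat_ge (C / (ε / 2))
  filter_upwards [eventually_ge_atTop N, eventually_gt_atTop 0] with n hn hn0
  have h2 := hC n
  rw [birkhoffSum_sub_const] at h2
  have h3 : (0 : ℝ) < n := by exact_mod_cast hn0
  have h4 : C ≤ n * (ε / 2) := by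
    have : C / (ε / 2) ≤ n := hN.trans (by exact_mod_cast hn)
    rwa [div_le_iff₀ (by positivity)] at this
  rw [one_div, inv_mul_le_iff₀ h3]
  linarith

/-- **Birkhoff's pointwise ergodic theorem** for ergodic probability-preserving maps. -/
theorem tendsto_birkhoff [IsProbabilityMeasure P] (hT : Ergodic T P)
    (hfm : Measurable f) (hf : Integrable f P) :
    ∀ᵐ x ∂P, Tendsto (fun n : ℕ => (1 / (n : ℝ)) * birkhoffSum T f n x) atTop
      (𝓝 (∫ x, f x ∂P)) := by
  have h1 : ∀ᵐ x ∂P, ∀ k : ℕ, ∀ᶠ n : ℕ in atTop,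
      (1 / (n : ℝ)) * birkhoffSum T f n x ≤ ∫ x, f x ∂P + 1 / ((k : ℝ) + 1) :=
    ae_all_iff.2 fun k => ae_eventually_le hT hfm hf (by positivity)
  have h2 : ∀ᵐ x ∂P, ∀ k : ℕ, ∀ᶠ n : ℕ in atTop,
      (1 / (n : ℝ)) * birkhoffSum T (fun y => -f y) n x ≤
        ∫ x, -f x ∂P + 1 / ((k : ℝ) + 1) :=
    ae_all_iff.2 fun k => ae_eventually_le hT hfm.neg hf.neg (by positivity)
  filter_upwards [h1, h2] with x hx1 hx2
  rw [Metric.tendsto_atTop']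
  intro ε hε
  obtain ⟨k, hk⟩ := exists_nat_one_div_lt hε
  obtain ⟨N, hN⟩ := ((hx1 k).and (hx2 k)).exists_forall_of_atTop
  refine ⟨N, fun n hn => ?_⟩
  obtain ⟨h3, h4⟩ := hN n hn.le
  have h5 : birkhoffSum T (fun y => -f y) n x = -birkhoffSum T f n x := by
    simp [birkhoffSum]
  rw [h5, integral_neg] at h4
  rw [Real.dist_eq, abs_lt]
  constructor <;> linarith

end PointwiseErgodic

/-! ### Markov chains on countable state spaces -/

namespace CountableChain

open scoped ENNReal NNReal

variable {S : Type*} [Countable S] [MeasurableSpace S] [MeasurableSingletonClass S]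

lemma measure_le_of_singleton {μ ν : Measure S} (h : ∀ x, μ {x} ≤ ν {x}) : μ ≤ ν := by
  rw [← Measure.sum_smul_dirac μ, ← Measure.sum_smul_dirac ν]
  refine Measure.le_iff.2 fun s hs => ?_
  rw [Measure.sum_apply _ hs, Measure.sum_apply _ hs]
  refine ENNReal.tsum_le_tsum fun x => ?_
  simp only [Measure.smul_apply, smul_eq_mul]
  exact mul_le_mul_left (h x) _

lemma prob_eq_of_singleton_le {μ ν : Measure S} [IsProbabilityMeasure μ] [IsProbabilityMeasure ν]
    (h : ∀ x, μ {x} ≤ ν {x}) : μ = ν :=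
  Measure.eq_of_le_of_measure_univ_eq (measure_le_of_singleton h) (by simp)

/-- A tight sequence of probability measures has a limit point, for which Fatou's lemma holds. -/
lemma exists_limit_measure (C : ℕ → Measure S) [∀ n, IsProbabilityMeasure (C n)] (W : S → ℝ≥0)
    (hW : ∀ r, {x | W x ≤ r}.Finite) (B : ℝ≥0) (hB : ∀ n, ∫⁻ x, W x ∂(C n) ≤ B) :
    ∃ (ν : Measure S) (U : Ultrafilter ℕ), IsProbabilityMeasure ν ∧ (U : Filter ℕ) ≤ atTop ∧
      (∀ x, Tendsto (fun n => C n {x}) U (𝓝 (ν {x}))) ∧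
      ∀ (h : S → ℝ≥0) (c : ℕ → ℝ≥0∞) (c' : ℝ≥0∞), Tendsto c U (𝓝 c') →
        (∀ n, ∫⁻ x, h x ∂(C n) ≤ c n) → ∫⁻ x, h x ∂ν ≤ c' := by
  have hU : ((hyperfilter ℕ : Ultrafilter ℕ) : Filter ℕ) ≤ atTop := by
    rw [← Nat.cofinite_eq_atTop]
    exact hyperfilter_le_cofinite
  -- An ultrafilter makes the masses of all points converge simultaneously.
  set U := hyperfilter ℕ with hUdef
  have hlim : ∀ x, ∃ a, Tendsto (fun n => C n {x}) U (𝓝 a) := by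
    intro x
    obtain ⟨a, -, ha⟩ := isCompact_univ.ultrafilter_le_nhds (U.map fun n => C n {x})
      (by simp)
    exact ⟨a, ha⟩
  choose a ha using hlim
  set ν : Measure S := Measure.sum fun x => a x • Measure.dirac x with hν
  have hνx : ∀ x, ν {x} = a x := fun x => Measure.sum_smul_dirac_singleton
  have hfatou : ∀ (h : S → ℝ≥0) (c : ℕ → ℝ≥0∞) (c' : ℝ≥0∞), Tendsto c U (𝓝 c') →
      (∀ n, ∫⁻ x, h x ∂(C n) ≤ c n) → ∫⁻ x, h x ∂ν ≤ c' := by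
    intro h c c' hc hle
    rw [lintegral_countable', ENNReal.tsum_eq_iSup_sum]
    refine iSup_le fun F => ?_
    have h1 : Tendsto (fun n => ∑ x ∈ F, (h x : ℝ≥0∞) * C n {x}) U
        (𝓝 (∑ x ∈ F, (h x : ℝ≥0∞) * ν {x})) := by
      refine tendsto_finsetSum _ fun x _ => ?_
      rw [hνx]
      exact ENNReal.Tendsto.const_mul (ha x) (Or.inr ENNReal.coe_ne_top)
    refine le_of_tendsto_of_tendsto' h1 hc fun n => ?_
    refine le_trans ?_ (hle n)
    rw [lintegral_countable']
    exact ENNReal.sum_le_tsum F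
  refine ⟨ν, U, ⟨le_antisymm ?_ ?_⟩, hU, fun x => by rw [hνx]; exact ha x, hfatou⟩
  · have := hfatou 1 (fun _ => 1) 1 tendsto_const_nhds (fun n => by simp)
    simpa using this
  · refine ENNReal.le_of_forall_pos_le_add fun ε hε _ => ?_
    -- With this level, Markov's inequality leaves mass at most ε outside the finite set {W ≤ r},
    -- uniformly in n, so no mass escapes in the limit.
    set r : ℝ≥0 := (B + 1) / ε with hr
    have hr0 : r ≠ 0 := by positivity
    set F := (hW r).toFinset with hF
    have hmarkov : ∀ n, 1 ≤ ∑ x ∈ F, C n {x} + ε := by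
      intro n
      have h1 : (r : ℝ≥0∞) * C n (F : Set S)ᶜ ≤ r * ε := by
        have h2 : C n (F : Set S)ᶜ ≤ C n {x | (r : ℝ≥0∞) ≤ W x} := by
          refine measure_mono fun x hx => ?_
          simp only [hF, Set.Finite.coe_toFinset, Set.mem_compl_iff, Set.mem_ofPred_eq,
            not_le] at hx
          simp only [Set.mem_ofPred_eq, ENNReal.coe_le_coe]
          exact hx.le
        refine (mul_le_mul_right h2 _).trans ?_
        refine (mul_meas_ge_le_lintegral (measurable_of_countable _) _).trans ((hB n).trans ?_)
        have h3 : r * ε = B + 1 := by rw [hr]; field_simp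
        rw [← ENNReal.coe_mul, h3, ENNReal.coe_le_coe]
        exact le_self_add
      have h4 : C n (F : Set S)ᶜ ≤ ε :=
        (ENNReal.mul_le_mul_iff_right (by exact_mod_cast hr0) ENNReal.coe_ne_top).1 h1
      have h5 := measure_add_measure_compl (μ := C n) F.measurableSet
      rw [measure_univ] at h5
      rw [sum_measure_singleton, ← h5]
      exact add_le_add le_rfl h4
    have h6 : Tendsto (fun n => ∑ x ∈ F, C n {x} + (ε : ℝ≥0∞)) U (𝓝 (∑ x ∈ F, a x + ε)) :=
      (tendsto_finsetSum _ fun x _ => ha x).add tendsto_const_nhds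
    refine (ge_of_tendsto' h6 hmarkov).trans (add_le_add ?_ le_rfl)
    have h7 : ∑ x ∈ F, a x = ν F := by
      rw [← sum_measure_singleton]
      exact Finset.sum_congr rfl fun x _ => (hνx x).symm
    rw [h7]
    exact measure_mono (Set.subset_univ _)

variable (κ : Kernel S S)

/-- The law of the chain at time `n`. -/
noncomputable def law (y : S) : ℕ → Measure S
  | 0 => Measure.dirac y
  | n + 1 => (law y n).bind κ

lemma lintegral_law_succ (y : S) (n : ℕ) (h : S → ℝ≥0∞) :
    ∫⁻ x, h x ∂(law κ y (n + 1)) = ∫⁻ x, ∫⁻ z, h z ∂(κ x) ∂(law κ y n) :=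
  Measure.lintegral_bind κ.aemeasurable (measurable_of_countable _).aemeasurable

/-- The average of the laws of the chain up to time `n`. -/
noncomputable def cesaro (y : S) (n : ℕ) : Measure S :=
  ((n : ℝ≥0∞) + 1)⁻¹ • ∑ i ∈ Finset.range (n + 1), law κ y i

omit [Countable S] [MeasurableSingletonClass S] in
lemma lintegral_cesaro (y : S) (n : ℕ) (h : S → ℝ≥0∞) : ∫⁻ x, h x ∂(cesaro κ y n) =
    ((n : ℝ≥0∞) + 1)⁻¹ * ∑ i ∈ Finset.range (n + 1), ∫⁻ x, h x ∂(law κ y i) := by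
  rw [cesaro, lintegral_smul_measure, lintegral_finsetSum_measure, smul_eq_mul]

lemma cesaro_const (n : ℕ) (c : ℝ≥0∞) :
    ((n : ℝ≥0∞) + 1)⁻¹ * ∑ _i ∈ Finset.range (n + 1), c = c := by
  rw [Finset.sum_const, Finset.card_range, nsmul_eq_mul, ← mul_assoc]
  push_cast
  rw [ENNReal.inv_mul_cancel (by simp) (by finiteness), one_mul]

variable [IsMarkovKernel κ]

instance (y : S) (n : ℕ) : IsProbabilityMeasure (law κ y n) := by
  induction n with
  | zero => exact inferInstanceAs (IsProbabilityMeasure (Measure.dirac y))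
  | succ n ih => exact inferInstanceAs (IsProbabilityMeasure ((law κ y n).bind κ))

instance (y : S) (n : ℕ) : IsProbabilityMeasure (cesaro κ y n) := by
  constructor
  have := lintegral_cesaro κ y n 1
  simp only [Pi.one_apply, lintegral_one, measure_univ] at this
  rw [this, cesaro_const]

/-- Existence of an invariant probability measure under a drift condition. -/
theorem exists_invariant (W : S → ℝ≥0) (hW : ∀ r, {x | W x ≤ r}.Finite) {ρ b : ℝ≥0} (hρ : ρ < 1)
    (hdrift : ∀ x, ∫⁻ z, W z ∂(κ x) ≤ ρ * W x + b) (y : S) :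
    ∃ ν : Measure S, IsProbabilityMeasure ν ∧ κ.Invariant ν ∧ ∫⁻ x, W x ∂ν < ∞ ∧
      ∀ h : S → ℝ≥0, (∀ x, ∫⁻ z, h z ∂(κ x) = h x) → ∫⁻ x, h x ∂ν ≤ h y := by
  have h1ρ : (1 - ρ) ≠ 0 := (tsub_pos_of_lt hρ).ne'
  -- The fixed point of s ↦ ρ s + b; the bound W y + b' is preserved by the drift inequality.
  set b' : ℝ≥0 := b / (1 - ρ) with hb'
  have hb : ρ * b' + b ≤ b' := by
    have h1 : b = (1 - ρ) * b' := by rw [hb']; field_simp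
    have h2 : ρ + (1 - ρ) = 1 := add_tsub_cancel_of_le hρ.le
    calc ρ * b' + b = (ρ + (1 - ρ)) * b' := by rw [add_mul, ← h1]
      _ = b' := by rw [h2, one_mul]
      _ ≤ b' := le_rfl
  have hlaw : ∀ n, ∫⁻ x, W x ∂(law κ y n) ≤ ((W y + b' : ℝ≥0) : ℝ≥0∞) := by
    intro n
    induction n with
    | zero =>
      have : ∫⁻ x, W x ∂(law κ y 0) = W y := lintegral_dirac _ _
      rw [this, ENNReal.coe_le_coe]
      exact le_self_add
    | succ n ih =>
      rw [lintegral_law_succ]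
      refine (lintegral_mono hdrift).trans ?_
      rw [lintegral_add_right _ measurable_const,
        lintegral_const_mul _ (measurable_of_countable _), lintegral_const, measure_univ, mul_one]
      refine (add_le_add (mul_le_mul_right ih _) le_rfl).trans ?_
      rw [← ENNReal.coe_mul, ← ENNReal.coe_add, ENNReal.coe_le_coe, mul_add, add_assoc]
      exact add_le_add (mul_le_of_le_one_left zero_le hρ.le) hb
  obtain ⟨ν, U, hν, hU, hlim, hfatou⟩ := exists_limit_measure (cesaro κ y) W hW (W y + b')
    (fun n => by
      rw [lintegral_cesaro]
      refine le_trans ?_ (cesaro_const n _).le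
      exact mul_le_mul_right (Finset.sum_le_sum fun i _ => hlaw i) _)
  refine ⟨ν, hν, ?_, ?_, fun h hh => ?_⟩
  · change ν.bind κ = ν
    -- Fatou gives only sub-invariance, which suffices for two probability measures. The correction
    -- 1/(n+1) is the boundary term of the time shift in the average.
    refine prob_eq_of_singleton_le fun z => ?_
    rw [Measure.bind_apply (measurableSet_singleton z) κ.aemeasurable]
    have hc : Tendsto (fun n => cesaro κ y n {z} + ((n : ℝ≥0∞) + 1)⁻¹) U (𝓝 (ν {z} + 0)) := by
      refine (hlim z).add (Tendsto.mono_left ?_ hU)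
      have := ENNReal.tendsto_inv_nat_nhds_zero.comp (tendsto_add_atTop_nat 1)
      refine this.congr fun n => ?_
      simp
    have key := hfatou (fun x => (κ x {z}).toNNReal) _ _ hc (fun n => ?_)
    · simpa [ENNReal.coe_toNNReal (measure_ne_top _ _)] using key
    · simp only [ENNReal.coe_toNNReal (measure_ne_top _ _)]
      have h1 : ∀ i, ∫⁻ x, κ x {z} ∂(law κ y i) = law κ y (i + 1) {z} := fun i =>
        (Measure.bind_apply (measurableSet_singleton z) κ.aemeasurable).symm
      have h2 : cesaro κ y n {z} =
          ((n : ℝ≥0∞) + 1)⁻¹ * ∑ i ∈ Finset.range (n + 1), law κ y i {z} := by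
        simp [cesaro]
      rw [lintegral_cesaro, h2, Finset.sum_congr rfl fun i _ => h1 i]
      have h3 : ∑ i ∈ Finset.range (n + 1), law κ y (i + 1) {z} ≤
          ∑ i ∈ Finset.range (n + 1), law κ y i {z} + 1 := by
        rw [Finset.sum_range_succ, Finset.sum_range_succ']
        gcongr
        · exact le_self_add
        · exact prob_le_one
      refine (mul_le_mul_right h3 _).trans ?_
      rw [mul_add, mul_one]
  · refine (hfatou W (fun _ => _) _ tendsto_const_nhds (fun n => ?_)).trans_lt
      (ENNReal.coe_lt_top (r := W y + b'))
    rw [lintegral_cesaro]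
    refine le_trans ?_ (cesaro_const n _).le
    exact mul_le_mul_right (Finset.sum_le_sum fun i _ => hlaw i) _
  · refine hfatou h (fun _ => h y) _ tendsto_const_nhds (fun n => ?_)
    have h1 : ∀ i, ∫⁻ x, h x ∂(law κ y i) = h y := by
      intro i
      induction i with
      | zero => exact lintegral_dirac _ _
      | succ i ih =>
        rw [lintegral_law_succ]
        simp only [hh, ih]
    rw [lintegral_cesaro, Finset.sum_congr rfl fun i _ => h1 i, cesaro_const]

/-! ### Uniqueness -/

variable {κ}

omit [IsMarkovKernel κ] in
lemma invariant_apply {μ : Measure S} (h : κ.Invariant μ) (s : Set S) :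
    ∫⁻ x, κ x s ∂μ = μ s := by
  have hs : MeasurableSet s := s.to_countable.measurableSet
  rw [← Measure.bind_apply hs κ.aemeasurable, h.def]

/-- One-step accessibility. -/
def Acc (κ : Kernel S S) (x z : S) : Prop := 0 < κ x {z}

omit [IsMarkovKernel κ] in
lemma pos_of_acc {μ : Measure S} (h : κ.Invariant μ) {x z : S} (hx : 0 < μ {x})
    (hxz : Acc κ x z) : 0 < μ {z} := by
  rw [← invariant_apply h, lintegral_countable']
  refine lt_of_lt_of_le (ENNReal.mul_pos hxz.ne' hx.ne') (ENNReal.le_tsum x)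

omit [IsMarkovKernel κ] in
lemma pos_of_reach {μ : Measure S} (h : κ.Invariant μ) {x z : S} (hx : 0 < μ {x})
    (hxz : Relation.ReflTransGen (Acc κ) x z) : 0 < μ {z} := by
  induction hxz with
  | refl => exact hx
  | tail _ h2 ih => exact pos_of_acc h ih h2

/-- The pointwise minimum M of two invariant probabilities is sub-invariant, hence invariant since
mass is conserved. So μ - M is invariant as well; it charges x and therefore the accessible state o.
-/
lemma lt_of_exists_lt {o : S} (ho : ∀ x, Relation.ReflTransGen (Acc κ) x o) {μ μ' : Measure S}
    [IsProbabilityMeasure μ] [IsProbabilityMeasure μ'] (h : κ.Invariant μ) (h' : κ.Invariant μ')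
    {x : S} (hx : μ' {x} < μ {x}) : μ' {o} < μ {o} := by
  set M : Measure S := Measure.sum fun x => min (μ {x}) (μ' {x}) • Measure.dirac x with hM
  have hMx : ∀ x, M {x} = min (μ {x}) (μ' {x}) := fun x => Measure.sum_smul_dirac_singleton
  have hMμ : M ≤ μ := measure_le_of_singleton fun x => by rw [hMx]; exact min_le_left _ _
  have hMμ' : M ≤ μ' := measure_le_of_singleton fun x => by rw [hMx]; exact min_le_right _ _
  have hfin : IsFiniteMeasure M := isFiniteMeasure_of_le μ hMμ
  have hMinv : κ.Invariant M := by
    change M.bind κ = M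
    have hsing : ∀ z, (M.bind κ) {z} ≤ M {z} := by
      intro z
      rw [Measure.bind_apply (measurableSet_singleton z) κ.aemeasurable, hMx]
      refine le_min ?_ ?_
      · rw [← invariant_apply h]; exact lintegral_mono' hMμ le_rfl
      · rw [← invariant_apply h']; exact lintegral_mono' hMμ' le_rfl
    refine Measure.eq_of_le_of_measure_univ_eq (measure_le_of_singleton hsing) ?_
    rw [Measure.bind_apply MeasurableSet.univ κ.aemeasurable]
    simp
  have hsub : μ - M + M = μ := Measure.sub_add_cancel_of_le hMμ
  have hinv : κ.Invariant (μ - M) := by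
    change (μ - M).bind κ = μ - M
    refine Measure.ext fun s hs => ?_
    have h1 := invariant_apply h s
    rw [← hsub, lintegral_add_measure, invariant_apply hMinv, Measure.add_apply] at h1
    rw [Measure.bind_apply hs κ.aemeasurable]
    exact (ENNReal.add_left_inj (measure_ne_top M s)).1 h1
  have hval : ∀ z, (μ - M) {z} = μ {z} - min (μ {z}) (μ' {z}) := by
    intro z
    rw [Measure.sub_apply (measurableSet_singleton z) hMμ, hMx]
  have hpos : 0 < (μ - M) {x} := by
    rw [hval, min_eq_right hx.le]
    exact tsub_pos_of_lt hx
  have := pos_of_reach hinv hpos (ho x)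
  rw [hval, tsub_pos_iff_lt] at this
  by_contra hcon
  rw [min_eq_left (not_lt.1 hcon)] at this
  exact lt_irrefl _ this

/-- Invariant probability measures are unique if some state is accessible from all states. -/
theorem invariant_unique {o : S} (ho : ∀ x, Relation.ReflTransGen (Acc κ) x o) {μ μ' : Measure S}
    [IsProbabilityMeasure μ] [IsProbabilityMeasure μ'] (h : κ.Invariant μ)
    (h' : κ.Invariant μ') : μ = μ' := by
  by_cases hle : ∃ x, μ' {x} < μ {x}
  · obtain ⟨x, hx⟩ := hle
    have h1 := lt_of_exists_lt ho h h' hx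
    refine (prob_eq_of_singleton_le fun z => ?_).symm
    by_contra hcon
    exact lt_asymm h1 (lt_of_exists_lt ho h' h (not_le.1 hcon))
  · push Not at hle
    exact prob_eq_of_singleton_le hle

end CountableChain

namespace CountableChain

open scoped ENNReal NNReal

variable {S : Type*} [Countable S] [MeasurableSpace S] [MeasurableSingletonClass S]

/-! ### Path laws -/

/-- The law on path space of the homogeneous chain started at `y`. -/
noncomputable def chainLaw (κ : Kernel S S) [IsMarkovKernel κ] (y : S) : Measure (ℕ → S) :=
  Kernel.traj (X := fun _ => S)
    (fun n => κ.comap (fun h : (i : Finset.Iic n) → S => h ⟨n, Finset.mem_Iic.2 le_rfl⟩)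
      (measurable_pi_apply _)) 0 (fun _ => y)

variable (κ : Kernel S S) [IsMarkovKernel κ]

instance (y : S) : IsProbabilityMeasure (chainLaw κ y) := by
  unfold chainLaw; infer_instance

/-- The paths with prescribed values before time `n`. -/
def cyl (n : ℕ) (s : ℕ → S) : Set (ℕ → S) := {ω | ∀ i < n, ω i = s i}

omit [Countable S] in
lemma measurableSet_cyl (n : ℕ) (s : ℕ → S) : MeasurableSet (cyl n s) := by
  have : cyl n s = ⋂ i, ⋂ (_ : i < n), (fun ω : ℕ → S => ω i) ⁻¹' {s i} := by
    ext ω; simp [cyl]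
  rw [this]
  exact MeasurableSet.iInter fun i => MeasurableSet.iInter fun _ =>
    measurable_pi_apply i (measurableSet_singleton _)

lemma chainLaw_ae_zero (y : S) : ∀ᵐ ω ∂(chainLaw κ y), ω 0 = y := by
  have h1 := Kernel.traj_map_frestrictLe_apply (X := fun _ => S)
    (κ := fun n => κ.comap (fun h : (i : Finset.Iic n) → S => h ⟨n, Finset.mem_Iic.2 le_rfl⟩)
      (measurable_pi_apply _)) 0 0 (fun _ => y)
  rw [Kernel.partialTraj_self, Kernel.id_apply] at h1
  have h2 : ∀ᵐ h ∂(Measure.dirac (fun _ => y : (i : Finset.Iic 0) → S)),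
      h ⟨0, Finset.mem_Iic.2 le_rfl⟩ = y := by
    rw [ae_dirac_iff]
    exact (Set.to_countable _).measurableSet
  rw [← h1] at h2
  exact ae_of_ae_map (by fun_prop) h2

lemma chainLaw_cyl_one (y : S) (s : ℕ → S) [Decidable (s 0 = y)] :
    chainLaw κ y (cyl 1 s) = if s 0 = y then 1 else 0 := by
  have h := chainLaw_ae_zero κ y
  split_ifs with hs
  · rw [← mem_ae_iff_prob_eq_one (measurableSet_cyl 1 s)]
    filter_upwards [h] with ω hω i hi
    obtain rfl : i = 0 := by omega
    rw [hω, hs]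
  · rw [measure_eq_zero_iff_ae_notMem]
    filter_upwards [h] with ω hω hc
    exact hs ((hc 0 one_pos).symm.trans hω)

omit [Countable S] in
lemma chainLaw_cyl_succ (y : S) (n : ℕ) (s : ℕ → S) :
    chainLaw κ y (cyl (n + 2) s) = chainLaw κ y (cyl (n + 1) s) * κ (s n) {s (n + 1)} := by
  set κ' : (n : ℕ) → Kernel ((i : Finset.Iic n) → S) S := fun n =>
    κ.comap (fun h : (i : Finset.Iic n) → S => h ⟨n, Finset.mem_Iic.2 le_rfl⟩)
      (measurable_pi_apply _) with hκ'
  have h1 := Kernel.partialTraj_compProd_eq_map_traj (X := fun _ => S) (κ := κ')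
    (Nat.zero_le n) (x₀ := fun _ => y)
  set h₀ : (i : Finset.Iic n) → S := fun i => s i with hh₀
  have hset2 : cyl (n + 2) s = (fun ω : ℕ → S => (Preorder.frestrictLe n ω, ω (n + 1))) ⁻¹'
      ({h₀} ×ˢ {s (n + 1)}) := by
    ext ω
    simp only [cyl, Set.mem_ofPred_eq, Set.mem_preimage, Set.mem_prod, Set.mem_singleton_iff,
      funext_iff, Subtype.forall, Finset.mem_Iic, Preorder.frestrictLe_apply, hh₀]
    constructor
    · exact fun h => ⟨fun i hi => h i (by omega), h _ (by omega)⟩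
    · rintro ⟨h, h'⟩ i hi
      rcases (Nat.lt_succ_iff.1 hi).lt_or_eq with h2 | h2
      · exact h i (by omega)
      · rw [h2]; exact h'
  have hset1 : cyl (n + 1) s = (Preorder.frestrictLe n : (ℕ → S) → _) ⁻¹' {h₀} := by
    ext ω
    simp only [cyl, Set.mem_ofPred_eq, Set.mem_preimage, Set.mem_singleton_iff,
      funext_iff, Subtype.forall, Finset.mem_Iic, Preorder.frestrictLe_apply, hh₀]
    exact forall_congr' fun i => by rw [Nat.lt_succ_iff]
  have hm2 : chainLaw κ y (cyl (n + 2) s) =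
      (Kernel.partialTraj (X := fun _ => S) κ' 0 n (fun _ => y) ⊗ₘ (κ' n))
        ({h₀} ×ˢ {s (n + 1)}) := by
    rw [h1, Measure.map_apply (by fun_prop)
      ((measurableSet_singleton _).prod (measurableSet_singleton _)), ← hset2]
    rfl
  have hm1 : chainLaw κ y (cyl (n + 1) s) =
      Kernel.partialTraj (X := fun _ => S) κ' 0 n (fun _ => y) {h₀} := by
    rw [← Kernel.traj_map_frestrictLe_apply, Measure.map_apply (by fun_prop)
      (measurableSet_singleton _), ← hset1]
    rfl
  rw [hm2, hm1, Measure.compProd_apply_prod (measurableSet_singleton _)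
    (measurableSet_singleton _), Measure.restrict_singleton, lintegral_smul_measure,
    lintegral_dirac, smul_eq_mul]
  rfl

/-- The time shift on path space. -/
def shift (ω : ℕ → S) : ℕ → S := fun n => ω (n + 1)

omit [Countable S] [MeasurableSingletonClass S] in
lemma measurable_shift : Measurable (shift : (ℕ → S) → ℕ → S) :=
  measurable_pi_lambda _ fun n => measurable_pi_apply (n + 1)

omit [Countable S] [MeasurableSpace S] [MeasurableSingletonClass S] in
lemma isPiSystem_cyl : IsPiSystem {A : Set (ℕ → S) | ∃ n s, A = cyl n s} := by
  have key : ∀ n n' (s s' : ℕ → S), n ≤ n' → (cyl n s ∩ cyl n' s').Nonempty →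
      cyl n s ∩ cyl n' s' = cyl n' s' := by
    rintro n n' s s' hn ⟨ω₀, h1, h2⟩
    refine Set.inter_eq_right.2 fun ω hω i hi => ?_
    rw [hω i (by omega), ← h2 i (by omega), h1 i hi]
  rintro _ ⟨n, s, rfl⟩ _ ⟨n', s', rfl⟩ hne
  rcases le_total n n' with h | h
  · exact ⟨n', s', key _ _ _ _ h hne⟩
  · rw [Set.inter_comm] at hne ⊢
    exact ⟨n, s, key _ _ _ _ h hne⟩

lemma generateFrom_cyl : (MeasurableSpace.pi : MeasurableSpace (ℕ → S)) =
    MeasurableSpace.generateFrom {A : Set (ℕ → S) | ∃ n s, A = cyl n s} := by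
  refine le_antisymm ?_ (MeasurableSpace.generateFrom_le ?_)
  · refine iSup_le fun i => ?_
    rintro _ ⟨B, -, rfl⟩
    have : (fun ω : ℕ → S => ω i) ⁻¹' B = ⋃ (v : Fin (i + 1) → S) (_ : v (Fin.last i) ∈ B),
        cyl (i + 1) (fun j => if h : j < i + 1 then v ⟨j, h⟩ else v (Fin.last i)) := by
      ext ω
      simp only [Set.mem_preimage, Set.mem_iUnion, cyl, Set.mem_ofPred_eq, exists_prop]
      constructor
      · intro h
        refine ⟨fun j => ω j, h, fun j hj => ?_⟩
        simp [hj]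
      · rintro ⟨v, hv, h⟩
        have := h i (Nat.lt_succ_self i)
        rw [dif_pos (Nat.lt_succ_self i)] at this
        rw [this]
        exact hv
    refine this ▸ @MeasurableSet.iUnion _ _ (MeasurableSpace.generateFrom _) _ _ fun v =>
      @MeasurableSet.iUnion _ _ (MeasurableSpace.generateFrom _) _ _ fun _ =>
        MeasurableSpace.measurableSet_generateFrom ⟨_, _, rfl⟩
  · rintro _ ⟨n, s, rfl⟩
    exact measurableSet_cyl n s

lemma ext_of_cyl {P Q : Measure (ℕ → S)} [IsFiniteMeasure P]
    (h : ∀ n s, P (cyl n s) = Q (cyl n s)) (hS : Nonempty S) : P = Q := by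
  refine ext_of_generate_finite _ generateFrom_cyl isPiSystem_cyl ?_ ?_
  · rintro _ ⟨n, s, rfl⟩
    exact h n s
  · obtain ⟨x⟩ := hS
    have h0 : cyl 0 (fun _ => x) = (Set.univ : Set (ℕ → S)) := by ext; simp [cyl]
    rw [← h0]
    exact h _ _

lemma measurable_chainLaw : Measurable (chainLaw κ) := measurable_of_countable _

/-- First-step decomposition of cylinder probabilities, obtained inductively from the last-step
decomposition. -/
lemma chainLaw_cyl_cons (y : S) (n : ℕ) (s : ℕ → S) :
    chainLaw κ y (cyl (n + 2) fun i => Nat.casesOn i y s) =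
      chainLaw κ (s 0) (cyl (n + 1) s) * κ y {s 0} := by
  classical
  induction n with
  | zero =>
    rw [chainLaw_cyl_succ, chainLaw_cyl_one, chainLaw_cyl_one]
    simp
  | succ n ih =>
    rw [chainLaw_cyl_succ, chainLaw_cyl_succ κ (s 0), ih, mul_right_comm]

/-- The Markov property at time one. -/
theorem chainLaw_map_shift (y : S) : (chainLaw κ y).map shift = (κ y).bind (chainLaw κ) := by
  have hp : IsProbabilityMeasure ((chainLaw κ y).map shift) :=
    Measure.isProbabilityMeasure_map measurable_shift.aemeasurable
  refine ext_of_cyl (fun n s => ?_) ⟨y⟩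
  rw [Measure.map_apply measurable_shift (measurableSet_cyl n s),
    Measure.bind_apply (measurableSet_cyl n s) (measurable_chainLaw κ).aemeasurable]
  rcases n with _ | n
  · have h0 : cyl 0 s = Set.univ := by ext; simp [cyl]
    simp [h0]
  rw [lintegral_countable', tsum_eq_single (s 0), ← chainLaw_cyl_cons]
  · refine measure_congr ?_
    filter_upwards [chainLaw_ae_zero κ y] with ω hω
    refine propext ⟨fun h i hi => ?_, fun h i hi => h (i + 1) (by omega)⟩
    rcases i with _ | i
    · exact hω
    · exact h i (by omega)
  · intro x hx
    rw [measure_eq_zero_iff_ae_notMem.2, zero_mul]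
    filter_upwards [chainLaw_ae_zero κ x] with ω hω hc
    exact hx (hω.symm.trans (hc 0 (Nat.succ_pos n)))

end CountableChain

namespace CountableChain

open scoped ENNReal NNReal

variable {S : Type*} [Countable S] [MeasurableSpace S] [MeasurableSingletonClass S]
  {κ : Kernel S S} [IsMarkovKernel κ]

/-! ### Shift-invariant events -/

lemma chainLaw_preimage_shift (y : S) {A : Set (ℕ → S)} (hA : MeasurableSet A) :
    chainLaw κ y (shift ⁻¹' A) = ∫⁻ z, chainLaw κ z A ∂(κ y) := by
  rw [← Measure.map_apply measurable_shift hA, chainLaw_map_shift,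
    Measure.bind_apply hA (measurable_chainLaw κ).aemeasurable]

lemma bind_chainLaw_apply (μ : Measure S) {A : Set (ℕ → S)} (hA : MeasurableSet A) :
    μ.bind (chainLaw κ) A = ∫⁻ x, chainLaw κ x A ∂μ :=
  Measure.bind_apply hA (measurable_chainLaw κ).aemeasurable

lemma isProbabilityMeasure_bind_chainLaw (μ : Measure S) [IsProbabilityMeasure μ] :
    IsProbabilityMeasure (μ.bind (chainLaw κ)) :=
  ⟨by rw [bind_chainLaw_apply μ MeasurableSet.univ]; simp⟩

lemma measurePreserving_shift {μ : Measure S} (h : κ.Invariant μ) :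
    MeasurePreserving shift (μ.bind (chainLaw κ)) (μ.bind (chainLaw κ)) := by
  refine ⟨measurable_shift, Measure.ext fun A hA => ?_⟩
  rw [Measure.map_apply measurable_shift hA, bind_chainLaw_apply μ (measurable_shift hA),
    bind_chainLaw_apply μ hA]
  simp only [chainLaw_preimage_shift _ hA]
  conv_rhs => rw [← h.def]
  rw [Measure.lintegral_bind κ.aemeasurable (measurable_of_countable _).aemeasurable]

lemma harmonic_of_invariant {A : Set (ℕ → S)} (hA : MeasurableSet A) (hinv : shift ⁻¹' A = A)
    (x : S) : ∫⁻ z, chainLaw κ z A ∂(κ x) = chainLaw κ x A := by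
  rw [← chainLaw_preimage_shift x hA, hinv]

/-- With c = g x the truncated difference (g - c)⁺ is subharmonic, and by invariance it has the same
μ-integral as its average under κ. The two agree μ-almost everywhere, in particular at the charged
point x, where (g - c)⁺ = 0; so it vanishes at every state accessible from x. -/
lemma le_of_acc_of_harmonic {μ : Measure S} [IsProbabilityMeasure μ]
    (h : κ.Invariant μ) {g : S → ℝ≥0∞} (hg1 : ∀ x, g x ≤ 1) (hg : ∀ x, ∫⁻ z, g z ∂(κ x) = g x)
    {x z : S} (hx : 0 < μ {x}) (hxz : Acc κ x z) : g z ≤ g x := by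
  set c := g x with hc
  have hle : ∀ w, g w - c ≤ ∫⁻ z, (g z - c) ∂(κ w) := by
    intro w
    rw [tsub_le_iff_right]
    calc g w = ∫⁻ z, g z ∂(κ w) := (hg w).symm
      _ ≤ ∫⁻ z, ((g z - c) + c) ∂(κ w) := lintegral_mono fun z => le_tsub_add
      _ = ∫⁻ z, (g z - c) ∂(κ w) + c := by
        rw [lintegral_add_right _ measurable_const, lintegral_const, measure_univ, mul_one]
  have hint : ∫⁻ w, ∫⁻ z, (g z - c) ∂(κ w) ∂μ = ∫⁻ w, (g w - c) ∂μ := by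
    conv_rhs => rw [← h.def]
    rw [Measure.lintegral_bind κ.aemeasurable (measurable_of_countable _).aemeasurable]
  have hfin : ∫⁻ w, (g w - c) ∂μ ≠ ∞ := by
    refine ne_top_of_le_ne_top ENNReal.one_ne_top ?_
    calc ∫⁻ w, (g w - c) ∂μ ≤ ∫⁻ _, 1 ∂μ := lintegral_mono fun w => tsub_le_self.trans (hg1 w)
      _ = 1 := by simp
  have hae := ae_eq_of_ae_le_of_lintegral_le (Eventually.of_forall hle) hfin
    (measurable_of_countable _).aemeasurable hint.le
  have hx' : g x - c = ∫⁻ z, (g z - c) ∂(κ x) := by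
    by_contra hcon
    have h1 : μ {x} ≤ μ {w | ¬ (g w - c = ∫⁻ z, (g z - c) ∂(κ w))} :=
      measure_mono (Set.singleton_subset_iff.2 hcon)
    have h2 : μ {w | ¬ (g w - c = ∫⁻ z, (g z - c) ∂(κ w))} = 0 := ae_iff.1 hae
    rw [h2] at h1
    exact absurd hx (not_lt.2 h1)
  rw [hc, tsub_self, ← hc, lintegral_countable'] at hx'
  have h3 := ENNReal.tsum_eq_zero.1 hx'.symm z
  rcases mul_eq_zero.1 h3 with h4 | h4
  · exact tsub_eq_zero_iff_le.1 h4
  · exact absurd h4 hxz.ne'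

lemma le_of_reach_of_harmonic {μ : Measure S} [IsProbabilityMeasure μ]
    (h : κ.Invariant μ) {g : S → ℝ≥0∞} (hg1 : ∀ x, g x ≤ 1) (hg : ∀ x, ∫⁻ z, g z ∂(κ x) = g x)
    {x z : S} (hx : 0 < μ {x}) (hxz : Relation.ReflTransGen (Acc κ) x z) : g z ≤ g x := by
  induction hxz with
  | refl => exact le_rfl
  | tail h1 h2 ih =>
    exact (le_of_acc_of_harmonic h hg1 hg (pos_of_reach h hx h1) h2).trans ih

/-- The probabilities of A and of its complement are both harmonic in the starting point, which
yields the two opposite inequalities. -/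
lemma chainLaw_eq_of_invariant {o : S} (ho : ∀ x, Relation.ReflTransGen (Acc κ) x o)
    {μ : Measure S} [IsProbabilityMeasure μ] (h : κ.Invariant μ) {A : Set (ℕ → S)}
    (hA : MeasurableSet A) (hinv : shift ⁻¹' A = A) {x : S} (hx : 0 < μ {x}) :
    chainLaw κ x A = chainLaw κ o A := by
  refine le_antisymm ?_ ?_
  · have h1 := le_of_reach_of_harmonic h (g := fun x => chainLaw κ x Aᶜ) (fun _ => prob_le_one)
      (harmonic_of_invariant hA.compl (by rw [Set.preimage_compl, hinv])) hx (ho x)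
    simp only [prob_compl_eq_one_sub hA] at h1
    exact (ENNReal.sub_le_sub_iff_left prob_le_one ENNReal.one_ne_top).1 h1
  · exact le_of_reach_of_harmonic h (g := fun x => chainLaw κ x A) (fun _ => prob_le_one)
      (harmonic_of_invariant hA hinv) hx (ho x)

omit [IsMarkovKernel κ] in
lemma ae_pos_of_pos {μ : Measure S} (h : κ.Invariant μ) {x : S} (hx : 0 < μ {x}) :
    ∀ᵐ z ∂(κ x), 0 < μ {z} := by
  rw [ae_iff_of_countable]
  exact fun z hz => pos_of_acc h hx (pos_iff_ne_zero.2 hz)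

omit [MeasurableSingletonClass S] in
lemma ae_pos (μ : Measure S) : ∀ᵐ z ∂μ, 0 < μ {z} := by
  rw [ae_iff_of_countable]
  exact fun z hz => pos_iff_ne_zero.2 hz

/-- Independence of invariant events and cylinders, by conditioning on the first step; that step
stays among the points charged by μ, where the probability of A is constant. -/
lemma chainLaw_inter_cyl {o : S} (ho : ∀ x, Relation.ReflTransGen (Acc κ) x o)
    {μ : Measure S} [IsProbabilityMeasure μ] (h : κ.Invariant μ) {A : Set (ℕ → S)}
    (hA : MeasurableSet A) (hinv : shift ⁻¹' A = A) (n : ℕ) (s : ℕ → S) {x : S}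
    (hx : 0 < μ {x}) :
    chainLaw κ x (cyl n s ∩ A) = chainLaw κ o A * chainLaw κ x (cyl n s) := by
  induction n generalizing s x with
  | zero =>
    have h0 : cyl 0 s = Set.univ := by ext; simp [cyl]
    rw [h0, Set.univ_inter, measure_univ, mul_one, chainLaw_eq_of_invariant ho h hA hinv hx]
  | succ n ih =>
    by_cases hs : s 0 = x
    · set s' : ℕ → S := fun i => s (i + 1) with hs'
      have h1 : chainLaw κ x (cyl (n + 1) s ∩ A) = chainLaw κ x (shift ⁻¹' (cyl n s' ∩ A)) := by
        refine measure_congr ?_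
        rw [Set.preimage_inter, hinv]
        filter_upwards [chainLaw_ae_zero κ x] with ω hω
        refine propext ⟨fun h => ⟨fun i hi => h.1 (i + 1) (by omega), h.2⟩,
          fun h => ⟨fun i hi => ?_, h.2⟩⟩
        rcases i with _ | i
        · rw [hω, hs]
        · exact h.1 i (by omega)
      have h2 : chainLaw κ x (cyl (n + 1) s) = chainLaw κ x (shift ⁻¹' (cyl n s')) := by
        refine measure_congr ?_
        filter_upwards [chainLaw_ae_zero κ x] with ω hω
        refine propext ⟨fun h => fun i hi => h (i + 1) (by omega), fun h => fun i hi => ?_⟩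
        rcases i with _ | i
        · rw [hω, hs]
        · exact h i (by omega)
      rw [h1, h2, chainLaw_preimage_shift x ((measurableSet_cyl n s').inter hA),
        chainLaw_preimage_shift x (measurableSet_cyl n s'),
        ← lintegral_const_mul _ (measurable_of_countable _)]
      refine lintegral_congr_ae ?_
      filter_upwards [ae_pos_of_pos h hx] with z hz
      exact ih s' hz
    · have h0 : chainLaw κ x (cyl (n + 1) s) = 0 := by
        rw [measure_eq_zero_iff_ae_notMem]
        filter_upwards [chainLaw_ae_zero κ x] with ω hω hc
        exact hs ((hc 0 (Nat.succ_pos n)).symm.trans hω)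
      rw [h0, mul_zero]
      exact measure_mono_null Set.inter_subset_left h0

/-- The stationary chain is ergodic. -/
theorem ergodic_shift {o : S} (ho : ∀ x, Relation.ReflTransGen (Acc κ) x o)
    {μ : Measure S} [IsProbabilityMeasure μ] (h : κ.Invariant μ) :
    Ergodic shift (μ.bind (chainLaw κ)) := by
  refine ⟨measurePreserving_shift h, ⟨fun {A} hA hinv => ?_⟩⟩
  rw [eventuallyConst_set']
  obtain ⟨x, hx⟩ := (ae_pos μ).exists
  -- Independence of all cylinders extends to all events; evaluated at the complement of A it is the
  -- zero-one law.
  have hr : (chainLaw κ x).restrict A = chainLaw κ o A • chainLaw κ x := by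
    refine ext_of_cyl (fun n s => ?_) ⟨o⟩
    rw [Measure.restrict_apply (measurableSet_cyl n s), Measure.smul_apply, smul_eq_mul]
    exact chainLaw_inter_cyl ho h hA hinv n s hx
  have h1 := congrArg (fun m => m Aᶜ) hr
  simp only [Measure.restrict_apply hA.compl, Set.compl_inter_self, measure_empty,
    Measure.smul_apply, smul_eq_mul] at h1
  rcases mul_eq_zero.1 h1.symm with h2 | h2
  · left
    rw [ae_eq_empty, bind_chainLaw_apply μ hA]
    rw [lintegral_eq_zero_iff (measurable_of_countable _)]
    filter_upwards [ae_pos μ] with z hz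
    rw [chainLaw_eq_of_invariant ho h hA hinv hz, h2]
    rfl
  · right
    rw [ae_eq_univ, bind_chainLaw_apply μ hA.compl]
    rw [lintegral_eq_zero_iff (measurable_of_countable _)]
    have hinv' : shift ⁻¹' Aᶜ = Aᶜ := by rw [Set.preimage_compl, hinv]
    filter_upwards [ae_pos μ] with z hz
    rw [chainLaw_eq_of_invariant ho h hA.compl hinv' hz,
      ← chainLaw_eq_of_invariant ho h hA.compl hinv' hx, h2]
    rfl

/-! ### The law of large numbers -/

/-- The ergodic averages along a path. -/
noncomputable def avg (f : S → ℝ) (n : ℕ) (ω : ℕ → S) : ℝ :=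
  (1 / (n : ℝ)) * ∑ m ∈ Finset.Icc 1 n, f (ω m)

omit [Countable S] [MeasurableSpace S] [MeasurableSingletonClass S] in
lemma avg_shift (f : S → ℝ) (n : ℕ) (ω : ℕ → S) :
    avg f n (shift ω) = (1 / (n : ℝ)) * (∑ m ∈ Finset.Icc 1 (n + 1), f (ω m) - f (ω 1)) := by
  rw [avg, Finset.sum_Icc_succ_top (by omega)]
  congr 1
  induction n with
  | zero => simp
  | succ n ih =>
    rw [Finset.sum_Icc_succ_top (by omega), ih, Finset.sum_Icc_succ_top (by omega)]
    simp only [shift]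
    ring

omit [Countable S] [MeasurableSpace S] [MeasurableSingletonClass S] in
-- Makes convergence of the averages a shift-invariant event, so that its probability is harmonic in
-- the starting point.
lemma tendsto_avg_shift_iff (f : S → ℝ) (c : ℝ) (ω : ℕ → S) :
    Tendsto (fun n => avg f n (shift ω)) atTop (𝓝 c) ↔
      Tendsto (fun n => avg f n ω) atTop (𝓝 c) := by
  rw [← tendsto_add_atTop_iff_nat (f := fun n => avg f n ω) 1]
  have h0 : Tendsto (fun n : ℕ => 1 / ((n : ℝ) + 1)) atTop (𝓝 0) :=
    tendsto_one_div_add_atTop_nhds_zero_nat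
  have h0' : Tendsto (fun n : ℕ => 1 / (n : ℝ)) atTop (𝓝 0) := tendsto_one_div_atTop_nhds_zero_nat
  constructor
  · intro h
    have h1 := (h.mul ((tendsto_const_nhds (x := (1 : ℝ))).sub h0)).add (h0.mul_const (f (ω 1)))
    rw [sub_zero, mul_one, zero_mul, add_zero] at h1
    refine h1.congr' ?_
    filter_upwards [eventually_gt_atTop 0] with n hn
    have hn' : (n : ℝ) ≠ 0 := by exact_mod_cast hn.ne'
    rw [avg_shift, avg]
    push_cast
    field_simp
    ring
  · intro h
    have h1 := (h.mul ((tendsto_const_nhds (x := (1 : ℝ))).add h0')).sub (h0'.mul_const (f (ω 1)))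
    rw [add_zero, mul_one, zero_mul, sub_zero] at h1
    refine h1.congr' ?_
    filter_upwards [eventually_gt_atTop 0] with n hn
    have hn' : (n : ℝ) ≠ 0 := by exact_mod_cast hn.ne'
    rw [avg_shift, avg]
    push_cast
    field_simp

lemma map_eval_bind_chainLaw (μ : Measure S) :
    (μ.bind (chainLaw κ)).map (fun ω => ω 0) = μ := by
  refine Measure.ext_of_singleton fun x => ?_
  have hm : MeasurableSet ((fun ω : ℕ → S => ω 0) ⁻¹' {x}) :=
    measurable_pi_apply 0 (measurableSet_singleton x)
  rw [Measure.map_apply (measurable_pi_apply 0) (measurableSet_singleton x),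
    bind_chainLaw_apply μ hm, lintegral_countable', tsum_eq_single x]
  · have : chainLaw κ x ((fun ω : ℕ → S => ω 0) ⁻¹' {x}) = 1 :=
      (mem_ae_iff_prob_eq_one hm).1 (chainLaw_ae_zero κ x)
    rw [this, one_mul]
  · intro z hz
    rw [measure_eq_zero_iff_ae_notMem.2, zero_mul]
    filter_upwards [chainLaw_ae_zero κ z] with ω hω hc
    exact hz (hω.symm.trans hc)

lemma ae_tendsto_avg_stationary {o : S} (ho : ∀ x, Relation.ReflTransGen (Acc κ) x o)
    {μ : Measure S} [IsProbabilityMeasure μ] (h : κ.Invariant μ) {f : S → ℝ}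
    (hf : Integrable f μ) : ∀ᵐ ω ∂(μ.bind (chainLaw κ)),
      Tendsto (fun n => avg f n ω) atTop (𝓝 (∫ x, f x ∂μ)) := by
  have hprob := isProbabilityMeasure_bind_chainLaw (κ := κ) μ
  have hfm : Measurable f := measurable_of_countable f
  have h0 : Measurable fun ω : ℕ → S => ω 0 := measurable_pi_apply 0
  have hmap := map_eval_bind_chainLaw (κ := κ) μ
  have hint : Integrable (fun ω : ℕ → S => f (ω 0)) (μ.bind (chainLaw κ)) := by
    rw [← hmap] at hf
    exact (integrable_map_measure hfm.aestronglyMeasurable h0.aemeasurable).1 hf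
  have hval : ∫ ω, f (ω 0) ∂(μ.bind (chainLaw κ)) = ∫ x, f x ∂μ := by
    conv_rhs => rw [← hmap]
    exact (integral_map h0.aemeasurable hfm.aestronglyMeasurable).symm
  have key := PointwiseErgodic.tendsto_birkhoff (ergodic_shift ho h) (hfm.comp h0) hint
  -- The averages begin at time 1 and Birkhoff sums at time 0, so the convergence is used along the
  -- shifted path.
  have key' := (measurePreserving_shift h).quasiMeasurePreserving.ae key
  filter_upwards [key'] with ω hω
  rw [← hval]
  refine hω.congr fun n => ?_
  have hit : ∀ k, shift^[k] (shift ω) 0 = ω (k + 1) := by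
    intro k
    have : ∀ (k : ℕ) (ω : ℕ → S) (i : ℕ), shift^[k] ω i = ω (i + k) := by
      intro k
      induction k with
      | zero => intro ω i; rfl
      | succ k ih =>
        intro ω i
        rw [Function.iterate_succ_apply, ih, shift, add_assoc]
    rw [this, zero_add, shift]
  rw [avg, birkhoffSum]
  congr 1
  induction n with
  | zero => simp
  | succ n ih =>
    rw [Finset.sum_range_succ, ih, Finset.sum_Icc_succ_top (by omega), Function.comp_apply, hit]

/-- **Ergodic theorem** for countable Markov chains with a drift condition and a state that is
accessible from everywhere. -/
theorem exists_unique_invariant_and_slln (W : S → ℝ≥0) (hW : ∀ r, {x | W x ≤ r}.Finite)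
    {ρ b : ℝ≥0} (hρ : ρ < 1) (hdrift : ∀ x, ∫⁻ z, W z ∂(κ x) ≤ ρ * W x + b) {o : S}
    (ho : ∀ x, Relation.ReflTransGen (Acc κ) x o) :
    ∃ μ : Measure S, IsProbabilityMeasure μ ∧ κ.Invariant μ ∧
      (∀ μ' : Measure S, IsProbabilityMeasure μ' → κ.Invariant μ' → μ' = μ) ∧
      ∫⁻ x, W x ∂μ < ∞ ∧
      ∀ (y : S) (f : S → ℝ), Integrable f μ → ∀ᵐ ω ∂(chainLaw κ y),
        Tendsto (fun n => avg f n ω) atTop (𝓝 (∫ x, f x ∂μ)) := by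
  obtain ⟨μ, hμ, hinv, hfin, -⟩ := exists_invariant κ W hW hρ hdrift o
  refine ⟨μ, hμ, hinv, fun μ' _ h' => invariant_unique ho h' hinv, hfin, fun y f hf => ?_⟩
  set E : Set (ℕ → S) := {ω | Tendsto (fun n => avg f n ω) atTop (𝓝 (∫ x, f x ∂μ))} with hE
  have hEm : MeasurableSet E := by
    refine measurableSet_tendsto _ fun n => ?_
    refine measurable_const.mul (Finset.measurable_sum _ fun m _ => ?_)
    exact (measurable_of_countable f).comp (measurable_pi_apply m)
  have hEinv : shift ⁻¹' E = E := by
    ext ω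
    exact tendsto_avg_shift_iff f _ ω
  have hprob := isProbabilityMeasure_bind_chainLaw (κ := κ) μ
  have hstat : μ.bind (chainLaw κ) E = 1 :=
    (mem_ae_iff_prob_eq_one hEm).1 (ae_tendsto_avg_stationary ho hinv hf)
  rw [bind_chainLaw_apply μ hEm] at hstat
  -- The construction is repeated from y for the sake of its Fatou bound on harmonic functions. By
  -- uniqueness the limit is again μ, so the probability of E started at y is at least its
  -- stationary probability 1.
  obtain ⟨ν, hν, hνinv, -, hle⟩ := exists_invariant κ W hW hρ hdrift y
  have hνμ : ν = μ := invariant_unique ho hνinv hinv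
  have h1 := hle (fun x => (chainLaw κ x E).toNNReal) (fun x => by
    simp only [ENNReal.coe_toNNReal (measure_ne_top _ _)]
    exact harmonic_of_invariant hEm hEinv x)
  simp only [ENNReal.coe_toNNReal (measure_ne_top _ _)] at h1
  rw [hνμ, hstat] at h1
  exact (mem_ae_iff_prob_eq_one hEm).2 (le_antisymm prob_le_one h1)

end CountableChain

/-! ### The MRARMA chain: stability, accessibility and drift -/

namespace MRARMA

open scoped ENNReal NNReal

variable {p q : ℕ} {α : Fin p → ℝ} {β : Fin q → ℝ} {ν : Measure ℤ}

/-! ### Stability of the companion matrix -/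

section Gelfand

attribute [local instance] Matrix.linftyOpNormedRing Matrix.linftyOpNormedAlgebra

/-- Powers of a real matrix with complex spectral radius less than `1` tend to zero. -/
lemma tendsto_pow_toLin_of_spectralRadius_lt_one {ι : Type*} [Fintype ι] [DecidableEq ι]
    (A : Matrix ι ι ℝ) (h : spectralRadius ℂ (A.map (algebraMap ℝ ℂ)) < 1) (x : ι → ℝ) :
    Tendsto (fun n : ℕ => (Matrix.toLin' A ^ n) x) atTop (𝓝 0) := by
  set M : Matrix ι ι ℂ := A.map (algebraMap ℝ ℂ) with hM
  -- Gelfand's formula gives ‖M^n‖ ≤ r^n eventually, for some r < 1.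
  have hG := spectrum.pow_nnnorm_pow_one_div_tendsto_nhds_spectralRadius M
  obtain ⟨r, hr1, hr2⟩ := ENNReal.lt_iff_exists_nnreal_btwn.1 h
  have hr2' : r < 1 := by exact_mod_cast hr2
  have hev : ∀ᶠ n : ℕ in atTop, ‖M ^ n‖ ≤ (r : ℝ) ^ n := by
    filter_upwards [hG.eventually (gt_mem_nhds hr1), eventually_gt_atTop 0] with n hn hn0
    have hn0' : (0 : ℝ) < n := by exact_mod_cast hn0
    have h1 := ENNReal.rpow_le_rpow hn.le hn0'.le
    rw [← ENNReal.rpow_mul, one_div_mul_cancel hn0'.ne', ENNReal.rpow_one,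
      ENNReal.rpow_natCast] at h1
    have h2 : ‖M ^ n‖₊ ≤ r ^ n := by exact_mod_cast h1
    exact_mod_cast h2
  have hr0 : Tendsto (fun n : ℕ => (r : ℝ) ^ n) atTop (𝓝 0) :=
    tendsto_pow_atTop_nhds_zero_of_lt_one r.2 (by exact_mod_cast hr2')
  set xc : ι → ℂ := fun i => (x i : ℂ) with hxc
  have hmul : ∀ n i, (M ^ n).mulVec xc i = (((Matrix.toLin' A ^ n) x i : ℝ) : ℂ) := by
    intro n i
    have h1 : M ^ n = (A ^ n).map (algebraMap ℝ ℂ) := by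
      rw [hM, ← RingHom.mapMatrix_apply, ← RingHom.mapMatrix_apply, map_pow]
    rw [← Matrix.toLin'_pow, Matrix.toLin'_apply, h1]
    simp [Matrix.mulVec, dotProduct, hxc]
  rw [tendsto_zero_iff_norm_tendsto_zero]
  have hlim : Tendsto (fun n : ℕ => (r : ℝ) ^ n * ‖xc‖) atTop (𝓝 0) := by
    simpa using hr0.mul_const ‖xc‖
  refine squeeze_zero' (Eventually.of_forall fun n => norm_nonneg _) ?_ hlim
  filter_upwards [hev] with n hn
  rw [pi_norm_le_iff_of_nonneg (by positivity)]
  intro i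
  have h1 := norm_le_pi_norm ((M ^ n).mulVec xc) i
  rw [hmul, Complex.norm_real] at h1
  refine h1.trans ((Matrix.linfty_opNorm_mulVec _ _).trans ?_)
  exact mul_le_mul_of_nonneg_right hn (norm_nonneg _)

end Gelfand

/-- The real vector of a state. -/
def castR (y : State p q) : Fin p ⊕ Fin q → ℝ := fun c => (y c : ℝ)

/-- The indicator of the coordinates in which a new innovation enters. -/
def innov (p q : ℕ) : Fin p ⊕ Fin q → ℝ
  | Sum.inl i => if i.val = 0 then 1 else 0
  | Sum.inr j => if j.val = 0 then 1 else 0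

/-- The indicator of the current observation. -/
def current (p q : ℕ) : Fin p ⊕ Fin q → ℝ
  | Sum.inl i => if i.val = 0 then 1 else 0
  | Sum.inr _ => 0

lemma sum_pred {n : ℕ} (i : Fin n) (hi : i.val ≠ 0) (f : Fin n → ℝ) :
    ∑ k : Fin n, (if i.val = k.val + 1 then (1 : ℝ) else 0) * f k =
      f ⟨i.val - 1, lt_of_le_of_lt (Nat.sub_le _ _) i.isLt⟩ := by
  rw [Finset.sum_eq_single ⟨i.val - 1, lt_of_le_of_lt (Nat.sub_le _ _) i.isLt⟩]
  · rw [if_pos (by simp only; omega), one_mul]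
  · intro b _ hb
    rw [if_neg, zero_mul]
    intro h
    exact hb (Fin.ext (by simp only; omega))
  · simp

/-- Splits a transition into the linear map, the innovation and a rounding error, the last being
almost surely at most 1 in absolute value. -/
lemma castR_step (y : State p q) (e r : ℤ) :
    castR (step y e r) = Matrix.toLin' (companion α β) (castR y) +
      ((e : ℝ) • innov p q + ((r : ℝ) - predictor α β y) • current p q) := by
  ext c
  rw [Pi.add_apply, Matrix.toLin'_apply, Matrix.mulVec, dotProduct, Fintype.sum_sum_type]
  rcases c with i | j
  · by_cases hi : i.val = 0
    · simp [castR, step, companion, innov, current, hi, predictor]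
      ring
    · have := sum_pred i hi fun k => (y (Sum.inl k) : ℝ)
      simp [castR, step, companion, innov, current, hi] at this ⊢
      rw [← this]
  · by_cases hj : j.val = 0
    · simp [castR, step, companion, innov, current, hj]
    · have := sum_pred j hj fun k => (y (Sum.inr k) : ℝ)
      simp [castR, step, companion, innov, current, hj] at this ⊢
      rw [← this]

/-! ### The transition kernel -/

lemma ae_roundLaw (z : ℝ) : ∀ᵐ r : ℤ ∂(roundLaw z), |(r : ℝ) - z| ≤ 1 := by
  have h0 := Int.floor_le z
  have h1 := (Int.lt_floor_add_one z).le
  rw [roundLaw, ae_add_measure_iff]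
  constructor <;> refine Measure.ae_smul_measure ?_ _ <;> rw [ae_dirac_iff (by trivial)]
  · rw [abs_le]; constructor <;> linarith
  · push_cast
    rw [abs_le]; constructor <;> linarith

/-- Justifies thresholds: u < 1 prevents an integer from being rounded up, so every step of a flow
uses a rounding of positive probability. -/
lemma roundLaw_pos {z u : ℝ} (h0 : 0 ≤ u) (h1 : u < 1) : 0 < roundLaw z {⌊z + u⌋} := by
  have h2 := Int.floor_add_fract z
  have h3 := Int.fract_lt_one z
  have h4 := Int.fract_nonneg z
  have h5 : ⌊z + u⌋ = ⌊z⌋ + ⌊Int.fract z + u⌋ := by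
    rw [← Int.floor_intCast_add]
    congr 1
    linarith
  rw [roundLaw, Measure.add_apply, Measure.smul_apply, Measure.smul_apply, h5]
  by_cases h : Int.fract z + u < 1
  · have : ⌊Int.fract z + u⌋ = 0 := Int.floor_eq_zero_iff.2 ⟨by linarith, h⟩
    rw [this, add_zero]
    simpa using h3
  · have : ⌊Int.fract z + u⌋ = 1 := by
      rw [Int.floor_eq_iff]
      push_cast
      constructor <;> linarith
    rw [this]
    simp
    linarith

lemma acc_step (hcharge : ∀ a : ℤ, 0 < ν {a}) (y : State p q) (e : ℤ) {u : ℝ} (h0 : 0 ≤ u)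
    (h1 : u < 1) :
    CountableChain.Acc (transition α β ν) y (step y e ⌊predictor α β y + u⌋) := by
  change 0 < ((ν.prod (roundLaw (predictor α β y))).map fun er => step y er.1 er.2) _
  rw [Measure.map_apply (measurable_of_countable _) (measurableSet_singleton _)]
  refine lt_of_lt_of_le ?_ (measure_mono (s := {e} ×ˢ {⌊predictor α β y + u⌋}) ?_)
  · rw [Measure.prod_prod]
    exact ENNReal.mul_pos (hcharge e).ne' (roundLaw_pos h0 h1).ne'
  · rintro ⟨a, b⟩ ⟨ha, hb⟩
    simp only [Set.mem_singleton_iff] at ha hb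
    simp [ha, hb]

lemma lintegral_transition_le (y : State p q) (h : State p q → ℝ≥0∞) (c : ℤ → ℝ≥0∞)
    (hc : ∀ e r : ℤ, |(r : ℝ) - predictor α β y| ≤ 1 → h (step y e r) ≤ c e) :
    ∫⁻ z, h z ∂(transition α β ν y) ≤ ∫⁻ e, c e ∂ν := by
  change ∫⁻ z, h z ∂((ν.prod (roundLaw (predictor α β y))).map fun er => step y er.1 er.2) ≤ _
  rw [lintegral_map (measurable_of_countable _) (measurable_of_countable _),
    lintegral_prod _ (measurable_of_countable _).aemeasurable]
  refine lintegral_mono fun e => ?_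
  calc ∫⁻ r, h (step y e r) ∂(roundLaw (predictor α β y))
      ≤ ∫⁻ _, c e ∂(roundLaw (predictor α β y)) :=
        lintegral_mono_ae ((ae_roundLaw _).mono fun r hr => hc e r hr)
    _ = c e := by simp

/-! ### Accessibility of the zero state -/

/-- Innovations equal to 0 during q steps flush all the innovation lags. -/
lemma exists_reach_inr_eq_zero (hcharge : ∀ a : ℤ, 0 < ν {a}) (y : State p q) :
    ∃ x : Fin p → ℤ, Relation.ReflTransGen (CountableChain.Acc (transition α β ν)) y
      (Sum.elim x 0) := by
  have h : ∀ n : ℕ, ∃ z : State p q,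
      Relation.ReflTransGen (CountableChain.Acc (transition α β ν)) y z ∧
        ∀ j : Fin q, j.val < n → z (Sum.inr j) = 0 := by
    intro n
    induction n with
    | zero => exact ⟨y, Relation.ReflTransGen.refl, fun j hj => absurd hj (Nat.not_lt_zero _)⟩
    | succ n ih =>
      obtain ⟨z, hz, h0⟩ := ih
      refine ⟨_, hz.tail (acc_step hcharge z 0 le_rfl zero_lt_one), fun j hj => ?_⟩
      simp only [step]
      split_ifs with h
      · rfl
      · exact h0 _ (by simp only; omega)
  obtain ⟨z, hz, h0⟩ := h q
  refine ⟨fun i => z (Sum.inl i), ?_⟩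
  convert hz using 1
  ext c
  rcases c with i | j
  · rfl
  · exact (h0 j j.isLt).symm

section AR

variable {d : ℕ} {α : Fin (d + 1) → ℝ}

lemma predictor_elim (x : Fin (d + 1) → ℤ) :
    predictor α β (Sum.elim x 0) = RoundingAR.dot α (RoundingAR.toReal x) := by
  simp [predictor, RoundingAR.dot]

lemma step_elim (x : Fin (d + 1) → ℤ) (r : ℤ) :
    step (Sum.elim x 0 : State (d + 1) q) 0 r = Sum.elim (RoundingAR.shiftIn r x) 0 := by
  ext c
  rcases c with i | j
  · refine Fin.cases ?_ (fun i => ?_) i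
    · simp [step]
    · simp only [step, Sum.elim_inl, RoundingAR.shiftIn_succ, Fin.val_succ,
        if_neg (Nat.succ_ne_zero _)]
      rfl
  · simp [step]

lemma reach_of_isFlow (hcharge : ∀ a : ℤ, 0 < ν {a}) {φ : (Fin (d + 1) → ℤ) → (Fin (d + 1) → ℤ)}
    (hφ : RoundingAR.IsFlow α φ) (x : Fin (d + 1) → ℤ) :
    Relation.ReflTransGen (CountableChain.Acc (transition α β ν)) (Sum.elim x 0)
      (Sum.elim (φ x) 0) := by
  induction hφ with
  | id => exact Relation.ReflTransGen.refl
  | @step φ u _ h0 h1 ih =>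
    refine ih.tail ?_
    have := acc_step (α := α) (β := β) hcharge (Sum.elim (φ x) 0) 0 h0 h1
    rwa [predictor_elim, step_elim] at this

lemma companion_elim (x : Fin (d + 1) → ℝ) :
    Matrix.toLin' (companion α β) (Sum.elim x 0) = Sum.elim (RoundingAR.arMap α x) 0 := by
  ext c
  rw [Matrix.toLin'_apply, Matrix.mulVec, dotProduct, Fintype.sum_sum_type]
  rcases c with i | j
  · refine Fin.cases ?_ (fun i => ?_) i
    · simp [companion, RoundingAR.arMap_apply, RoundingAR.dot]
    · have := sum_pred i.succ (by simp) x
      simp only [companion, Sum.elim_inl, Sum.elim_inr, Pi.zero_apply, mul_zero,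
        Finset.sum_const_zero, add_zero, Fin.val_succ, if_neg (Nat.succ_ne_zero _)] at this ⊢
      rw [this, RoundingAR.arMap_apply, RoundingAR.shiftIn_succ]
      rfl
  · simp [companion]

/-- The vectors without innovation entries form an invariant subspace on which the companion matrix
acts as `arMap`, so stability is inherited. -/
lemma tendsto_arMap_pow
    (hA : ∀ x, Tendsto (fun n : ℕ => (Matrix.toLin' (companion α β) ^ n) x) atTop (𝓝 0))
    (x : Fin (d + 1) → ℝ) : Tendsto (fun n : ℕ => (RoundingAR.arMap α ^ n) x) atTop (𝓝 0) := by
  have h : ∀ n : ℕ, (Matrix.toLin' (companion α β) ^ n) (Sum.elim x 0) =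
      Sum.elim ((RoundingAR.arMap α ^ n) x) 0 := by
    intro n
    induction n with
    | zero => simp
    | succ n ih =>
      rw [pow_succ', Module.End.mul_apply, ih, companion_elim, pow_succ', Module.End.mul_apply]
  have h1 := hA (Sum.elim x 0)
  simp only [h] at h1
  rw [tendsto_pi_nhds] at h1 ⊢
  exact fun i => h1 (Sum.inl i)

end AR

/-- The zero state is accessible from every state. -/
theorem reach_zero (hcharge : ∀ a : ℤ, 0 < ν {a}) (hα : ∀ i : Fin p, i.val + 1 = p → α i ≠ 0)
    (hA : ∀ x, Tendsto (fun n : ℕ => (Matrix.toLin' (companion α β) ^ n) x) atTop (𝓝 0))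
    (y : State p q) :
    Relation.ReflTransGen (CountableChain.Acc (transition α β ν)) y 0 := by
  obtain ⟨x, hx⟩ := exists_reach_inr_eq_zero (α := α) (β := β) hcharge y
  refine hx.trans ?_
  rcases p with _ | d
  · have : (Sum.elim x 0 : State 0 q) = 0 := by
      ext c
      rcases c with i | j
      · exact i.elim0
      · rfl
    rw [this]
  · obtain ⟨φ, hφ, h0⟩ := RoundingAR.exists_flow_to_zero (hα (Fin.last d) (by simp))
      (tendsto_arMap_pow hA) x
    have h1 := reach_of_isFlow (α := α) (β := β) hcharge hφ x
    rw [h0] at h1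
    convert h1 using 1
    ext c
    rcases c with i | j <;> rfl

/-! ### The drift condition -/

variable [IsProbabilityMeasure ν]

lemma lintegral_affine_rpow_lt_top {k : ℝ} (hk : 1 ≤ k)
    (hmoment : Integrable (fun a : ℤ => |(a : ℝ)| ^ k) ν) (A B : ℝ≥0) :
    ∫⁻ e, ((e.natAbs : ℝ≥0∞) * A + B) ^ k ∂ν < ∞ := by
  have h1 : ∫⁻ e, (e.natAbs : ℝ≥0∞) ^ k ∂ν < ∞ := by
    have := hmoment.lintegral_lt_top
    refine lt_of_le_of_lt (lintegral_mono fun e => ?_) this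
    rw [← ENNReal.ofReal_rpow_of_nonneg (abs_nonneg _) (by linarith)]
    have : |(e : ℝ)| = ((e.natAbs : ℕ) : ℝ) := by
      rw [Nat.cast_natAbs, Int.cast_abs]
    rw [this, ENNReal.ofReal_natCast]
  have h2 : ∀ e : ℤ, ((e.natAbs : ℝ≥0∞) * A + B) ^ k ≤
      (2 : ℝ≥0∞) ^ (k - 1) * ((A : ℝ≥0∞) ^ k * (e.natAbs : ℝ≥0∞) ^ k + (B : ℝ≥0∞) ^ k) := by
    intro e
    have := ENNReal.rpow_add_le_mul_rpow_add_rpow ((e.natAbs : ℝ≥0∞) * A) B hk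
    rwa [ENNReal.mul_rpow_of_nonneg _ _ (by linarith), mul_comm ((e.natAbs : ℝ≥0∞) ^ k)] at this
  refine (lintegral_mono h2).trans_lt ?_
  rw [lintegral_const_mul _ (measurable_of_countable _),
    lintegral_add_right _ measurable_const, lintegral_const_mul _ (measurable_of_countable _),
    lintegral_const, measure_univ, mul_one]
  have hk0 : 0 ≤ k := by linarith
  have hA : (A : ℝ≥0∞) ^ k < ∞ := ENNReal.rpow_lt_top_of_nonneg hk0 ENNReal.coe_ne_top
  have hB : (B : ℝ≥0∞) ^ k < ∞ := ENNReal.rpow_lt_top_of_nonneg hk0 ENNReal.coe_ne_top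
  have h2' : (2 : ℝ≥0∞) ^ (k - 1) < ∞ :=
    ENNReal.rpow_lt_top_of_nonneg (by linarith) ENNReal.ofNat_ne_top
  exact ENNReal.mul_lt_top h2' (ENNReal.add_lt_top.2 ⟨ENNReal.mul_lt_top hA h1, hB⟩)

/-- A Lyapunov function for the chain. -/
theorem exists_lyapunov {k : ℝ} (hk : 1 ≤ k)
    (hmoment : Integrable (fun a : ℤ => |(a : ℝ)| ^ k) ν)
    (hA : ∀ x, Tendsto (fun n : ℕ => (Matrix.toLin' (companion α β) ^ n) x) atTop (𝓝 0)) :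
    ∃ (W : State p q → ℝ≥0) (ρ b : ℝ≥0), ρ < 1 ∧ (∀ r, {x | W x ≤ r}.Finite) ∧
      (∀ y, ∫⁻ z, W z ∂(transition α β ν y) ≤ ρ * W y + b) ∧
      ∃ C : ℝ≥0, ∀ y, norm1 y ^ k ≤ C * W y := by
  have hk0 : 0 < k := by linarith
  obtain ⟨N, ρ, hρ0, hρ1, hnorm, hadd, hsmul, hcontr⟩ :=
    RoundingAR.exists_adapted_norm (Matrix.toLin' (companion α β)) hA
  have hN0 : ∀ x, 0 ≤ N x := fun x => (norm_nonneg _).trans (hnorm x)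
  lift ρ to ℝ≥0 using hρ0.le
  set Nn : State p q → ℝ≥0 := fun y => ⟨N (castR y), hN0 _⟩ with hNn
  set A : ℝ≥0 := ⟨N (innov p q), hN0 _⟩ with hAdef
  set B : ℝ≥0 := ⟨N (current p q), hN0 _⟩ with hBdef
  have hρ1' : ρ < 1 := by exact_mod_cast hρ1
  have hδ : (1 - ρ) ≠ 0 := (tsub_pos_of_lt hρ1').ne'
  have hsum : ρ + (1 - ρ) = 1 := add_tsub_cancel_of_le hρ1'.le
  have hstep : ∀ (y : State p q) (e r : ℤ), |(r : ℝ) - predictor α β y| ≤ 1 →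
      Nn (step y e r) ≤ ρ * Nn y + (e.natAbs * A + B) := by
    intro y e r hr
    rw [← NNReal.coe_le_coe]
    push_cast
    rw [Nat.cast_natAbs, Int.cast_abs]
    change N (castR (step y e r)) ≤ ρ * N (castR y) + (|(e : ℝ)| * N (innov p q) + N (current p q))
    rw [castR_step (α := α) (β := β)]
    refine (hadd _ _).trans (add_le_add (hcontr _) ((hadd _ _).trans (add_le_add ?_ ?_)))
    · rw [hsmul]
    · rw [hsmul]
      exact mul_le_of_le_one_left (hN0 _) hr
  set c : ℤ → ℝ≥0∞ := fun e =>
    ((e.natAbs : ℝ≥0∞) * ((A / (1 - ρ) : ℝ≥0) : ℝ≥0∞) + ((B / (1 - ρ) : ℝ≥0) : ℝ≥0∞)) ^ k with hc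
  have hfin : ∫⁻ e, c e ∂ν < ∞ := lintegral_affine_rpow_lt_top hk hmoment _ _
  have hconv : ∀ (y : State p q) (e r : ℤ), |(r : ℝ) - predictor α β y| ≤ 1 →
      ((Nn (step y e r) ^ k : ℝ≥0) : ℝ≥0∞) ≤
        (ρ : ℝ≥0∞) * ((Nn y ^ k : ℝ≥0) : ℝ≥0∞) + c e := by
    intro y e r hr
    -- Writing the additive term as 1 - ρ times its quotient by 1 - ρ produces a convex combination,
    -- so convexity of the k-th power retains the factor ρ on the old state.
    have h1 : Nn (step y e r) ≤ ρ * Nn y +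
        (1 - ρ) * (e.natAbs * (A / (1 - ρ)) + B / (1 - ρ)) := by
      refine (hstep y e r hr).trans (le_of_eq ?_)
      congr 1
      field_simp
    have h2 := NNReal.rpow_le_rpow h1 hk0.le
    have h3 := NNReal.rpow_arith_mean_le_arith_mean2_rpow ρ (1 - ρ) (Nn y)
      (e.natAbs * (A / (1 - ρ)) + B / (1 - ρ)) hsum hk
    have h4 : (1 - ρ) * (e.natAbs * (A / (1 - ρ)) + B / (1 - ρ)) ^ k ≤
        (e.natAbs * (A / (1 - ρ)) + B / (1 - ρ)) ^ k :=
      mul_le_of_le_one_left zero_le tsub_le_self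
    have h5 := h2.trans (h3.trans (add_le_add le_rfl h4))
    have h6 : c e = (((e.natAbs * (A / (1 - ρ)) + B / (1 - ρ)) ^ k : ℝ≥0) : ℝ≥0∞) := by
      rw [hc, ENNReal.coe_rpow_of_nonneg _ hk0.le]
      push_cast
      rfl
    rw [h6, ← ENNReal.coe_mul, ← ENNReal.coe_add, ENNReal.coe_le_coe]
    exact h5
  refine ⟨fun y => Nn y ^ k, ρ, (∫⁻ e, c e ∂ν).toNNReal, hρ1', fun r => ?_, fun y => ?_,
    ((Fintype.card (Fin p ⊕ Fin q) : ℝ≥0) ^ k), fun y => ?_⟩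
  · set R : ℤ := ⌈((r ^ (1 / k) : ℝ≥0) : ℝ)⌉ with hR
    have h1 : (Set.Icc (fun _ => -R : State p q) (fun _ => R)).Finite := Set.finite_Icc _ _
    refine h1.subset fun x hx => ?_
    have hx' : Nn x ≤ r ^ (1 / k) := by
      have := NNReal.rpow_le_rpow (z := 1 / k) (show Nn x ^ k ≤ r from hx) (by positivity)
      rwa [← NNReal.rpow_mul, mul_one_div_cancel hk0.ne', NNReal.rpow_one] at this
    have h2 : ∀ i, |x i| ≤ R := by
      intro i
      have h3 := (norm_le_pi_norm (castR x) i).trans (hnorm _)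
      rw [castR, Real.norm_eq_abs] at h3
      have h4 : N (castR x) ≤ ((r ^ (1 / k) : ℝ≥0) : ℝ) := hx'
      have h5 := (h3.trans h4).trans (Int.le_ceil _)
      exact_mod_cast h5
    exact ⟨fun i => (abs_le.1 (h2 i)).1, fun i => (abs_le.1 (h2 i)).2⟩
  · refine (lintegral_transition_le y _ _ (hconv y)).trans ?_
    rw [lintegral_add_left measurable_const, lintegral_const, measure_univ, mul_one,
      ENNReal.coe_toNNReal hfin.ne]
  · have h1 : norm1 y ≤ Fintype.card (Fin p ⊕ Fin q) * N (castR y) := by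
      rw [norm1, ← nsmul_eq_mul]
      refine Finset.sum_le_card_nsmul _ _ _ fun i _ => ?_
      have := (norm_le_pi_norm (castR y) i).trans (hnorm _)
      rwa [castR, Real.norm_eq_abs] at this
    have h0 : 0 ≤ norm1 y := Finset.sum_nonneg fun _ _ => abs_nonneg _
    have h2 := Real.rpow_le_rpow h0 h1 hk0.le
    rw [Real.mul_rpow (by positivity) (hN0 _)] at h2
    push_cast
    exact h2

end MRARMA

/-! ### The main theorem: drift and accessibility combined -/

theorem mainTheorem1 (p q : ℕ) (α : Fin p → ℝ) (β : Fin q → ℝ)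
    (ν : Measure ℤ) [IsProbabilityMeasure ν]
    (hcharge : ∀ a : ℤ, 0 < ν {a})
    (k : ℝ) (hk : 1 ≤ k) (hmoment : Integrable (fun a : ℤ => |(a : ℝ)| ^ k) ν)
    (hα : ∀ i : Fin p, i.val + 1 = p → α i ≠ 0)
    (hβ : ∀ j : Fin q, j.val + 1 = q → β j ≠ 0)
    (hρ : spectralRadius ℂ ((MRARMA.companion α β).map (algebraMap ℝ ℂ)) < 1) :
    ∃ μ : Measure (MRARMA.State p q),
      IsProbabilityMeasure μ ∧
      (MRARMA.transition α β ν).Invariant μ ∧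
      (∀ μ' : Measure (MRARMA.State p q), IsProbabilityMeasure μ' →
        (MRARMA.transition α β ν).Invariant μ' → μ' = μ) ∧
      Integrable (fun y => MRARMA.norm1 y ^ k) μ ∧
      ∀ (y : MRARMA.State p q) (f : MRARMA.State p q → ℝ), Integrable f μ →
        ∀ᵐ ω ∂(MRARMA.pathLaw α β ν y),
          Tendsto (fun n : ℕ => (1 / (n : ℝ)) * ∑ m ∈ Finset.Icc 1 n, f (ω m)) atTop
            (𝓝 (∫ x, f x ∂μ)) := by
  have hA := MRARMA.tendsto_pow_toLin_of_spectralRadius_lt_one _ hρ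
  obtain ⟨W, ρ, b, hρ1, hW, hdrift, C, hC⟩ := MRARMA.exists_lyapunov hk hmoment hA
  obtain ⟨μ, hμ, hinv, huniq, hfin, hslln⟩ :=
    CountableChain.exists_unique_invariant_and_slln W hW hρ1 hdrift
      (MRARMA.reach_zero hcharge hα hA)
  refine ⟨μ, hμ, hinv, huniq, ?_, hslln⟩
  have hWint : Integrable (fun y => (W y : ℝ)) μ := by
    refine ⟨(measurable_of_countable _).aestronglyMeasurable, ?_⟩
    rw [HasFiniteIntegral]
    simpa using hfin
  refine (hWint.const_mul (C : ℝ)).mono' (measurable_of_countable _).aestronglyMeasurable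
    (Eventually.of_forall fun y => ?_)
  have h0 : 0 ≤ MRARMA.norm1 y := Finset.sum_nonneg fun _ _ => abs_nonneg _
  rw [Real.norm_of_nonneg (Real.rpow_nonneg h0 k)]
  exact hC y
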